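/- **Setting.** For every $n\ge 1$ let $T=T_n\ge 1$, $W=W_n\in\mathbb R^{n\times n}$, $m=m_n\in\mathbb R^n$ and $u=(u_t)_{t\in\mathbb Z}$ a real sequence (which may depend on $n$); let $\eta>0$ be fixed. Put $$A=MU,\qquad M=[m,Wm,\dots,W^{T-1}m]\in\mathbb R^{n\times T},\qquad U=\tfrac1{\sqrt T}\{u_{j-i}\}_{i,j=1}^T,$$ $$S_q=\sum_{k\ge 0}W^{k+(-q)^+}\big(W^{k+q^+}\big)^{\sf T}\ (q\in\mathbb Z),\qquad [J^q]_{ij}=\delta_{i+q,j}\ (1\le i,j\le T),$$ and let $\|\cdot\|$ be the spectral norm. Let $B=B_n\in\mathbb R^{n\times n}$ be symmetric. Assume $\sup_n\|W_n\|<1$, $\sup_n\|AA^{\sf T}\|<\infty$, $\sup_n\|B\|<\infty$, and $n/T\to c\in[0,1)\cup(1,\infty)$ as $n\to\infty$. **Matrices at level $\gamma>0$.** Let $R_\gamma\in\mathbb R^{T\times T}$, $\tilde R_\gamma\in\mathbb R^{n\times n}$ be symmetric positive semidefinite solutions of $$R_\gamma=\Big\{\tfrac1T\operatorname{tr}(S_{i-j}\bar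 Q_\gamma)\Big\}_{i,j=1}^T,\qquad \tilde R_\gamma=\sum_{q\in\mathbb Z}\tfrac1T\operatorname{tr}(J^q\bar{\tilde Q}_\gamma)\,S_q,$$ where $$\bar Q_\gamma=\tfrac1\gamma\Big(I_n+\eta^2\tilde R_\gamma+\tfrac1\gamma A(I_T+\eta^2R_\gamma)^{-1}A^{\sf T}\Big)^{-1},\qquad \bar{\tilde Q}_\gamma=\tfrac1\gamma\Big(I_T+\eta^2R_\gamma+\tfrac1\gamma A^{\sf T}(I_n+\eta^2\tilde R_\gamma)^{-1}A\Big)^{-1},$$ and let $G_\gamma^{[B]}\in\mathbb R^{T\times T}$, $\tilde G_\gamma^{[B]}\in\mathbb R^{n\times n}$ be solutions of $$G_\gamma^{[B]}=\Big\{\tfrac1T\operatorname{tr}\big(S_{i-j}\bar Q_\gamma[B+\tilde G_\gamma^{[B]}]\bar Q_\gamma\big)\Big\}_{i,j=1}^T,\qquad \tilde G_\gamma^{[B]}=\sum_{q\in\mathbb Z}\eta^4\gamma^2\,\tfrac1T\operatorname{tr}\big(J^q\bar{\tilde Q}_\gamma G_\gamma^{[B]}\bar{\tilde Q}_\gamma\big)S_q.$$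 **Limiting systems.** Let $\mathcal R\in\mathbb R^{T\times T}$, $\tilde{\mathcal R}\in\mathbb R^{n\times n}$ be symmetric positive semidefinite solutions, with $\delta_{c>1}I_n+\tilde{\mathcal R}$ and $\delta_{c<1}I_T+\mathcal R$ invertible (here $\delta_{P}$ is $1$ if $P$ holds and $0$ otherwise), of $$\mathcal R=c\Big\{\tfrac1n\operatorname{tr}\big(S_{i-j}(\delta_{c>1}I_n+\tilde{\mathcal R})^{-1}\big)\Big\}_{i,j=1}^T,\qquad \tilde{\mathcal R}=\sum_{q\in\mathbb Z}\tfrac1T\operatorname{tr}\big(J^q(\delta_{c<1}I_T+\mathcal R)^{-1}\big)S_q,$$ and let $\mathcal G^{[B]}\in\mathbb R^{T\times T}$, $\tilde{\mathcal G}^{[B]}\in\mathbb R^{n\times n}$ be solutions of the linear system $$\mathcal G^{[B]}=c\Big\{\tfrac1n\operatorname{tr}\big(S_{i-j}(\delta_{c>1}I_n+\tilde{\mathcal R})^{-1}[B+\tilde{\mathcal G}^{[B]}](\delta_{c>1}I_n+\tilde{\mathcal R})^{-1}\big)\Big\}_{i,j=1}^T,$$ $$\tilde{\mathcal G}^{[B]}=\sum_{q\in\mathbb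 Z}\tfrac1T\operatorname{tr}\big(J^q(\delta_{c<1}I_T+\mathcal R)^{-1}\mathcal G^{[B]}(\delta_{c<1}I_T+\mathcal R)^{-1}\big)S_q.$$ **Claim.** For all large $n$ (and, for the systems at level $\gamma$, for every $\gamma>0$) all these systems have solutions, and for any choice of solutions the following holds. 1. If $c<1$, then, as $\gamma\downarrow0$, $\ \eta^4G_\gamma^{[B]}\to\mathcal G^{[B]}$ and $\tilde G_\gamma^{[B]}\to\tilde{\mathcal G}^{[B]}$. 2. If $c>1$, then, as $\gamma\downarrow0$, $\ \gamma^2G_\gamma^{[B]}\to\mathcal G^{[B]}$ and $\tilde G_\gamma^{[B]}\to\tilde{\mathcal G}^{[B]}$. Here the convergence $F_\gamma\to\mathcal L$ as $\gamma\downarrow0$ of matrices that depend on $n$ means: (a) for all large $n$ the limit $\lim_{\gamma\downarrow0}F_\gamma$ exists; (b) $\|F_\gamma-\mathcal L\|\to0$ as $n\to\infty$ and $\gamma\downarrow0$ jointly, so that in particular $\big\|\lim_{\gamma\downarrow0}F_\gamma-\mathcal L\big\|\to0$ as $n\to\infty$; (c) for all large $n$ such that $A=0$ and $n/T=c$, one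 has exactly $\lim_{\gamma\downarrow0}F_\gamma=\mathcal L$. -/

import Mathlib

open Filter Topology
open scoped Matrix Matrix.Norms.L2Operator

/-! Throughout, `‖·‖` on real matrices is the spectral (`ℓ²` operator) norm. -/

namespace ESN

noncomputable section

/-- `S_q = ∑_{k ≥ 0} W^{k + (-q)⁺} (W^{k + q⁺})ᵀ`, for `q ∈ ℤ`. -/
def S {n : ℕ} (W : Matrix (Fin n) (Fin n) ℝ) (q : ℤ) : Matrix (Fin n) (Fin n) ℝ :=
  ∑' k : ℕ, W ^ (k + (-q).toNat) * (W ^ (k + q.toNat))ᵀ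

/-- The `T × T` shift matrix `[J^q]_{ij} = δ_{i+q,j}`, for `q ∈ ℤ`. -/
def J (T : ℕ) (q : ℤ) : Matrix (Fin T) (Fin T) ℝ :=
  Matrix.of fun i j => if ((i : ℕ) : ℤ) + q = ((j : ℕ) : ℤ) then 1 else 0

/-- The Toeplitz matrix `{ a tr (S_{i-j} Q) }_{i,j=1}^T`. -/
def toeplitzTrace {n : ℕ} (W : Matrix (Fin n) (Fin n) ℝ) (T : ℕ) (a : ℝ)
    (Q : Matrix (Fin n) (Fin n) ℝ) : Matrix (Fin T) (Fin T) ℝ :=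
  Matrix.of fun i j => a * (S W (((i : ℕ) : ℤ) - ((j : ℕ) : ℤ)) * Q).trace

/-- The matrix `∑_{q ∈ ℤ} (1/T) tr (J^q P) S_q`; only the terms with `|q| < T` are nonzero. -/
def shiftSum {n T : ℕ} (W : Matrix (Fin n) (Fin n) ℝ) (P : Matrix (Fin T) (Fin T) ℝ) :
    Matrix (Fin n) (Fin n) ℝ :=
  ∑' q : ℤ, ((1 / (T : ℝ)) * (J T q * P).trace) • S W q

/-- The matrix `M = [m, W m, …, W^{T-1} m]`. -/
def memoryMatrix {n : ℕ} (W : Matrix (Fin n) (Fin n) ℝ) (m : Fin n → ℝ) (T : ℕ) :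
    Matrix (Fin n) (Fin T) ℝ :=
  Matrix.of fun i j => ((W ^ (j : ℕ)) *ᵥ m) i

/-- The matrix `U = T^{-1/2} {u_{j-i}}_{i,j=1}^T`. -/
def inputMatrix (u : ℤ → ℝ) (T : ℕ) : Matrix (Fin T) (Fin T) ℝ :=
  Matrix.of fun i j => (1 / Real.sqrt (T : ℝ)) * u (((j : ℕ) : ℤ) - ((i : ℕ) : ℤ))

/-- The data matrix `A = M U`. -/
def dataMatrix {n : ℕ} (W : Matrix (Fin n) (Fin n) ℝ) (m : Fin n → ℝ) (u : ℤ → ℝ) (T : ℕ) :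
    Matrix (Fin n) (Fin T) ℝ :=
  memoryMatrix W m T * inputMatrix u T

/-- `Q̄_γ = (1/γ) (I_n + η² R̃ + (1/γ) A (I_T + η² R)⁻¹ Aᵀ)⁻¹`. -/
def Qbar {n T : ℕ} (A : Matrix (Fin n) (Fin T) ℝ) (η γ : ℝ)
    (R : Matrix (Fin T) (Fin T) ℝ) (Rt : Matrix (Fin n) (Fin n) ℝ) :
    Matrix (Fin n) (Fin n) ℝ :=
  (1 / γ) • (1 + η ^ 2 • Rt + (1 / γ) • (A * (1 + η ^ 2 • R)⁻¹ * Aᵀ))⁻¹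

/-- The companion `(1/γ) (I_T + η² R + (1/γ) Aᵀ (I_n + η² R̃)⁻¹ A)⁻¹` of `Q̄_γ`. -/
def Qtbar {n T : ℕ} (A : Matrix (Fin n) (Fin T) ℝ) (η γ : ℝ)
    (R : Matrix (Fin T) (Fin T) ℝ) (Rt : Matrix (Fin n) (Fin n) ℝ) :
    Matrix (Fin T) (Fin T) ℝ :=
  (1 / γ) • (1 + η ^ 2 • R + (1 / γ) • (Aᵀ * (1 + η ^ 2 • Rt)⁻¹ * A))⁻¹

/-- `(R_γ, R̃_γ)` is a (positive semidefinite) solution of the first-order system at level `γ`. -/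
structure IsFirstOrder {n T : ℕ} (W : Matrix (Fin n) (Fin n) ℝ) (A : Matrix (Fin n) (Fin T) ℝ)
    (η γ : ℝ) (R : Matrix (Fin T) (Fin T) ℝ) (Rt : Matrix (Fin n) (Fin n) ℝ) : Prop where
  posSemidef : R.PosSemidef
  posSemidef_tilde : Rt.PosSemidef
  eq : R = toeplitzTrace W T (1 / (T : ℝ)) (Qbar A η γ R Rt)
  eq_tilde : Rt = shiftSum W (Qtbar A η γ R Rt)

/-- `(G_γ^{[B]}, G̃_γ^{[B]})` is a solution of the second-order system at level `γ`. -/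
structure IsSecondOrder {n T : ℕ} (W : Matrix (Fin n) (Fin n) ℝ) (A : Matrix (Fin n) (Fin T) ℝ)
    (B : Matrix (Fin n) (Fin n) ℝ) (η γ : ℝ)
    (R : Matrix (Fin T) (Fin T) ℝ) (Rt : Matrix (Fin n) (Fin n) ℝ)
    (G : Matrix (Fin T) (Fin T) ℝ) (Gt : Matrix (Fin n) (Fin n) ℝ) : Prop where
  eq : G = toeplitzTrace W T (1 / (T : ℝ)) (Qbar A η γ R Rt * (B + Gt) * Qbar A η γ R Rt)
  eq_tilde : Gt = (η ^ 4 * γ ^ 2) • shiftSum W (Qtbar A η γ R Rt * G * Qtbar A η γ R Rt)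

/-- The matrix `δ_{c>1} I_n + X`. -/
def shiftGt {n : ℕ} (c : ℝ) (X : Matrix (Fin n) (Fin n) ℝ) : Matrix (Fin n) (Fin n) ℝ :=
  (if 1 < c then (1 : ℝ) else 0) • 1 + X

/-- The matrix `δ_{c<1} I_T + X`. -/
def shiftLt {T : ℕ} (c : ℝ) (X : Matrix (Fin T) (Fin T) ℝ) : Matrix (Fin T) (Fin T) ℝ :=
  (if c < 1 then (1 : ℝ) else 0) • 1 + X

/-- `(𝓡, 𝓡̃)` is a (positive semidefinite) solution of the limiting first-order system; the two
matrices that the system inverts are required to be invertible, hence positive definite. -/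
structure IsLimitFirstOrder {n T : ℕ} (W : Matrix (Fin n) (Fin n) ℝ) (c : ℝ)
    (R : Matrix (Fin T) (Fin T) ℝ) (Rt : Matrix (Fin n) (Fin n) ℝ) : Prop where
  posSemidef : R.PosSemidef
  posSemidef_tilde : Rt.PosSemidef
  posDef_shift : (shiftLt c R).PosDef
  posDef_shift_tilde : (shiftGt c Rt).PosDef
  eq : R = toeplitzTrace W T (c * (1 / (n : ℝ))) (shiftGt c Rt)⁻¹
  eq_tilde : Rt = shiftSum W (shiftLt c R)⁻¹

/-- `(𝓖^{[B]}, 𝓖̃^{[B]})` is a solution of the limiting second-order (linear) system. -/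
structure IsLimitSecondOrder {n T : ℕ} (W B : Matrix (Fin n) (Fin n) ℝ) (c : ℝ)
    (R : Matrix (Fin T) (Fin T) ℝ) (Rt : Matrix (Fin n) (Fin n) ℝ)
    (G : Matrix (Fin T) (Fin T) ℝ) (Gt : Matrix (Fin n) (Fin n) ℝ) : Prop where
  eq : G = toeplitzTrace W T (c * (1 / (n : ℝ)))
    ((shiftGt c Rt)⁻¹ * (B + Gt) * (shiftGt c Rt)⁻¹)
  eq_tilde : Gt = shiftSum W ((shiftLt c R)⁻¹ * G * (shiftLt c R)⁻¹)

/-- Small-`γ` limit, for large `n`, of the matrices `F n γ` of size `d n`, with deterministic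
approximation `L n`:
* for all large `n`, the limit of `F n γ` as `γ ↓ 0` exists;
* `‖F n γ - L n‖ → 0` as `n → ∞` and `γ ↓ 0` jointly, so that in particular the distance in
  spectral norm of `lim_{γ ↓ 0} F n γ` to `L n` vanishes as `n → ∞`;
* for all large `n` for which `E n` holds, the limit of `F n γ` as `γ ↓ 0` is exactly `L n`. -/
def SmallGammaLimit {d : ℕ → ℕ} (E : ℕ → Prop)
    (F : ∀ n, ℝ → Matrix (Fin (d n)) (Fin (d n)) ℝ)
    (L : ∀ n, Matrix (Fin (d n)) (Fin (d n)) ℝ) : Prop :=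
  (∀ᶠ n in atTop, ∃ X, Tendsto (F n) (𝓝[>] 0) (𝓝 X)) ∧
  Tendsto (fun p : ℕ × ℝ => ‖F p.1 p.2 - L p.1‖) (atTop ×ˢ 𝓝[>] 0) (𝓝 0) ∧
  (∀ᶠ n in atTop, E n → Tendsto (F n) (𝓝[>] 0) (𝓝 (L n)))

end

end ESN

namespace ESN

open Matrix
open scoped MatrixOrder

set_option linter.unusedSectionVars false

/-! ### Quadratic forms and the Loewner order on real matrices -/

section Order

variable {ι τ κ : Type*} [Fintype ι] [Fintype τ] [Fintype κ]

theorem quad_nonneg {M : Matrix ι ι ℝ} (hM : 0 ≤ M) (x : ι → ℝ) : 0 ≤ x ⬝ᵥ M *ᵥ x := by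
  simpa using (nonneg_iff_posSemidef.1 hM).dotProduct_mulVec_nonneg x

theorem quad_mono {M N : Matrix ι ι ℝ} (h : M ≤ N) (x : ι → ℝ) :
    x ⬝ᵥ M *ᵥ x ≤ x ⬝ᵥ N *ᵥ x := by
  have := quad_nonneg (sub_nonneg.2 h) x
  rw [sub_mulVec, dotProduct_sub] at this
  linarith

theorem isHermitian_of_nonneg {M : Matrix ι ι ℝ} (hM : 0 ≤ M) : M.IsHermitian :=
  (nonneg_iff_posSemidef.1 hM).1

theorem transpose_of_isHermitian {M : Matrix ι ι ℝ} (hM : M.IsHermitian) : Mᵀ = M := by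
  rw [← conjTranspose_eq_transpose_of_trivial]; exact hM

theorem transpose_of_nonneg {M : Matrix ι ι ℝ} (hM : 0 ≤ M) : Mᵀ = M :=
  transpose_of_isHermitian (isHermitian_of_nonneg hM)

theorem isHermitian_of_transpose {M : Matrix ι ι ℝ} (hM : Mᵀ = M) : M.IsHermitian := by
  rw [IsHermitian, conjTranspose_eq_transpose_of_trivial, hM]

theorem le_of_quad {M N : Matrix ι ι ℝ} (hM : M.IsHermitian) (hN : N.IsHermitian)
    (h : ∀ x, x ⬝ᵥ M *ᵥ x ≤ x ⬝ᵥ N *ᵥ x) : M ≤ N := by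
  refine PosSemidef.of_dotProduct_mulVec_nonneg (hN.sub hM) fun x => ?_
  rw [star_trivial, sub_mulVec, dotProduct_sub]
  linarith [h x]

theorem bilin_comm {M : Matrix ι ι ℝ} (hM : M.IsHermitian) (x y : ι → ℝ) :
    x ⬝ᵥ M *ᵥ y = y ⬝ᵥ M *ᵥ x := by
  rw [dotProduct_mulVec, ← mulVec_transpose, transpose_of_isHermitian hM, dotProduct_comm]

theorem bilin_transpose (M : Matrix ι τ ℝ) (x : ι → ℝ) (y : τ → ℝ) :
    y ⬝ᵥ Mᵀ *ᵥ x = x ⬝ᵥ M *ᵥ y := by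
  rw [mulVec_transpose, dotProduct_mulVec, dotProduct_comm]

theorem bilin_conj (M : Matrix ι ι ℝ) (B : Matrix ι τ ℝ) (x y : τ → ℝ) :
    x ⬝ᵥ (Bᵀ * M * B) *ᵥ y = (B *ᵥ x) ⬝ᵥ M *ᵥ (B *ᵥ y) := by
  rw [← mulVec_mulVec, ← mulVec_mulVec, dotProduct_mulVec, vecMul_transpose]

theorem conj_nonneg {M : Matrix ι ι ℝ} (h : 0 ≤ M) (B : Matrix ι τ ℝ) : 0 ≤ Bᵀ * M * B := by
  have := (nonneg_iff_posSemidef.1 h).conjTranspose_mul_mul_same B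
  rw [conjTranspose_eq_transpose_of_trivial] at this
  exact nonneg_iff_posSemidef.2 this

theorem conj_mono {M N : Matrix ι ι ℝ} (h : M ≤ N) (B : Matrix ι τ ℝ) :
    Bᵀ * M * B ≤ Bᵀ * N * B := by
  have := conj_nonneg (sub_nonneg.2 h) B
  rwa [Matrix.mul_sub, Matrix.sub_mul, sub_nonneg] at this

theorem transpose_mul_self_nonneg (B : Matrix ι τ ℝ) : 0 ≤ Bᵀ * B := by
  have := posSemidef_conjTranspose_mul_self B
  rw [conjTranspose_eq_transpose_of_trivial] at this
  exact nonneg_iff_posSemidef.2 this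

theorem trace_nonneg_of_nonneg {M : Matrix ι ι ℝ} (h : 0 ≤ M) : 0 ≤ M.trace :=
  (nonneg_iff_posSemidef.1 h).trace_nonneg

theorem trace_mono' {M N : Matrix ι ι ℝ} (h : M ≤ N) : M.trace ≤ N.trace := by
  have := trace_nonneg_of_nonneg (sub_nonneg.2 h)
  rw [trace_sub] at this; linarith

variable [DecidableEq ι] [DecidableEq τ]

theorem zero_le_one_mat : (0 : Matrix ι ι ℝ) ≤ 1 := nonneg_iff_posSemidef.2 .one

theorem smul_one_nonneg {a : ℝ} (ha : 0 ≤ a) : (0 : Matrix ι ι ℝ) ≤ a • 1 :=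
  smul_nonneg ha zero_le_one_mat

theorem smul_one_mono {a b : ℝ} (h : a ≤ b) : (a • 1 : Matrix ι ι ℝ) ≤ b • 1 :=
  smul_le_smul_of_nonneg_right h zero_le_one_mat

theorem quad_smul_one (a : ℝ) (x : ι → ℝ) :
    x ⬝ᵥ (a • (1 : Matrix ι ι ℝ)) *ᵥ x = a * (x ⬝ᵥ x) := by
  rw [smul_mulVec, one_mulVec, dotProduct_smul, smul_eq_mul]

theorem posDef_of_le {M N : Matrix ι ι ℝ} (hM : M.PosDef) (h : M ≤ N) : N.PosDef := by
  have := hM.add_posSemidef (le_iff.1 h)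
  rwa [add_sub_cancel] at this

theorem posDef_smul_one {a : ℝ} (ha : 0 < a) : (a • 1 : Matrix ι ι ℝ).PosDef :=
  PosDef.one.smul ha

theorem posDef_of_smul_one_le {a : ℝ} (ha : 0 < a) {M : Matrix ι ι ℝ} (h : a • 1 ≤ M) :
    M.PosDef :=
  posDef_of_le (posDef_smul_one ha) h

theorem posDef_of_one_le {M : Matrix ι ι ℝ} (h : 1 ≤ M) : M.PosDef :=
  posDef_of_le PosDef.one h

theorem PosDef.nonneg {M : Matrix ι ι ℝ} (h : M.PosDef) : 0 ≤ M :=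
  nonneg_iff_posSemidef.2 h.posSemidef

theorem PosDef.inv_nonneg {M : Matrix ι ι ℝ} (h : M.PosDef) : 0 ≤ M⁻¹ :=
  PosDef.nonneg h.inv

theorem PosDef.mul_inv {M : Matrix ι ι ℝ} (h : M.PosDef) : M * M⁻¹ = 1 :=
  Matrix.mul_nonsing_inv _ ((isUnit_iff_isUnit_det _).1 h.isUnit)

theorem PosDef.inv_mul {M : Matrix ι ι ℝ} (h : M.PosDef) : M⁻¹ * M = 1 :=
  Matrix.nonsing_inv_mul _ ((isUnit_iff_isUnit_det _).1 h.isUnit)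

/-- Variational lower bound for the quadratic form of an inverse. -/
theorem two_mul_sub_le_quad_inv {M : Matrix ι ι ℝ} (hM : M.PosDef) (x y : ι → ℝ) :
    2 * (x ⬝ᵥ y) - y ⬝ᵥ M *ᵥ y ≤ x ⬝ᵥ M⁻¹ *ᵥ x := by
  have h := quad_nonneg (PosDef.nonneg hM) (y - M⁻¹ *ᵥ x)
  have e : M *ᵥ (M⁻¹ *ᵥ x) = x := by rw [mulVec_mulVec, PosDef.mul_inv hM, one_mulVec]
  have e2 : (M⁻¹ *ᵥ x) ⬝ᵥ M *ᵥ y = x ⬝ᵥ y := by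
    rw [bilin_comm hM.1, e, dotProduct_comm]
  rw [mulVec_sub, dotProduct_sub, sub_dotProduct, sub_dotProduct, e, e2, dotProduct_comm y x,
    dotProduct_comm (M⁻¹ *ᵥ x) x] at h
  linarith

theorem inv_anti {M N : Matrix ι ι ℝ} (hM : M.PosDef) (h : M ≤ N) : N⁻¹ ≤ M⁻¹ := by
  have hN := posDef_of_le hM h
  refine le_of_quad hN.inv.1 hM.inv.1 fun x => ?_
  have h1 := two_mul_sub_le_quad_inv hM x (N⁻¹ *ᵥ x)
  have h2 := quad_mono h (N⁻¹ *ᵥ x)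
  rw [mulVec_mulVec (M := N), PosDef.mul_inv hN, one_mulVec, dotProduct_comm (N⁻¹ *ᵥ x) x] at h2
  linarith

theorem inv_smul_real {a : ℝ} (ha : a ≠ 0) {M : Matrix ι ι ℝ} (hM : M.PosDef) :
    (a • M)⁻¹ = a⁻¹ • M⁻¹ := by
  apply Matrix.inv_eq_right_inv
  rw [smul_mul_smul_comm, PosDef.mul_inv hM, mul_inv_cancel₀ ha, one_smul]

/-- `M ≤ s N` turns into `N⁻¹ ≤ s M⁻¹`. -/
theorem inv_le_smul_inv {M N : Matrix ι ι ℝ} {s : ℝ} (hs : 0 < s) (hM : M.PosDef)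
    (hN : N.PosDef) (h : M ≤ s • N) : N⁻¹ ≤ s • M⁻¹ := by
  have h1 := inv_anti hM h
  rw [inv_smul_real hs.ne' hN] at h1
  have h2 := smul_le_smul_of_nonneg_left h1 hs.le
  rwa [smul_smul, mul_inv_cancel₀ hs.ne', one_smul] at h2

theorem inv_smul_one {a : ℝ} (ha : 0 < a) : (a • 1 : Matrix ι ι ℝ)⁻¹ = a⁻¹ • 1 := by
  rw [inv_smul_real ha.ne' PosDef.one, inv_one]

theorem inv_le_of_smul_one_le {a : ℝ} (ha : 0 < a) {M : Matrix ι ι ℝ} (h : a • 1 ≤ M) :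
    M⁻¹ ≤ a⁻¹ • 1 := by
  rw [← inv_smul_one ha]
  exact inv_anti (posDef_smul_one ha) h

theorem exists_transpose_mul_self {M : Matrix ι ι ℝ} (hM : 0 ≤ M) :
    ∃ C : Matrix ι ι ℝ, M = Cᵀ * C := by
  refine ⟨CFC.sqrt M, ?_⟩
  have : 0 ≤ CFC.sqrt M := CFC.sqrt_nonneg M
  rw [transpose_of_nonneg this, CFC.sqrt_mul_sqrt_self M hM]

theorem trace_mul_nonneg {M N : Matrix ι ι ℝ} (hM : 0 ≤ M) (hN : 0 ≤ N) :
    0 ≤ (M * N).trace := by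
  obtain ⟨C, rfl⟩ := exists_transpose_mul_self hN
  rw [← Matrix.mul_assoc, Matrix.trace_mul_comm, ← Matrix.mul_assoc]
  have := conj_nonneg hM Cᵀ
  rw [transpose_transpose] at this
  exact trace_nonneg_of_nonneg this

theorem trace_mul_mono_left {M M' N : Matrix ι ι ℝ} (hM : M ≤ M') (hN : 0 ≤ N) :
    (M * N).trace ≤ (M' * N).trace := by
  have := trace_mul_nonneg (sub_nonneg.2 hM) hN
  rw [Matrix.sub_mul, trace_sub] at this; linarith

theorem trace_mul_le {M N : Matrix ι ι ℝ} {a : ℝ} (hM : M ≤ a • 1) (hN : 0 ≤ N) :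
    (M * N).trace ≤ a * N.trace := by
  simpa [smul_mul_assoc, trace_smul] using trace_mul_mono_left hM hN

end Order

/-! ### Domination of a matrix by a positive semidefinite one -/

section Domination

variable {ι τ : Type*} [Fintype ι] [Fintype τ]

/-- `M` is dominated by `D` if `xᵀ M y ≤ (xᵀ D x + yᵀ D y) / 2` for all vectors `x`, `y`. -/
def Dom (M D : Matrix ι ι ℝ) : Prop :=
  ∀ x y : ι → ℝ, x ⬝ᵥ M *ᵥ y ≤ (x ⬝ᵥ D *ᵥ x + y ⬝ᵥ D *ᵥ y) / 2

namespace Dom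

variable {M N D E : Matrix ι ι ℝ}

theorem add (h : Dom M D) (h' : Dom N E) : Dom (M + N) (D + E) := fun x y => by
  have := h x y; have := h' x y
  simp only [add_mulVec, dotProduct_add]; linarith

theorem neg (h : Dom M D) : Dom (-M) D := fun x y => by
  have := h (-x) y
  simpa [neg_mulVec, mulVec_neg] using this

theorem mono (h : Dom M D) (h' : D ≤ E) : Dom M E := fun x y => by
  have := h x y; have := quad_mono h' x; have := quad_mono h' y
  linarith

theorem smul (h : Dom M D) {a : ℝ} (ha : 0 ≤ a) : Dom (a • M) (a • D) := fun x y => by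
  have := mul_le_mul_of_nonneg_left (h x y) ha
  simp only [smul_mulVec, dotProduct_smul, smul_eq_mul]; linarith

theorem conj (h : Dom M D) (B : Matrix ι τ ℝ) : Dom (Bᵀ * M * B) (Bᵀ * D * B) := fun x y => by
  simp only [bilin_conj]; exact h _ _

theorem transpose (h : Dom M D) : Dom Mᵀ D := fun x y => by
  rw [bilin_transpose]; linarith [h y x]

theorem of_sum {α : Type*} (s : Finset α) {f g : α → Matrix ι ι ℝ}
    (h : ∀ a ∈ s, Dom (f a) (g a)) : Dom (∑ a ∈ s, f a) (∑ a ∈ s, g a) := by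
  classical
  induction s using Finset.induction_on with
  | empty => intro x y; simp
  | insert a s ha ih =>
    rw [Finset.sum_insert ha, Finset.sum_insert ha]
    exact (h a (Finset.mem_insert_self _ _)).add
      (ih fun b hb => h b (Finset.mem_insert_of_mem hb))

theorem mul_right (h : Dom M D) (B : Matrix ι ι ℝ) (hD : 0 ≤ D) :
    Dom (M * B) (D + Bᵀ * D * B) := fun x y => by
  have h1 := h x (B *ᵥ y)
  have h2 := quad_nonneg hD y
  have h3 := quad_nonneg (conj_nonneg hD B) x
  rw [← bilin_conj] at h1
  rw [← mulVec_mulVec]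
  simp only [add_mulVec, dotProduct_add]
  linarith

theorem mul_left (h : Dom M D) (B : Matrix ι ι ℝ) (hD : 0 ≤ D) :
    Dom (B * M) (D + B * D * Bᵀ) := by
  have := (h.transpose.mul_right Bᵀ hD).transpose
  rwa [transpose_mul, transpose_transpose, transpose_transpose] at this

variable [DecidableEq ι]

theorem of_le (hM : M.IsHermitian) (h1 : -D ≤ M) (h2 : M ≤ D) : Dom M D := fun x y => by
  have h3 := quad_mono h2 (x + y)
  have h4 := quad_mono h1 (x - y)
  have h5 := bilin_comm hM x y
  have h6 : x ⬝ᵥ D *ᵥ x + y ⬝ᵥ D *ᵥ y =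
    ((x + y) ⬝ᵥ D *ᵥ (x + y) + (x - y) ⬝ᵥ D *ᵥ (x - y)) / 2 := by
    simp only [mulVec_add, mulVec_sub, dotProduct_add, dotProduct_sub, add_dotProduct,
      sub_dotProduct]; ring
  have h7 : 4 * (x ⬝ᵥ M *ᵥ y) = (x + y) ⬝ᵥ M *ᵥ (x + y) - (x - y) ⬝ᵥ M *ᵥ (x - y) := by
    simp only [mulVec_add, mulVec_sub, dotProduct_add, dotProduct_sub, add_dotProduct,
      sub_dotProduct]; linarith
  rw [neg_mulVec, dotProduct_neg] at h4
  rw [h6]; linarith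

theorem of_nonneg (hM : 0 ≤ M) : Dom M M :=
  of_le (isHermitian_of_nonneg hM) ((neg_nonpos.2 hM).trans hM) le_rfl

theorem norm_le {a : ℝ} (ha : 0 ≤ a) (h : Dom M (a • 1)) : ‖M‖ ≤ a := by
  rw [cstar_norm_def]
  refine ContinuousLinearMap.opNorm_le_of_re_inner_le ha fun x y hx hy => ?_
  rw [RCLike.re_to_real, real_inner_comm, inner_toEuclideanCLM]
  have h1 := h y.ofLp x.ofLp
  have hn : ∀ z : EuclideanSpace ℝ ι, ‖z‖ = 1 → z.ofLp ⬝ᵥ z.ofLp = 1 := fun z hz => by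
    have := EuclideanSpace.real_norm_sq_eq z
    rw [hz] at this
    simp only [dotProduct, ← sq]
    simpa using this.symm
  rw [quad_smul_one, quad_smul_one, hn x hx, hn y hy] at h1
  linarith

end Dom

variable [DecidableEq ι]

theorem dotProduct_mulVec_self_le {M : Matrix τ ι ℝ} {ρ : ℝ} (h : ‖M‖ ≤ ρ) (x : ι → ℝ) :
    (M *ᵥ x) ⬝ᵥ (M *ᵥ x) ≤ ρ ^ 2 * (x ⬝ᵥ x) := by
  have h1 := l2_opNorm_mulVec M (WithLp.toLp 2 x)
  have h2 : ‖(WithLp.toLp 2 (M *ᵥ x) : EuclideanSpace ℝ τ)‖ ≤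
      ρ * ‖(WithLp.toLp 2 x : EuclideanSpace ℝ ι)‖ :=
    h1.trans (mul_le_mul_of_nonneg_right h (norm_nonneg _))
  have h3 := pow_le_pow_left₀ (norm_nonneg _) h2 2
  rw [mul_pow, EuclideanSpace.real_norm_sq_eq, EuclideanSpace.real_norm_sq_eq] at h3
  simpa [dotProduct, ← sq] using h3

theorem Dom.of_norm_le {M : Matrix ι ι ℝ} {a : ℝ} (h : ‖M‖ ≤ a) : Dom M (a • 1) := fun x y => by
  have ha : 0 ≤ a := (norm_nonneg _).trans h
  have h1 := dotProduct_mulVec_self_le h y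
  rw [quad_smul_one, quad_smul_one]
  have h2 : 2 * (x ⬝ᵥ M *ᵥ y) * a ≤ a ^ 2 * (x ⬝ᵥ x) + (M *ᵥ y) ⬝ᵥ (M *ᵥ y) := by
    have : 0 ≤ (a • x - M *ᵥ y) ⬝ᵥ (a • x - M *ᵥ y) := by
      simpa [dotProduct] using Finset.sum_nonneg fun i _ =>
        mul_self_nonneg ((a • x - M *ᵥ y) i)
    simp only [sub_dotProduct, dotProduct_sub, smul_dotProduct, dotProduct_smul, smul_eq_mul,
      dotProduct_comm (M *ᵥ y) x] at this
    linarith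
  rcases ha.eq_or_lt with h0 | h0
  · subst h0
    have : M = 0 := norm_le_zero_iff.1 h
    simp [this]
  · nlinarith

theorem norm_le_of_nonneg_of_le {M : Matrix ι ι ℝ} {a : ℝ} (ha : 0 ≤ a) (h0 : 0 ≤ M)
    (h : M ≤ a • 1) : ‖M‖ ≤ a :=
  ((Dom.of_nonneg h0).mono h).norm_le ha

theorem le_norm_smul_one {M : Matrix ι ι ℝ} {a : ℝ} (hM : M.IsHermitian) (h : ‖M‖ ≤ a) :
    M ≤ a • 1 := by
  refine le_of_quad hM (isHermitian_of_nonneg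
    (smul_one_nonneg ((norm_nonneg _).trans h))) fun x => ?_
  have := Dom.of_norm_le h x x
  linarith

theorem transpose_mul_self_le {M : Matrix τ ι ℝ} {a : ℝ} (h : ‖M‖ ≤ a) :
    Mᵀ * M ≤ a ^ 2 • 1 := by
  refine le_of_quad (isHermitian_of_nonneg (transpose_mul_self_nonneg M))
    (isHermitian_of_nonneg (smul_one_nonneg (sq_nonneg a))) fun x => ?_
  rw [quad_smul_one, ← mulVec_mulVec, dotProduct_mulVec, vecMul_transpose]
  exact dotProduct_mulVec_self_le h x

theorem trace_conj_le [DecidableEq τ] {D : Matrix ι ι ℝ} (hD : 0 ≤ D) {B : Matrix ι τ ℝ} {b : ℝ}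
    (hB : ‖B‖ ≤ b) : (Bᵀ * D * B).trace ≤ b ^ 2 * D.trace := by
  have h : ‖Bᵀ‖ ≤ b := by
    rw [← conjTranspose_eq_transpose_of_trivial, l2_opNorm_conjTranspose]; exact hB
  have h1 := trace_mul_le (transpose_mul_self_le h) hD
  rwa [transpose_transpose, Matrix.mul_assoc, Matrix.trace_mul_comm] at h1

end Domination

section Resolvent

variable {ι τ : Type*} [Fintype ι] [Fintype τ] [DecidableEq ι] [DecidableEq τ]

/-- The resolvent-type matrix `(Z + Aᵀ V⁻¹ A)⁻¹`. -/
noncomputable def res (A : Matrix ι τ ℝ) (V : Matrix ι ι ℝ) (Z : Matrix τ τ ℝ) : Matrix τ τ ℝ :=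
  (Z + Aᵀ * V⁻¹ * A)⁻¹

variable {A : Matrix ι τ ℝ} {V V' : Matrix ι ι ℝ} {Z Z' : Matrix τ τ ℝ}

theorem le_resCore (hV : V.PosDef) (A : Matrix ι τ ℝ) (Z : Matrix τ τ ℝ) :
    Z ≤ Z + Aᵀ * V⁻¹ * A :=
  le_add_of_nonneg_right (conj_nonneg (PosDef.inv_nonneg hV) A)

theorem posDef_resCore (hV : V.PosDef) (hZ : Z.PosDef) : (Z + Aᵀ * V⁻¹ * A).PosDef :=
  posDef_of_le hZ (le_resCore hV A Z)

theorem res_zero : res (0 : Matrix ι τ ℝ) V Z = Z⁻¹ := by simp [res]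

theorem posDef_res (hV : V.PosDef) (hZ : Z.PosDef) : (res A V Z).PosDef :=
  (posDef_resCore hV hZ).inv

theorem res_nonneg (hV : V.PosDef) (hZ : Z.PosDef) : 0 ≤ res A V Z :=
  PosDef.nonneg (posDef_res hV hZ)

theorem res_le_inv (hV : V.PosDef) (hZ : Z.PosDef) : res A V Z ≤ Z⁻¹ :=
  inv_anti hZ (le_resCore hV A Z)

theorem res_le_smul_one (hV : V.PosDef) {a : ℝ} (ha : 0 < a) (hZ : a • 1 ≤ Z) :
    res A V Z ≤ a⁻¹ • 1 :=
  (res_le_inv hV (posDef_of_smul_one_le ha hZ)).trans (inv_le_of_smul_one_le ha hZ)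

theorem res_mul_transpose_mul_inv (hV : V.PosDef) (hZ : Z.PosDef) :
    res A V Z * Aᵀ * V⁻¹ = Z⁻¹ * Aᵀ * res Aᵀ Z V := by
  have h1 : Aᵀ * V⁻¹ * (V + A * Z⁻¹ * Aᵀ) = (Z + Aᵀ * V⁻¹ * A) * Z⁻¹ * Aᵀ := by
    rw [Matrix.mul_add, Matrix.add_mul, Matrix.add_mul, Matrix.mul_assoc Aᵀ, PosDef.inv_mul hV,
      PosDef.mul_inv hZ]
    simp only [Matrix.mul_assoc, Matrix.mul_one, Matrix.one_mul]
  have hQ := posDef_resCore (A := Aᵀ) hZ hV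
  have hP := posDef_resCore (A := A) hV hZ
  rw [transpose_transpose] at hQ
  calc res A V Z * Aᵀ * V⁻¹
      = res A V Z * (Aᵀ * V⁻¹ * (V + A * Z⁻¹ * Aᵀ)) * (V + A * Z⁻¹ * Aᵀ)⁻¹ := by
        rw [Matrix.mul_assoc (res A V Z) (_ * _), Matrix.mul_assoc (Aᵀ * V⁻¹), PosDef.mul_inv hQ,
          Matrix.mul_one, Matrix.mul_assoc (res A V Z)]
    _ = (res A V Z * (Z + Aᵀ * V⁻¹ * A)) * Z⁻¹ * Aᵀ * (V + A * Z⁻¹ * Aᵀ)⁻¹ := by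
        rw [h1]; simp only [Matrix.mul_assoc]
    _ = _ := by
        rw [res, PosDef.inv_mul hP, Matrix.one_mul, res, transpose_transpose]

theorem res_mul_self (hV : V.PosDef) (hZ : Z.PosDef) :
    res A V Z * Z = 1 - Z⁻¹ * Aᵀ * res Aᵀ Z V * A := by
  have hP := posDef_resCore (A := A) hV hZ
  rw [← res_mul_transpose_mul_inv hV hZ, eq_sub_iff_add_eq, Matrix.mul_assoc _ Aᵀ,
    Matrix.mul_assoc _ _ A, ← Matrix.mul_add, res, PosDef.inv_mul hP]

theorem inv_sub_res (hV : V.PosDef) (hZ : Z.PosDef) :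
    Z⁻¹ - res A V Z = (Z⁻¹)ᵀ * (Aᵀ * res Aᵀ Z V * A) * Z⁻¹ := by
  have h := congrArg (· * Z⁻¹) (res_mul_self (A := A) hV hZ)
  simp only [Matrix.mul_assoc, PosDef.mul_inv hZ, Matrix.mul_one, Matrix.sub_mul,
    Matrix.one_mul] at h
  rw [h, transpose_of_nonneg (PosDef.inv_nonneg hZ)]
  simp only [Matrix.mul_assoc, sub_sub_cancel]

theorem trace_res_mul (hV : V.PosDef) (hZ : Z.PosDef) :
    (res A V Z * Z).trace - Fintype.card τ = (res Aᵀ Z V * V).trace - Fintype.card ι := by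
  have hP := posDef_resCore (A := Aᵀ) hZ hV
  have h2 : res Aᵀ Z V * V = 1 - res Aᵀ Z V * (A * Z⁻¹ * Aᵀ) := by
    rw [transpose_transpose] at hP
    rw [eq_sub_iff_add_eq, ← Matrix.mul_add, res, transpose_transpose, PosDef.inv_mul hP]
  rw [res_mul_self hV hZ, h2, trace_sub, trace_sub, trace_one, trace_one]
  have : (Z⁻¹ * Aᵀ * res Aᵀ Z V * A).trace = (res Aᵀ Z V * (A * Z⁻¹ * Aᵀ)).trace := by
    rw [Matrix.mul_assoc (Z⁻¹ * Aᵀ), Matrix.trace_mul_comm]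
    simp only [Matrix.mul_assoc]
  rw [this]; ring

theorem res_conj_le (hV : V.PosDef) (hZ : Z.PosDef) :
    (res A V Z)ᵀ * Z * res A V Z ≤ res A V Z := by
  have h := conj_mono (le_resCore hV A Z) (res A V Z)
  refine h.trans_eq ?_
  rw [transpose_of_nonneg (res_nonneg hV hZ), res,
    PosDef.inv_mul (posDef_resCore hV hZ), Matrix.one_mul]

theorem res_le_smul_res (hV : V.PosDef) (hZ : Z.PosDef) (hV' : V'.PosDef) (hZ' : Z'.PosDef)
    {s : ℝ} (hs : 0 < s) (h1 : Z' ≤ s • Z) (h2 : V ≤ s • V') :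
    res A V Z ≤ s • res A V' Z' := by
  refine inv_le_smul_inv hs (posDef_resCore hV' hZ') (posDef_resCore hV hZ) ?_
  have h3 := conj_mono (inv_le_smul_inv hs hV hV' h2) A
  rw [smul_add]
  refine add_le_add h1 (h3.trans_eq ?_)
  simp

theorem trace_inv_sub_res_le (hV : V.PosDef) (hZ : Z.PosDef) {p q F : ℝ} (hp : 0 ≤ p) (hq : 0 ≤ q)
    (hZp : Z⁻¹ ≤ p • 1) (hQ : res Aᵀ Z V ≤ q • 1) (hA : (A * Aᵀ).trace ≤ F) :
    (Z⁻¹ - res A V Z).trace ≤ p ^ 2 * (q * F) := by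
  rw [inv_sub_res hV hZ]
  have hQ0 : 0 ≤ res Aᵀ Z V := res_nonneg hZ hV
  refine (trace_conj_le (conj_nonneg hQ0 A)
    (norm_le_of_nonneg_of_le hp (PosDef.inv_nonneg hZ) hZp)).trans ?_
  refine mul_le_mul_of_nonneg_left ?_ (sq_nonneg p)
  have h0 : 0 ≤ A * Aᵀ := by simpa using transpose_mul_self_nonneg Aᵀ
  have := trace_mul_le hQ h0
  rw [← Matrix.mul_assoc, Matrix.trace_mul_comm, ← Matrix.mul_assoc] at this
  exact this.trans (mul_le_mul_of_nonneg_left hA hq)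

end Resolvent

section DualPair

variable {ι τ : Type*} [Fintype ι] [Fintype τ] [DecidableEq ι] [DecidableEq τ]

/-- A pair of mutually adjoint, domination preserving linear maps between matrix algebras, which
both map a positive semidefinite matrix to a matrix comparable with its trace. -/
structure DualPair (Φ : Matrix ι ι ℝ →ₗ[ℝ] Matrix τ τ ℝ) (Ψ : Matrix τ τ ℝ →ₗ[ℝ] Matrix ι ι ℝ)
    (k C : ℝ) : Prop where
  k_pos : 0 < k
  C_nonneg : 0 ≤ C
  dom_left : ∀ {M D}, Dom M D → Dom (Φ M) (Φ D)
  dom_right : ∀ {M D}, Dom M D → Dom (Ψ M) (Ψ D)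
  lower_left : ∀ {M}, 0 ≤ M → (k * M.trace) • 1 ≤ Φ M
  lower_right : ∀ {M}, 0 ≤ M → (k * M.trace) • 1 ≤ Ψ M
  upper_left : ∀ {M}, 0 ≤ M → Φ M ≤ (C * M.trace) • 1
  upper_right : ∀ {M}, 0 ≤ M → Ψ M ≤ (C * M.trace) • 1
  adj : ∀ {M N}, 0 ≤ M → 0 ≤ N → (Φ M * N).trace = (M * Ψ N).trace

namespace DualPair

variable {Φ : Matrix ι ι ℝ →ₗ[ℝ] Matrix τ τ ℝ} {Ψ : Matrix τ τ ℝ →ₗ[ℝ] Matrix ι ι ℝ} {k C : ℝ}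

theorem symm (h : DualPair Φ Ψ k C) : DualPair Ψ Φ k C where
  k_pos := h.k_pos
  C_nonneg := h.C_nonneg
  dom_left := h.dom_right
  dom_right := h.dom_left
  lower_left := h.lower_right
  lower_right := h.lower_left
  upper_left := h.upper_right
  upper_right := h.upper_left
  adj := fun hM hN => by rw [Matrix.trace_mul_comm, ← h.adj hN hM, Matrix.trace_mul_comm]

theorem map_nonneg (h : DualPair Φ Ψ k C) {M : Matrix ι ι ℝ} (hM : 0 ≤ M) : 0 ≤ Φ M :=
  (smul_one_nonneg (mul_nonneg h.k_pos.le (trace_nonneg_of_nonneg hM))).trans (h.lower_left hM)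

theorem map_mono (h : DualPair Φ Ψ k C) {M N : Matrix ι ι ℝ} (hM : M ≤ N) : Φ M ≤ Φ N := by
  have := h.map_nonneg (sub_nonneg.2 hM)
  rwa [map_sub, sub_nonneg] at this

theorem map_le (h : DualPair Φ Ψ k C) {M : Matrix ι ι ℝ} (hM : 0 ≤ M) {b : ℝ}
    (hb : M.trace ≤ b) : Φ M ≤ (C * b) • 1 :=
  (h.upper_left hM).trans (smul_one_mono (mul_le_mul_of_nonneg_left hb h.C_nonneg))

theorem le_map (h : DualPair Φ Ψ k C) {M : Matrix ι ι ℝ} (hM : 0 ≤ M) {b : ℝ}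
    (hb : b ≤ M.trace) : (k * b) • 1 ≤ Φ M :=
  (smul_one_mono (mul_le_mul_of_nonneg_left hb h.k_pos.le)).trans (h.lower_left hM)

theorem map_dom_smul_one (h : DualPair Φ Ψ k C) {M D : Matrix ι ι ℝ} (hM : Dom M D) (hD : 0 ≤ D)
    {b : ℝ} (hb : D.trace ≤ b) : Dom (Φ M) ((C * b) • 1) :=
  (h.dom_left hM).mono (h.map_le hD hb)

end DualPair

theorem trace_le_of_le_smul_one {M : Matrix ι ι ℝ} {b : ℝ} (h : M ≤ b • 1) :
    M.trace ≤ b * Fintype.card ι := by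
  simpa [trace_smul, trace_one] using trace_mono' h

end DualPair

section FirstOrder

variable {ι τ : Type*} [Fintype ι] [Fintype τ] [DecidableEq ι] [DecidableEq τ]
  {Φ : Matrix ι ι ℝ →ₗ[ℝ] Matrix τ τ ℝ} {Ψ : Matrix τ τ ℝ →ₗ[ℝ] Matrix ι ι ℝ} {k C : ℝ}

/-- Positive definite solutions of the coupled system
`V = β + Ψ (Z + Aᵀ V⁻¹ A)⁻¹`, `Z = 1 + t Φ (V + A Z⁻¹ Aᵀ)⁻¹`. -/
structure IsSol (Φ : Matrix ι ι ℝ →ₗ[ℝ] Matrix τ τ ℝ) (Ψ : Matrix τ τ ℝ →ₗ[ℝ] Matrix ι ι ℝ)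
    (t β : ℝ) (A : Matrix ι τ ℝ) (V : Matrix ι ι ℝ) (Z : Matrix τ τ ℝ) : Prop where
  posDef_left : V.PosDef
  posDef_right : Z.PosDef
  eq_left : V = β • 1 + Ψ (res A V Z)
  eq_right : Z = 1 + t • Φ (res Aᵀ Z V)

namespace IsSol

variable {t β : ℝ} {A : Matrix ι τ ℝ} {V : Matrix ι ι ℝ} {Z : Matrix τ τ ℝ}

theorem one_le (h : IsSol Φ Ψ t β A V Z) (hD : DualPair Φ Ψ k C) (ht : 0 ≤ t) : 1 ≤ Z := by
  rw [h.eq_right]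
  exact le_add_of_nonneg_right (smul_nonneg ht
    (hD.map_nonneg (res_nonneg h.posDef_right h.posDef_left)))

theorem smul_one_le (h : IsSol Φ Ψ t β A V Z) (hD : DualPair Φ Ψ k C) : β • 1 ≤ V := by
  rw [h.eq_left]
  exact le_add_of_nonneg_right (hD.symm.map_nonneg (res_nonneg h.posDef_left h.posDef_right))

theorem res_le_one (h : IsSol Φ Ψ t β A V Z) (hD : DualPair Φ Ψ k C) (ht : 0 ≤ t) :
    res A V Z ≤ 1 := by
  have := res_le_smul_one (A := A) h.posDef_left one_pos
    (by simpa using h.one_le hD ht)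
  simpa using this

theorem trace_res_eq (h : IsSol Φ Ψ t β A V Z) (hD : DualPair Φ Ψ k C) (htA : t = 1 ∨ A = 0) :
    (res A V Z).trace - t * β * (res Aᵀ Z V).trace =
      Fintype.card τ - t * Fintype.card ι := by
  have hP : 0 ≤ res A V Z := res_nonneg h.posDef_left h.posDef_right
  have hQ : 0 ≤ res Aᵀ Z V := res_nonneg h.posDef_right h.posDef_left
  have hadj := hD.adj hQ hP
  have h1 : (res A V Z * Z).trace =
      (res A V Z).trace + t * (res Aᵀ Z V * Ψ (res A V Z)).trace := by
    refine (congrArg (fun X => (res A V Z * X).trace) h.eq_right).trans ?_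
    rw [Matrix.mul_add, Matrix.mul_one, trace_add, Matrix.mul_smul, trace_smul,
      Matrix.trace_mul_comm, hadj, smul_eq_mul]
  have h2 : (res Aᵀ Z V * V).trace =
      β * (res Aᵀ Z V).trace + (res Aᵀ Z V * Ψ (res A V Z)).trace := by
    refine (congrArg (fun X => (res Aᵀ Z V * X).trace) h.eq_left).trans ?_
    rw [Matrix.mul_add, Matrix.mul_smul, Matrix.mul_one, trace_add, trace_smul,
      smul_eq_mul]
  have h3 := trace_res_mul (A := A) h.posDef_left h.posDef_right
  rcases htA with rfl | rfl
  · linear_combination -h1 + h2 + h3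
  · have e : (res (0 : Matrix ι τ ℝ)ᵀ Z V * V).trace = Fintype.card ι := by
      rw [transpose_zero, res_zero, PosDef.inv_mul h.posDef_left, trace_one]
    linear_combination -h1 + t * h2 + h3 + (1 - t) * e

theorem le_trace_res (h : IsSol Φ Ψ t β A V Z) (hD : DualPair Φ Ψ k C) (htA : t = 1 ∨ A = 0)
    (ht : 0 ≤ t) (hβ : 0 ≤ β) :
    Fintype.card τ - t * Fintype.card ι ≤ (res A V Z).trace := by
  have := h.trace_res_eq hD htA
  have h2 : 0 ≤ t * β * (res Aᵀ Z V).trace := mul_nonneg (mul_nonneg ht hβ)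
    (trace_nonneg_of_nonneg (res_nonneg h.posDef_right h.posDef_left))
  linarith

end IsSol

/-- Approximate solutions, up to `ε`, of the system with `t = 1` and `β = 0`, together with a priori
bounds. -/
structure IsApproxSol (Φ : Matrix ι ι ℝ →ₗ[ℝ] Matrix τ τ ℝ) (Ψ : Matrix τ τ ℝ →ₗ[ℝ] Matrix ι ι ℝ)
    (A : Matrix ι τ ℝ) (ε v₀ v₁ z : ℝ) (V : Matrix ι ι ℝ) (Z : Matrix τ τ ℝ) : Prop where
  lower_left : v₀ • 1 ≤ V
  upper_left : V ≤ v₁ • 1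
  lower_right : 1 ≤ Z
  upper_right : Z ≤ z • 1
  le_left : V ≤ Ψ (res A V Z) + ε • 1
  ge_left : Ψ (res A V Z) ≤ V + ε • 1
  le_right : Z ≤ 1 + Φ (res Aᵀ Z V) + ε • 1
  ge_right : 1 + Φ (res Aᵀ Z V) ≤ Z + ε • 1

theorem quad_add {M N : Matrix ι ι ℝ} (x : ι → ℝ) :
    x ⬝ᵥ (M + N) *ᵥ x = x ⬝ᵥ M *ᵥ x + x ⬝ᵥ N *ᵥ x := by
  rw [add_mulVec, dotProduct_add]

theorem quad_smul {M : Matrix ι ι ℝ} (a : ℝ) (x : ι → ℝ) :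
    x ⬝ᵥ (a • M) *ᵥ x = a * (x ⬝ᵥ M *ᵥ x) := by
  rw [smul_mulVec, dotProduct_smul, smul_eq_mul]

theorem quad_one (x : ι → ℝ) : x ⬝ᵥ (1 : Matrix ι ι ℝ) *ᵥ x = x ⬝ᵥ x := by
  rw [one_mulVec]

theorem dotProduct_self_nonneg' (x : ι → ℝ) : 0 ≤ x ⬝ᵥ x := by
  simpa using quad_nonneg zero_le_one_mat x

namespace IsApproxSol

variable {A : Matrix ι τ ℝ} {ε v₀ v₁ z a s : ℝ} {V₁ V₂ : Matrix ι ι ℝ} {Z₁ Z₂ : Matrix τ τ ℝ}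

theorem posDef_left {V : Matrix ι ι ℝ} {Z : Matrix τ τ ℝ} (h : IsApproxSol Φ Ψ A ε v₀ v₁ z V Z)
    (hv : 0 < v₀) : V.PosDef := posDef_of_smul_one_le hv h.lower_left

theorem posDef_right {V : Matrix ι ι ℝ} {Z : Matrix τ τ ℝ} (h : IsApproxSol Φ Ψ A ε v₀ v₁ z V Z) :
    Z.PosDef := posDef_of_one_le h.lower_right

theorem improve (hD : DualPair Φ Ψ k C) (hv : 0 < v₀) (hz : 1 ≤ z) (ha : 0 ≤ a)
    (hA : Aᵀ * A ≤ a • 1) (hε : 0 ≤ ε)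
    (h₁ : IsApproxSol Φ Ψ A ε v₀ v₁ z V₁ Z₁) (h₂ : IsApproxSol Φ Ψ A ε v₀ v₁ z V₂ Z₂)
    (hs : 1 ≤ s) (hε1 : ε ≤ 1) (hZ : Z₂ ≤ s • Z₁) (hV : V₁ ≤ s • V₂) :
    Z₂ ≤ (s - (1 + a / v₀)⁻¹ * z⁻¹ * (s - 1) + ε * (2 + 4 / v₀) * s) • Z₁ ∧
    V₁ ≤ (s - (1 + a / v₀)⁻¹ * z⁻¹ * (s - 1) + ε * (2 + 4 / v₀) * s) • V₂ := by
  have hs0 : 0 < s := by linarith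
  have hz0 : 0 < z := by linarith
  have hV₁ := h₁.posDef_left hv
  have hV₂ := h₂.posDef_left hv
  have hZ₁ := h₁.posDef_right
  have hZ₂ := h₂.posDef_right
  set d : ℝ := (1 + a / v₀)⁻¹ with hd
  have hav : 0 ≤ a / v₀ := by positivity
  have hd0 : 0 < d := by positivity
  have hda : d * (1 + a / v₀) = 1 := inv_mul_cancel₀ (by positivity)
  have hd1 : d ≤ 1 := by nlinarith
  set w : ℝ := z⁻¹ * (s - 1) with hw
  have hw0 : 0 ≤ w := mul_nonneg (by positivity) (by linarith)
  have hww : w ≤ s - 1 := by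
    have : z⁻¹ ≤ 1 := inv_le_one_of_one_le₀ hz
    nlinarith
  have hdw : d * z⁻¹ * (s - 1) = d * w := by rw [hw]; ring
  rw [hdw]
  have hQ : Φ (res Aᵀ Z₂ V₂) ≤ s • Φ (res Aᵀ Z₁ V₁) := by
    rw [← map_smul]
    exact hD.map_mono (res_le_smul_res hZ₂ hV₂ hZ₁ hV₁ hs0 hV hZ)
  have hzZ : ∀ x, w * (x ⬝ᵥ Z₁ *ᵥ x) ≤ (s - 1) * (x ⬝ᵥ x) := fun x => by
    have h3 := quad_mono h₁.upper_right x
    rw [quad_smul_one] at h3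
    have h4 := mul_le_mul_of_nonneg_left h3 hw0
    have : w * (z * (x ⬝ᵥ x)) = (s - 1) * (x ⬝ᵥ x) := by
      rw [hw]; field_simp
    linarith
  -- first improvement, of the comparison of `Z`
  have hZ' : ∀ x, x ⬝ᵥ Z₂ *ᵥ x ≤ (s - w + ε * (1 + s)) * (x ⬝ᵥ Z₁ *ᵥ x) := fun x => by
    have h1 := quad_mono h₂.le_right x
    have h2 := quad_mono h₁.ge_right x
    have h3 := quad_mono hQ x
    have h4 := hzZ x
    have h5 := quad_mono h₁.lower_right x
    simp only [quad_add, quad_smul, quad_one] at h1 h2 h3 h5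
    have h6 := mul_le_mul_of_nonneg_left h2 hs0.le
    have h7 := mul_le_mul_of_nonneg_left h5 (mul_nonneg hε (by linarith : 0 ≤ 1 + s))
    nlinarith
  -- the matrix `Aᵀ V₁⁻¹ A` is bounded by a multiple of `Z₁`
  have hN : ∀ x, x ⬝ᵥ (Aᵀ * V₁⁻¹ * A) *ᵥ x ≤ a / v₀ * (x ⬝ᵥ Z₁ *ᵥ x) := fun x => by
    have h1 := quad_mono (conj_mono (inv_le_of_smul_one_le hv h₁.lower_left) A) x
    have h2 := quad_mono hA x
    have h3 := quad_mono h₁.lower_right x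
    have e : Aᵀ * (v₀⁻¹ • (1 : Matrix ι ι ℝ)) * A = v₀⁻¹ • (Aᵀ * A) := by simp
    rw [e] at h1
    simp only [quad_smul, quad_one] at h1 h2 h3
    have h4 : v₀⁻¹ * (x ⬝ᵥ (Aᵀ * A) *ᵥ x) ≤ v₀⁻¹ * (a * (x ⬝ᵥ Z₁ *ᵥ x)) :=
      mul_le_mul_of_nonneg_left (h2.trans (mul_le_mul_of_nonneg_left h3 ha)) (by positivity)
    calc _ ≤ _ := h1
      _ ≤ _ := h4
      _ = _ := by rw [div_eq_mul_inv]; ring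
  set s' : ℝ := s - d * w + ε * (1 + s) with hs'
  have hs'1 : 1 ≤ s' := by
    have : 0 ≤ ε * (1 + s) := mul_nonneg hε (by linarith)
    nlinarith
  have hcore : Z₂ + Aᵀ * V₂⁻¹ * A ≤ s' • (Z₁ + Aᵀ * V₁⁻¹ * A) := by
    refine le_of_quad (posDef_resCore hV₂ hZ₂).1
      (isHermitian_of_nonneg (smul_nonneg (by linarith)
        (PosDef.nonneg (posDef_resCore hV₁ hZ₁)))) fun x => ?_
    have h1 := quad_mono (conj_mono (inv_le_smul_inv hs0 hV₁ hV₂ hV) A) x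
    have e : Aᵀ * (s • V₁⁻¹) * A = s • (Aᵀ * V₁⁻¹ * A) := by simp
    rw [e] at h1
    simp only [quad_add, quad_smul] at h1 ⊢
    have h2 := hZ' x
    have h3 := hN x
    have h4 := quad_nonneg (conj_nonneg (PosDef.inv_nonneg hV₁) A) x
    have h5 : 0 ≤ ε * (1 + s) * (x ⬝ᵥ (Aᵀ * V₁⁻¹ * A) *ᵥ x) := by positivity
    have h6 := mul_le_mul_of_nonneg_left h3 (mul_nonneg hd0.le hw0)
    have h7 : d * w * (a / v₀ * (x ⬝ᵥ Z₁ *ᵥ x)) = (w - d * w) * (x ⬝ᵥ Z₁ *ᵥ x) := by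
      linear_combination (w * (x ⬝ᵥ Z₁ *ᵥ x)) * hda
    rw [hs']
    linarith
  have hP : Ψ (res A V₁ Z₁) ≤ s' • Ψ (res A V₂ Z₂) := by
    rw [← map_smul]
    exact hD.symm.map_mono (inv_le_smul_inv (by linarith) (posDef_resCore hV₂ hZ₂)
      (posDef_resCore hV₁ hZ₁) hcore)
  have h4v : 0 ≤ ε * (4 / v₀) * s := by positivity
  have hεs : 0 ≤ ε * (s - 1) := mul_nonneg hε (by linarith)
  have hdw1 : d * w ≤ w := by nlinarith
  constructor
  · refine le_of_quad hZ₂.1 (isHermitian_of_nonneg (smul_nonneg ?_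
      (PosDef.nonneg hZ₁))) fun x => ?_
    · nlinarith
    · rw [quad_smul]
      refine (hZ' x).trans (mul_le_mul_of_nonneg_right ?_ (quad_nonneg (PosDef.nonneg hZ₁) x))
      nlinarith
  · refine le_of_quad hV₁.1 (isHermitian_of_nonneg (smul_nonneg ?_
      (PosDef.nonneg hV₂))) fun x => ?_
    · nlinarith
    · have h1 := quad_mono h₁.le_left x
      have h2 := quad_mono h₂.ge_left x
      have h3 := quad_mono hP x
      have h5 := quad_mono h₂.lower_left x
      simp only [quad_add, quad_smul, quad_one] at h1 h2 h3 h5 ⊢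
      have h6 := mul_le_mul_of_nonneg_left h2 (by linarith : 0 ≤ s')
      have hs'4 : 1 + s' ≤ 4 * s := by
        have : ε * (1 + s) ≤ 1 + s := mul_le_of_le_one_left (by linarith) hε1
        have : 0 ≤ d * w := by positivity
        linarith
      have h7 : (1 + s') * ε * (x ⬝ᵥ x) ≤ ε * (4 / v₀) * s * (x ⬝ᵥ V₂ *ᵥ x) := by
        have h8 : (1 + s') * ε * (x ⬝ᵥ x) ≤ 4 * s * ε * (x ⬝ᵥ x) :=
          mul_le_mul_of_nonneg_right (mul_le_mul_of_nonneg_right hs'4 hε)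
            (dotProduct_self_nonneg' x)
        have h9 : x ⬝ᵥ x ≤ v₀⁻¹ * (x ⬝ᵥ V₂ *ᵥ x) := by
          rw [← div_eq_inv_mul, le_div_iff₀ hv]; linarith
        have h10 := mul_le_mul_of_nonneg_left h9 (by positivity : 0 ≤ 4 * s * ε)
        have : 4 * s * ε * (v₀⁻¹ * (x ⬝ᵥ V₂ *ᵥ x)) = ε * (4 / v₀) * s * (x ⬝ᵥ V₂ *ᵥ x) := by
          rw [div_eq_mul_inv]; ring
        linarith
      have h11 : 0 ≤ ε * (s - 1) * (x ⬝ᵥ V₂ *ᵥ x) :=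
        mul_nonneg hεs (quad_nonneg (PosDef.nonneg hV₂) x)
      rw [hs'] at h6 h7 h3
      nlinarith

end IsApproxSol

/-- A property of real numbers that is upward closed and improves under an affine contraction holds
beyond the fixed point of the contraction. -/
theorem of_improve {p : ℝ → Prop} {l e : ℝ} (hl : 0 < l) (hmono : ∀ s s', s ≤ s' → p s → p s')
    (hex : ∃ s, p s) (himp : ∀ s, 0 ≤ s → p s → p ((1 - l) * s + e)) {s : ℝ}
    (hs : e / l < s) (hs0 : 0 < s) : p s := by
  by_contra hns
  have hlow : ∀ r, p r → s < r := fun r hr => by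
    by_contra hrs
    exact hns (hmono r s (not_lt.1 hrs) hr)
  set S : Set ℝ := {r | p r}
  have hbdd : BddBelow S := ⟨s, fun r hr => (hlow r hr).le⟩
  have hne : S.Nonempty := hex
  have hsI : s ≤ sInf S := le_csInf hne fun r hr => (hlow r hr).le
  have hes : e < l * s := by rwa [div_lt_iff₀ hl, mul_comm] at hs
  have key : ∀ r, p r → sInf S ≤ (1 - l) * r + e := fun r hr =>
    csInf_le hbdd (himp r (by linarith [hlow r hr]) hr)
  have hI : e < l * sInf S := lt_of_lt_of_le hes (mul_le_mul_of_nonneg_left hsI hl.le)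
  rcases le_or_gt 1 l with h1 | h1
  · obtain ⟨r, hr⟩ := hne
    have h2 := key r hr
    have h3 : sInf S ≤ r := csInf_le hbdd hr
    nlinarith
  · have : sInf S < (sInf S - e) / (1 - l) := by
      rw [lt_div_iff₀ (by linarith)]; linarith
    obtain ⟨r, hr, hr2⟩ := exists_lt_of_csInf_lt hne this
    have h2 := key r hr
    rw [lt_div_iff₀ (by linarith)] at hr2
    linarith

namespace IsApproxSol

variable {A : Matrix ι τ ℝ} {ε v₀ v₁ z a s : ℝ} {V₁ V₂ : Matrix ι ι ℝ} {Z₁ Z₂ : Matrix τ τ ℝ}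

/-- Stability of approximate solutions: any two of them are comparable up to a factor `1 + O(ε)`. -/
theorem stability (hD : DualPair Φ Ψ k C) (hv : 0 < v₀) (hz : 1 ≤ z) (ha : 0 ≤ a)
    (hA : Aᵀ * A ≤ a • 1) (hε : 0 < ε) (hε1 : ε ≤ 1)
    (hε2 : ε * (2 + 4 / v₀) ≤ (1 + a / v₀)⁻¹ * z⁻¹ / 2)
    (h₁ : IsApproxSol Φ Ψ A ε v₀ v₁ z V₁ Z₁) (h₂ : IsApproxSol Φ Ψ A ε v₀ v₁ z V₂ Z₂) :
    Z₂ ≤ (1 + 3 * ((2 + 4 / v₀) * ((1 + a / v₀) * z)) * ε) • Z₁ ∧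
    V₁ ≤ (1 + 3 * ((2 + 4 / v₀) * ((1 + a / v₀) * z)) * ε) • V₂ := by
  set m : ℝ := 2 + 4 / v₀
  set l : ℝ := (1 + a / v₀)⁻¹ * z⁻¹ with hl
  have hm : 0 < m := by positivity
  have hl0 : 0 < l := by positivity
  have hle : (1 + a / v₀) * z = l⁻¹ := by rw [hl, mul_inv, inv_inv, inv_inv]
  rw [hle]
  refine of_improve (p := fun r => Z₂ ≤ (1 + r) • Z₁ ∧ V₁ ≤ (1 + r) • V₂) (l := l / 2)
    (e := ε * m) (by positivity) ?_ ?_ ?_ ?_ (by positivity)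
  · exact fun s s' hss h => ⟨h.1.trans (smul_le_smul_of_nonneg_right (by linarith)
        (PosDef.nonneg h₁.posDef_right)),
      h.2.trans (smul_le_smul_of_nonneg_right (by linarith) (PosDef.nonneg (h₂.posDef_left hv)))⟩
  · refine ⟨max (z - 1) (v₁ / v₀ - 1), ?_, ?_⟩
    · calc Z₂ ≤ z • 1 := h₂.upper_right
        _ ≤ z • Z₁ := smul_le_smul_of_nonneg_left h₁.lower_right (by linarith)
        _ ≤ _ := smul_le_smul_of_nonneg_right (by linarith [le_max_left (z - 1) (v₁ / v₀ - 1)])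
          (PosDef.nonneg h₁.posDef_right)
    · rcases isEmpty_or_nonempty ι with hι | hι
      · exact (Subsingleton.elim _ _ : V₁ = _).le
      have hv1 : 0 ≤ v₁ := by
        have h3 := h₁.lower_left.trans h₁.upper_left
        have i : ι := Classical.arbitrary ι
        have := quad_mono h3 (Pi.single i 1)
        rw [quad_smul_one, quad_smul_one] at this
        simp at this
        linarith
      calc V₁ ≤ v₁ • 1 := h₁.upper_left
        _ = (v₁ / v₀) • (v₀ • 1) := by rw [smul_smul, div_mul_cancel₀ _ hv.ne']
        _ ≤ (v₁ / v₀) • V₂ := smul_le_smul_of_nonneg_left h₂.lower_left (by positivity)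
        _ ≤ _ := smul_le_smul_of_nonneg_right (by linarith [le_max_right (z - 1) (v₁ / v₀ - 1)])
          (PosDef.nonneg (h₂.posDef_left hv))
  · rintro r hr ⟨hr1, hr2⟩
    have h3 := improve hD hv hz ha hA hε.le h₁ h₂ (by linarith : 1 ≤ 1 + r) hε1 hr1 hr2
    have h4 : 1 + r - l * (1 + r - 1) + ε * m * (1 + r) ≤ 1 + ((1 - l / 2) * r + ε * m) := by
      nlinarith
    exact ⟨h3.1.trans (smul_le_smul_of_nonneg_right h4 (PosDef.nonneg h₁.posDef_right)),
      h3.2.trans (smul_le_smul_of_nonneg_right h4 (PosDef.nonneg (h₂.posDef_left hv)))⟩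
  · rw [div_lt_iff₀ (by positivity)]
    have : 3 * (m * l⁻¹) * ε * (l / 2) = 3 / 2 * (ε * m) := by field_simp
    rw [this]
    have : 0 < ε * m := by positivity
    linarith

end IsApproxSol

end FirstOrder

section Bounds

variable {ι τ : Type*} [Fintype ι] [Fintype τ] [DecidableEq ι] [DecidableEq τ]
  {Φ : Matrix ι ι ℝ →ₗ[ℝ] Matrix τ τ ℝ} {Ψ : Matrix τ τ ℝ →ₗ[ℝ] Matrix ι ι ℝ} {k C : ℝ}
  {t β v₀ c₁ : ℝ} {A : Matrix ι τ ℝ} {V : Matrix ι ι ℝ} {Z : Matrix τ τ ℝ}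

namespace IsSol

theorem lower_left (h : IsSol Φ Ψ t β A V Z) (hD : DualPair Φ Ψ k C) (htA : t = 1 ∨ A = 0)
    (ht : 0 ≤ t) (hβ : 0 ≤ β) (hv : v₀ ≤ k * (Fintype.card τ - t * Fintype.card ι)) :
    v₀ • 1 ≤ V := by
  have hP : 0 ≤ res A V Z := res_nonneg h.posDef_left h.posDef_right
  rw [h.eq_left]
  exact ((smul_one_mono hv).trans (hD.symm.le_map hP (h.le_trace_res hD htA ht hβ))).trans
    (le_add_of_nonneg_left (smul_one_nonneg hβ))

theorem upper_left (h : IsSol Φ Ψ t β A V Z) (hD : DualPair Φ Ψ k C) (ht : 0 ≤ t)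
    (hβ1 : β ≤ 1) (hc : C * Fintype.card τ ≤ c₁) : V ≤ (1 + c₁) • 1 := by
  have hP : 0 ≤ res A V Z := res_nonneg h.posDef_left h.posDef_right
  have htr : (res A V Z).trace ≤ Fintype.card τ := by
    simpa using trace_mono' (h.res_le_one hD ht)
  rw [h.eq_left, add_smul]
  exact add_le_add (smul_one_mono hβ1) ((hD.symm.map_le hP htr).trans (smul_one_mono hc))

theorem map_res_le (h : IsSol Φ Ψ t β A V Z) (hD : DualPair Φ Ψ k C) (hv0 : 0 < v₀)
    (hv : v₀ • 1 ≤ V) : Φ (res Aᵀ Z V) ≤ (C * Fintype.card ι * v₀⁻¹) • 1 := by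
  have hQ : 0 ≤ res Aᵀ Z V := res_nonneg h.posDef_right h.posDef_left
  have := hD.map_le hQ (trace_le_of_le_smul_one
    (res_le_smul_one (A := Aᵀ) h.posDef_right hv0 hv))
  rwa [mul_comm v₀⁻¹, ← mul_assoc] at this

theorem upper_right (h : IsSol Φ Ψ t β A V Z) (hD : DualPair Φ Ψ k C) (ht : 0 ≤ t)
    (hv0 : 0 < v₀) (hv : v₀ • 1 ≤ V) (hc : t * (C * Fintype.card ι) ≤ c₁) :
    Z ≤ (1 + c₁ / v₀) • 1 := by
  rw [h.eq_right, add_smul, one_smul]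
  refine add_le_add le_rfl ((smul_le_smul_of_nonneg_left (h.map_res_le hD hv0 hv) ht).trans ?_)
  rw [smul_smul, div_eq_mul_inv, ← mul_assoc]
  exact smul_one_mono (mul_le_mul_of_nonneg_right hc (by positivity))

theorem isApproxSol_self (h : IsSol Φ Ψ 1 β A V Z) (hD : DualPair Φ Ψ k C) {ε : ℝ}
    (hβ : 0 ≤ β) (hβε : β ≤ ε) (hε : ε ≤ 1) (hv0 : 0 < v₀)
    (hv : v₀ ≤ k * (Fintype.card τ - Fintype.card ι))
    (hcτ : C * Fintype.card τ ≤ c₁) (hcι : C * Fintype.card ι ≤ c₁) :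
    IsApproxSol Φ Ψ A ε v₀ (1 + c₁) (1 + c₁ / v₀) V Z := by
  have hv' := h.lower_left hD (Or.inl rfl) zero_le_one hβ (v₀ := v₀) (by simpa using hv)
  have hε0 : (0 : Matrix τ τ ℝ) ≤ ε • 1 := smul_one_nonneg (hβ.trans hβε)
  have e1 := h.eq_left
  have e2 := h.eq_right
  rw [one_smul] at e2
  refine ⟨hv', h.upper_left hD zero_le_one (hβε.trans hε) hcτ, h.one_le hD zero_le_one,
    h.upper_right hD zero_le_one hv0 hv' (by simpa using hcι), ?_, ?_, ?_, ?_⟩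
  · nth_rw 1 [e1]
    rw [add_comm]
    exact add_le_add le_rfl (smul_one_mono hβε)
  · nth_rw 2 [e1]
    rw [add_assoc, add_left_comm]
    exact le_add_of_nonneg_right
      (add_nonneg (smul_one_nonneg hβ) (smul_one_nonneg (hβ.trans hβε)))
  · nth_rw 1 [e2]
    exact le_add_of_nonneg_right hε0
  · nth_rw 2 [e2]
    exact le_add_of_nonneg_right hε0

theorem isApproxSol_zero (h : IsSol Φ Ψ t β A V Z) (hD : DualPair Φ Ψ k C) {ε F : ℝ}
    (htA : t = 1 ∨ A = 0) (ht : 0 ≤ t)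
    (hβ : 0 ≤ β) (hβε : β ≤ ε) (hε : ε ≤ 1) (hv0 : 0 < v₀)
    (hv : v₀ ≤ k * (Fintype.card τ - t * Fintype.card ι))
    (hcτ : C * Fintype.card τ ≤ c₁) (hcι : t * (C * Fintype.card ι) ≤ c₁)
    (hF0 : (A * Aᵀ).trace ≤ F) (hF : C * F ≤ ε) (htε : |t - 1| * (C * Fintype.card ι) ≤ ε) :
    IsApproxSol Φ Ψ (0 : Matrix ι τ ℝ) ((1 + 2 * v₀⁻¹ + v₀⁻¹ ^ 2) * ε) v₀ (1 + c₁)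
      (1 + c₁ / v₀) V Z := by
  have hv' := h.lower_left hD htA ht hβ hv
  have hε0 : 0 ≤ ε := hβ.trans hβε
  have hv0' : 0 ≤ v₀⁻¹ := by positivity
  have hV := h.posDef_left
  have hZ := h.posDef_right
  have hZ1 := h.one_le hD ht
  have hZinv : Z⁻¹ ≤ (1 : ℝ) • 1 := by simpa using inv_le_of_smul_one_le one_pos (by simpa using hZ1)
  have hVinv := inv_le_of_smul_one_le hv0 hv'
  have hPle : res A V Z ≤ (1 : ℝ) • 1 := (res_le_inv hV hZ).trans hZinv
  have hQle : res Aᵀ Z V ≤ v₀⁻¹ • 1 := (res_le_inv hZ hV).trans hVinv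
  have e1 := h.eq_left
  have e2 := h.eq_right
  have trP : C * (Z⁻¹ - res A V Z).trace ≤ v₀⁻¹ * ε := by
    have h1 := mul_le_mul_of_nonneg_left
      (trace_inv_sub_res_le hV hZ zero_le_one hv0' hZinv hQle hF0) hD.C_nonneg
    have h2 := mul_le_mul_of_nonneg_left hF hv0'
    linarith
  have trQ : C * (V⁻¹ - res Aᵀ Z V).trace ≤ v₀⁻¹ ^ 2 * ε := by
    have hF' : (Aᵀ * Aᵀᵀ).trace ≤ F := by rwa [transpose_transpose, Matrix.trace_mul_comm]
    have h1 := mul_le_mul_of_nonneg_left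
      (trace_inv_sub_res_le (A := Aᵀ) hZ hV hv0' zero_le_one hVinv
        (by rwa [transpose_transpose]) hF') hD.C_nonneg
    have h2 := mul_le_mul_of_nonneg_left hF (sq_nonneg v₀⁻¹)
    linarith
  have hP0 := sub_nonneg.2 (res_le_inv (A := A) hV hZ)
  have hQ0 := sub_nonneg.2 (res_le_inv (A := Aᵀ) hZ hV)
  have dP := (hD.upper_right hP0).trans (smul_one_mono trP)
  have dQ := (hD.upper_left hQ0).trans (smul_one_mono trQ)
  have dP0 := hD.symm.map_nonneg hP0
  have dQ0 := hD.map_nonneg hQ0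
  rw [map_sub] at dP dQ dP0 dQ0
  have hΦ := h.map_res_le hD hv0 hv'
  have hΦ0 := hD.map_nonneg (res_nonneg (A := Aᵀ) hZ hV)
  have hT : ∀ x, |t - 1| * (x ⬝ᵥ Φ (res Aᵀ Z V) *ᵥ x) ≤ v₀⁻¹ * ε * (x ⬝ᵥ x) := fun x => by
    have h1 := quad_mono hΦ x
    rw [quad_smul_one] at h1
    have h2 := mul_le_mul_of_nonneg_left h1 (abs_nonneg (t - 1))
    have h3 := mul_le_mul_of_nonneg_right htε (mul_nonneg hv0' (dotProduct_self_nonneg' x))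
    nlinarith
  have hM0 : 0 ≤ (1 + 2 * v₀⁻¹ + v₀⁻¹ ^ 2) * ε := by positivity
  have hinvV := PosDef.nonneg hV.inv
  have hinvZ := PosDef.nonneg hZ.inv
  have p1 : 0 ≤ v₀⁻¹ * ε := by positivity
  have p2 : 0 ≤ v₀⁻¹ ^ 2 * ε := by positivity
  refine ⟨hv', h.upper_left hD ht (hβε.trans hε) hcτ, h.one_le hD ht,
    h.upper_right hD ht hv0 hv' hcι, ?_, ?_, ?_, ?_⟩
  · rw [res_zero]
    calc V = β • 1 + Ψ (res A V Z) := e1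
      _ ≤ ((1 + 2 * v₀⁻¹ + v₀⁻¹ ^ 2) * ε) • 1 + Ψ Z⁻¹ :=
        add_le_add (smul_one_mono (by nlinarith)) (sub_nonneg.1 dP0)
      _ = _ := add_comm _ _
  · rw [res_zero]
    calc Ψ Z⁻¹ ≤ Ψ (res A V Z) + (v₀⁻¹ * ε) • 1 := by rw [add_comm]; exact sub_le_iff_le_add.1 dP
      _ ≤ V + ((1 + 2 * v₀⁻¹ + v₀⁻¹ ^ 2) * ε) • 1 := by
        refine add_le_add ?_ (smul_one_mono (by nlinarith))
        nth_rw 2 [e1]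
        exact le_add_of_nonneg_left (smul_one_nonneg hβ)
  · rw [transpose_zero, res_zero]
    refine le_of_quad hZ.1 (isHermitian_of_nonneg (add_nonneg (add_nonneg zero_le_one_mat
      (hD.map_nonneg hinvV)) (smul_one_nonneg hM0))) fun x => ?_
    have h1 := hT x
    have h2 := quad_nonneg dQ0 x
    have h3 := quad_nonneg hΦ0 x
    have h4 : x ⬝ᵥ Z *ᵥ x = x ⬝ᵥ x + t * (x ⬝ᵥ Φ (res Aᵀ Z V) *ᵥ x) := by
      nth_rw 1 [e2]
      rw [quad_add, quad_smul, quad_one]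
    rw [sub_mulVec, dotProduct_sub] at h2
    simp only [quad_add, quad_smul, quad_one]
    rw [h4]
    have h5 := mul_le_mul_of_nonneg_right (le_abs_self (t - 1)) h3
    have h6 := dotProduct_self_nonneg' x
    have h7 := mul_nonneg p1 h6
    have h8 := mul_nonneg p2 h6
    have h9 := mul_nonneg hε0 h6
    nlinarith
  · rw [transpose_zero, res_zero]
    refine le_of_quad (isHermitian_of_nonneg (add_nonneg zero_le_one_mat
      (hD.map_nonneg hinvV))) (isHermitian_of_nonneg (add_nonneg (PosDef.nonneg hZ)
        (smul_one_nonneg hM0))) fun x => ?_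
    have h1 := hT x
    have h2 := quad_mono dQ x
    have h3 := quad_nonneg hΦ0 x
    have h4 : x ⬝ᵥ Z *ᵥ x = x ⬝ᵥ x + t * (x ⬝ᵥ Φ (res Aᵀ Z V) *ᵥ x) := by
      nth_rw 1 [e2]
      rw [quad_add, quad_smul, quad_one]
    rw [sub_mulVec, dotProduct_sub] at h2
    simp only [quad_add, quad_smul, quad_one] at h2 ⊢
    rw [h4]
    have h5 := mul_le_mul_of_nonneg_right (neg_abs_le (t - 1)) h3
    have h6 := dotProduct_self_nonneg' x
    have h7 := mul_nonneg p1 h6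
    have h8 := mul_nonneg p2 h6
    have h9 := mul_nonneg hε0 h6
    nlinarith

end IsSol

theorem dom_sub_of_le_smul {P P' : Matrix ι ι ℝ} {s q : ℝ} (hs : 0 ≤ s) (hP : 0 ≤ P)
    (hP' : 0 ≤ P') (hq : P ≤ q • 1) (hq' : P' ≤ q • 1) (h : P ≤ (1 + s) • P')
    (h' : P' ≤ (1 + s) • P) : Dom (P - P') ((s * q) • 1) := by
  refine Dom.of_le ((isHermitian_of_nonneg hP).sub (isHermitian_of_nonneg hP')) ?_ ?_
  · rw [neg_le, neg_sub, sub_le_iff_le_add, mul_smul]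
    rw [add_smul, one_smul, add_comm] at h'
    exact h'.trans (add_le_add (smul_le_smul_of_nonneg_left hq hs) le_rfl)
  · rw [sub_le_iff_le_add, mul_smul]
    rw [add_smul, one_smul, add_comm] at h
    exact h.trans (add_le_add (smul_le_smul_of_nonneg_left hq' hs) le_rfl)

end Bounds

section SecondOrder

variable {ι τ : Type*} [Fintype ι] [Fintype τ] [DecidableEq ι] [DecidableEq τ]
  {Φ : Matrix ι ι ℝ →ₗ[ℝ] Matrix τ τ ℝ} {Ψ : Matrix τ τ ℝ →ₗ[ℝ] Matrix ι ι ℝ} {k C : ℝ}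

/-- The linear system `G₁ = Ψ (P (B₂ + G₂) P)`, `G₂ = t Φ (Q (B₁ + G₁) Q)`. -/
structure IsSol₂ (Φ : Matrix ι ι ℝ →ₗ[ℝ] Matrix τ τ ℝ) (Ψ : Matrix τ τ ℝ →ₗ[ℝ] Matrix ι ι ℝ)
    (t : ℝ) (B₁ : Matrix ι ι ℝ) (B₂ : Matrix τ τ ℝ) (P : Matrix τ τ ℝ) (Q : Matrix ι ι ℝ)
    (G₁ : Matrix ι ι ℝ) (G₂ : Matrix τ τ ℝ) : Prop where
  eq_left : G₁ = Ψ (P * (B₂ + G₂) * P)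
  eq_right : G₂ = t • Φ (Q * (B₁ + G₁) * Q)

variable {t β v₀ z e : ℝ} {A : Matrix ι τ ℝ} {V : Matrix ι ι ℝ} {Z : Matrix τ τ ℝ}

namespace IsSol

theorem dom_left (h : IsSol Φ Ψ t β A V Z) (hD : DualPair Φ Ψ k C) (hβ : 0 ≤ β)
    {X : Matrix τ τ ℝ} {s : ℝ} (hs : 0 ≤ s) (hX : Dom X (s • Z)) :
    Dom (Ψ (res A V Z * X * res A V Z)) (s • V) := by
  have hP : 0 ≤ res A V Z := res_nonneg h.posDef_left h.posDef_right
  have h1 := hX.conj (res A V Z)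
  rw [Matrix.mul_smul, Matrix.smul_mul] at h1
  have h2 := hD.dom_right (h1.mono (smul_le_smul_of_nonneg_left
    (res_conj_le h.posDef_left h.posDef_right) hs))
  rw [transpose_of_nonneg hP, map_smul] at h2
  refine h2.mono (smul_le_smul_of_nonneg_left ?_ hs)
  nth_rw 2 [h.eq_left]
  exact le_add_of_nonneg_left (smul_one_nonneg hβ)

theorem dom_right (h : IsSol Φ Ψ t β A V Z) (hD : DualPair Φ Ψ k C) (ht : 0 ≤ t) (hz : 0 < z)
    (hZ : Z ≤ z • 1) {X : Matrix ι ι ℝ} {s : ℝ} (hs : 0 ≤ s) (hX : Dom X (s • V)) :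
    Dom (t • Φ (res Aᵀ Z V * X * res Aᵀ Z V)) (((1 - z⁻¹) * s) • Z) := by
  have hQ : 0 ≤ res Aᵀ Z V := res_nonneg h.posDef_right h.posDef_left
  have h1 := hX.conj (res Aᵀ Z V)
  rw [Matrix.mul_smul, Matrix.smul_mul] at h1
  have h2 := (hD.dom_left (h1.mono (smul_le_smul_of_nonneg_left
    (res_conj_le h.posDef_right h.posDef_left) hs))).smul ht
  rw [transpose_of_nonneg hQ, map_smul, smul_comm] at h2
  refine h2.mono ?_
  rw [mul_comm, mul_smul]
  refine smul_le_smul_of_nonneg_left ?_ hs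
  have h3 : t • Φ (res Aᵀ Z V) = Z - 1 := eq_sub_of_add_eq' h.eq_right.symm
  rw [h3, sub_smul, one_smul]
  refine sub_le_sub le_rfl ?_
  have := smul_le_smul_of_nonneg_left hZ (inv_nonneg.2 hz.le)
  rwa [smul_smul, inv_mul_cancel₀ hz.ne', one_smul] at this

/-- A priori bound for solutions of the linear system with right-hand sides `E₁`, `E₂`. -/
theorem dom_of_eq (h : IsSol Φ Ψ t β A V Z) (hD : DualPair Φ Ψ k C) (ht : 0 ≤ t) (hβ : 0 ≤ β)
    (hv0 : 0 < v₀) (hv : v₀ • 1 ≤ V) (hz : 1 ≤ z) (hZ : Z ≤ z • 1) (he : 0 < e)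
    {X₁ E₁ : Matrix ι ι ℝ} {X₂ E₂ : Matrix τ τ ℝ}
    (h₁ : X₁ = Ψ (res A V Z * X₂ * res A V Z) + E₁)
    (h₂ : X₂ = t • Φ (res Aᵀ Z V * X₁ * res Aᵀ Z V) + E₂)
    (hE₁ : Dom E₁ (e • V)) (hE₂ : Dom E₂ (e • Z)) :
    Dom X₁ ((4 * z * e) • V) ∧ Dom X₂ ((4 * z * e) • Z) := by
  have hz0 : 0 < z := by linarith
  have hθ : 0 ≤ 1 - z⁻¹ := sub_nonneg.2 (inv_le_one_of_one_le₀ hz)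
  have hV0 := PosDef.nonneg h.posDef_left
  have hZ0 := PosDef.nonneg h.posDef_right
  have key2 : ∀ s, 0 ≤ s → Dom X₁ (s • V) → Dom X₂ (((1 - z⁻¹) * s + e) • Z) := by
    intro s hs hX
    rw [h₂, add_smul]
    exact (h.dom_right hD ht hz0 hZ hs hX).add hE₂
  have key1 : ∀ s, 0 ≤ s → Dom X₁ (s • V) → Dom X₁ (((1 - z⁻¹) * s + 2 * e) • V) := by
    intro s hs hX
    have h3 := h.dom_left hD hβ (add_nonneg (mul_nonneg hθ hs) he.le) (key2 s hs hX)
    have h4 := h3.add hE₁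
    rwa [← h₁, ← add_smul, add_assoc, ← two_mul] at h4
  have hX₁ : Dom X₁ ((3 * z * e) • V) := by
    refine of_improve (p := fun s => Dom X₁ (s • V)) (l := z⁻¹) (e := 2 * e) (by positivity)
      (fun s s' hss hX => hX.mono (smul_le_smul_of_nonneg_right hss hV0)) ?_ key1 ?_ (by positivity)
    · refine ⟨‖X₁‖ / v₀, (Dom.of_norm_le le_rfl).mono ?_⟩
      have := smul_le_smul_of_nonneg_left hv (by positivity : 0 ≤ ‖X₁‖ / v₀)
      rwa [smul_smul, div_mul_cancel₀ _ hv0.ne'] at this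
    · rw [div_inv_eq_mul]
      nlinarith [mul_pos hz0 he]
  refine ⟨hX₁.mono (smul_le_smul_of_nonneg_right (by nlinarith [mul_pos hz0 he]) hV0),
    (key2 _ (by positivity) hX₁).mono (smul_le_smul_of_nonneg_right ?_ hZ0)⟩
  have : z⁻¹ * z = 1 := inv_mul_cancel₀ hz0.ne'
  have h5 : (1 - z⁻¹) * (3 * z * e) = 3 * z * e - 3 * e := by linear_combination (-3 * e) * this
  rw [h5]
  nlinarith [mul_pos hz0 he]

theorem dom_smul_left (hv0 : 0 < v₀) (hv : v₀ • 1 ≤ V) {X : Matrix ι ι ℝ} {b : ℝ} (hb : 0 ≤ b)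
    (hX : Dom X (b • 1)) : Dom X ((b / v₀) • V) := by
  refine hX.mono ?_
  have := smul_le_smul_of_nonneg_left hv (by positivity : 0 ≤ b / v₀)
  rwa [smul_smul, div_mul_cancel₀ _ hv0.ne'] at this

theorem dom_sol₂ (h : IsSol Φ Ψ t β A V Z) (hD : DualPair Φ Ψ k C) (ht : 0 ≤ t) (hβ : 0 ≤ β)
    (hv0 : 0 < v₀) (hv : v₀ • 1 ≤ V) (hz : 1 ≤ z) (hZ : Z ≤ z • 1) {b : ℝ} (hb : 0 < b)
    {B₁ G₁ : Matrix ι ι ℝ} {B₂ G₂ : Matrix τ τ ℝ} (hB₁ : ‖B₁‖ ≤ b) (hB₂ : ‖B₂‖ ≤ b)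
    (hG : IsSol₂ Φ Ψ t B₁ B₂ (res A V Z) (res Aᵀ Z V) G₁ G₂) :
    Dom G₁ ((4 * z * (b * (1 + v₀⁻¹))) • V) ∧ Dom G₂ ((4 * z * (b * (1 + v₀⁻¹))) • Z) := by
  have hz0 : 0 < z := by linarith
  have hV0 := PosDef.nonneg h.posDef_left
  have hZ0 := PosDef.nonneg h.posDef_right
  have hZ1 := h.one_le hD ht
  have p : 0 < b * v₀⁻¹ := by positivity
  refine h.dom_of_eq hD ht hβ hv0 hv hz hZ (by positivity)
    (E₁ := Ψ (res A V Z * B₂ * res A V Z)) (E₂ := t • Φ (res Aᵀ Z V * B₁ * res Aᵀ Z V)) ?_ ?_ ?_ ?_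
  · nth_rw 1 [hG.eq_left]
    rw [← map_add, Matrix.mul_add, Matrix.add_mul, add_comm]
  · nth_rw 1 [hG.eq_right]
    rw [← smul_add, ← map_add, Matrix.mul_add, Matrix.add_mul, add_comm]
  · refine (h.dom_left hD hβ hb.le ((Dom.of_norm_le hB₂).mono
      (smul_le_smul_of_nonneg_left hZ1 hb.le))).mono (smul_le_smul_of_nonneg_right ?_ hV0)
    linarith
  · refine (h.dom_right hD ht hz0 hZ (s := b / v₀) (by positivity)
      (dom_smul_left hv0 hv hb.le (Dom.of_norm_le hB₁))).mono
        (smul_le_smul_of_nonneg_right ?_ hZ0)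
    have : 0 ≤ z⁻¹ * (b / v₀) := by positivity
    rw [div_eq_mul_inv] at *
    linarith

end IsSol

/-- Domination of a difference `Q M Q - Q' M Q'`. -/
theorem exists_dom_conj_sub {Q Q' M D : Matrix ι ι ℝ} {q μ d : ℝ} (hQ : ‖Q‖ ≤ q) (hQ' : ‖Q'‖ ≤ q)
    (hM : ‖M‖ ≤ μ) (hD0 : 0 ≤ D) (hD : Dom (Q - Q') D) (hd : D.trace ≤ d) :
    ∃ E, 0 ≤ E ∧ E.trace ≤ 2 * (1 + (μ * q) ^ 2) * d ∧ Dom (Q * M * Q - Q' * M * Q') E := by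
  have hμ : 0 ≤ μ := (norm_nonneg _).trans hM
  have h1 := (hD.mul_right (M * Q) hD0).add (hD.mul_left (Q' * M) hD0)
  have e : (Q - Q') * (M * Q) + Q' * M * (Q - Q') = Q * M * Q - Q' * M * Q' := by
    noncomm_ring
  rw [e] at h1
  refine ⟨_, ?_, ?_, h1⟩
  · have h2 := conj_nonneg hD0 (Q' * M)ᵀ
    rw [transpose_transpose] at h2
    exact add_nonneg (add_nonneg hD0 (conj_nonneg hD0 _)) (add_nonneg hD0 h2)
  · have n1 : ‖M * Q‖ ≤ μ * q := (norm_mul_le _ _).trans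
      (mul_le_mul hM hQ (norm_nonneg _) hμ)
    have n2 : ‖(Q' * M)ᵀ‖ ≤ μ * q := by
      rw [← conjTranspose_eq_transpose_of_trivial, l2_opNorm_conjTranspose, mul_comm μ]
      exact (norm_mul_le _ _).trans
        (mul_le_mul hQ' hM (norm_nonneg _) ((norm_nonneg _).trans hQ'))
    have t1 := trace_conj_le hD0 n1
    have t2 := trace_conj_le hD0 n2
    rw [transpose_transpose] at t2
    simp only [trace_add]
    have : (μ * q) ^ 2 * D.trace ≤ (μ * q) ^ 2 * d := mul_le_mul_of_nonneg_left hd (sq_nonneg _)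
    linarith

theorem dom_map_conj_sub (hD : DualPair Φ Ψ k C) {Q Q' M D : Matrix ι ι ℝ} {q μ d : ℝ}
    (hQ : ‖Q‖ ≤ q) (hQ' : ‖Q'‖ ≤ q)
    (hM : ‖M‖ ≤ μ) (hD0 : 0 ≤ D) (hQD : Dom (Q - Q') D) (hd : C * D.trace ≤ d) :
    Dom (Φ (Q * M * Q) - Φ (Q' * M * Q')) ((2 * (1 + (μ * q) ^ 2) * d) • 1) := by
  obtain ⟨E, hE0, hE, hdom⟩ := exists_dom_conj_sub hQ hQ' hM hD0 hQD le_rfl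
  rw [← map_sub]
  refine (hD.map_dom_smul_one hdom hE0 hE).mono (smul_one_mono ?_)
  have := mul_le_mul_of_nonneg_left hd (by positivity : 0 ≤ 2 * (1 + (μ * q) ^ 2))
  linarith

/-- Perturbation of the linear system. -/
theorem IsSol₂.norm_sub_le (hD : DualPair Φ Ψ k C) {v₁ q μ d t' : ℝ}
    (h : IsSol Φ Ψ 1 β A V Z) (hβ : 0 ≤ β)
    (hv0 : 0 < v₀) (hv : v₀ • 1 ≤ V) (hv1 : V ≤ v₁ • 1) (hv10 : 0 ≤ v₁)
    (hz : 1 ≤ z) (hZ : Z ≤ z • 1) (hμ : 0 ≤ μ) (hd : 0 < d)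
    {B₁ G₁ G₁' Q' DQ : Matrix ι ι ℝ} {B₂ G₂ G₂' P' DP : Matrix τ τ ℝ}
    (hG : IsSol₂ Φ Ψ 1 B₁ B₂ (res A V Z) (res Aᵀ Z V) G₁ G₂)
    (hG' : IsSol₂ Φ Ψ t' B₁ B₂ P' Q' G₁' G₂')
    (hP : ‖res A V Z‖ ≤ 1) (hP' : ‖P'‖ ≤ 1) (hQ : ‖res Aᵀ Z V‖ ≤ q) (hQ' : ‖Q'‖ ≤ q)
    (hM₁ : ‖B₁ + G₁'‖ ≤ μ) (hM₂ : ‖B₂ + G₂'‖ ≤ μ)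
    (hDP : Dom (res A V Z - P') DP) (hDP0 : 0 ≤ DP) (hDPd : C * DP.trace ≤ d)
    (hDQ : Dom (res Aᵀ Z V - Q') DQ) (hDQ0 : 0 ≤ DQ) (hDQd : C * DQ.trace ≤ d)
    (ht' : |1 - t'| * (C * Fintype.card ι) ≤ d) :
    ‖G₁ - G₁'‖ ≤ 4 * z * ((2 * (1 + μ ^ 2) + 2 * (1 + (μ * q) ^ 2) + q * μ * q) * d
      * (1 + v₀⁻¹)) * v₁ ∧
    ‖G₂ - G₂'‖ ≤ 4 * z * ((2 * (1 + μ ^ 2) + 2 * (1 + (μ * q) ^ 2) + q * μ * q) * d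
      * (1 + v₀⁻¹)) * z := by
  have hz0 : 0 < z := by linarith
  have hq : 0 ≤ q := (norm_nonneg _).trans hQ
  have hV0 := PosDef.nonneg h.posDef_left
  have hZ0 := PosDef.nonneg h.posDef_right
  have hZ1 := h.one_le hD zero_le_one
  set b : ℝ := (2 * (1 + μ ^ 2) + 2 * (1 + (μ * q) ^ 2) + q * μ * q) * d with hb
  have hb0 : 0 < b := by positivity
  have hbv : 0 < b * v₀⁻¹ := by positivity
  have c1 : 0 ≤ 2 * (1 + μ ^ 2) * d := by positivity
  have c2 : 0 ≤ 2 * (1 + (μ * q) ^ 2) * d := by positivity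
  have c3 : 0 ≤ q * μ * q * d := by positivity
  have hE₁ := dom_map_conj_sub hD.symm hP hP' hM₂ hDP0 hDP hDPd
  rw [mul_one] at hE₁
  have hE₂ := dom_map_conj_sub hD hQ hQ' hM₁ hDQ0 hDQ hDQd
  have hE₃ : Dom ((1 - t') • Φ (Q' * (B₁ + G₁') * Q')) ((q * μ * q * d) • 1) := by
    have n1 : ‖Q' * (B₁ + G₁') * Q'‖ ≤ q * μ * q :=
      (norm_mul_le _ _).trans (mul_le_mul ((norm_mul_le _ _).trans
        (mul_le_mul hQ' hM₁ (norm_nonneg _) hq)) hQ' (norm_nonneg _) (by positivity))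
    have h1 := hD.map_dom_smul_one (Dom.of_norm_le n1) (smul_one_nonneg (by positivity))
      (trace_le_of_le_smul_one le_rfl)
    have h2 := (h1.smul (abs_nonneg (1 - t'))).mono (E := (q * μ * q * d) • 1) (by
      rw [smul_smul]
      refine smul_one_mono ?_
      have := mul_le_mul_of_nonneg_left ht' (by positivity : 0 ≤ q * μ * q)
      linarith)
    rcases abs_choice (1 - t') with ha | ha
    · rwa [ha] at h2
    · rw [ha] at h2
      have h3 := h2.neg
      rwa [neg_smul, neg_neg] at h3
  have key := h.dom_of_eq hD zero_le_one hβ hv0 hv hz hZ (e := b * (1 + v₀⁻¹)) (by positivity)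
    (X₁ := G₁ - G₁') (X₂ := G₂ - G₂')
    (E₁ := Ψ (res A V Z * (B₂ + G₂') * res A V Z) - Ψ (P' * (B₂ + G₂') * P'))
    (E₂ := Φ (res Aᵀ Z V * (B₁ + G₁') * res Aᵀ Z V) - Φ (Q' * (B₁ + G₁') * Q')
      + (1 - t') • Φ (Q' * (B₁ + G₁') * Q')) ?_ ?_ ?_ ?_
  · have hpos : 0 ≤ 4 * z * (b * (1 + v₀⁻¹)) := by positivity
    constructor
    · refine Dom.norm_le (mul_nonneg hpos hv10) (key.1.mono ?_)
      exact (smul_le_smul_of_nonneg_left hv1 hpos).trans_eq (smul_smul _ _ _)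
    · refine Dom.norm_le (mul_nonneg hpos hz0.le) (key.2.mono ?_)
      exact (smul_le_smul_of_nonneg_left hZ hpos).trans_eq (smul_smul _ _ _)
  · nth_rw 1 [hG.eq_left, hG'.eq_left]
    rw [← map_sub, ← map_sub, ← map_add]
    congr 1
    noncomm_ring
  · nth_rw 1 [hG.eq_right, hG'.eq_right]
    rw [one_smul, one_smul, sub_smul, one_smul, ← sub_add_sub_cancel _
      (Φ (res Aᵀ Z V * (B₁ + G₁') * res Aᵀ Z V)), ← map_sub]
    have : res Aᵀ Z V * (B₁ + G₁) * res Aᵀ Z V - res Aᵀ Z V * (B₁ + G₁') * res Aᵀ Z V =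
      res Aᵀ Z V * (G₁ - G₁') * res Aᵀ Z V := by noncomm_ring
    rw [this]
    abel
  · refine (IsSol.dom_smul_left hv0 hv c1 hE₁).mono (smul_le_smul_of_nonneg_right ?_ hV0)
    rw [div_eq_mul_inv]
    have : 2 * (1 + μ ^ 2) * d ≤ b := by rw [hb]; linarith
    have := mul_le_mul_of_nonneg_right this (inv_nonneg.2 hv0.le)
    linarith
  · have h1 := hE₂.add hE₃
    rw [← add_smul] at h1
    refine (h1.mono (smul_le_smul_of_nonneg_left hZ1 (by positivity))).mono
      (smul_le_smul_of_nonneg_right ?_ hZ0)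
    rw [hb] at *
    linarith

end SecondOrder

section Compare

theorem IsApproxSol.res_le_res {ι τ : Type*} [Fintype ι] [Fintype τ] [DecidableEq ι]
    [DecidableEq τ] {Φ : Matrix ι ι ℝ →ₗ[ℝ] Matrix τ τ ℝ} {Ψ : Matrix τ τ ℝ →ₗ[ℝ] Matrix ι ι ℝ}
    {k C : ℝ} {A : Matrix ι τ ℝ} {ε v₀ v₁ z a : ℝ} {V₁ V₂ : Matrix ι ι ℝ} {Z₁ Z₂ : Matrix τ τ ℝ}
    (hD : DualPair Φ Ψ k C) (hv : 0 < v₀) (hz : 1 ≤ z) (ha : 0 ≤ a)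
    (hA : Aᵀ * A ≤ a • 1) (hε : 0 < ε) (hε1 : ε ≤ 1)
    (hε2 : ε * (2 + 4 / v₀) ≤ (1 + a / v₀)⁻¹ * z⁻¹ / 2)
    (h₁ : IsApproxSol Φ Ψ A ε v₀ v₁ z V₁ Z₁) (h₂ : IsApproxSol Φ Ψ A ε v₀ v₁ z V₂ Z₂) :
    res A V₁ Z₁ ≤ (1 + 3 * ((2 + 4 / v₀) * ((1 + a / v₀) * z)) * ε) • res A V₂ Z₂ ∧
    res Aᵀ Z₂ V₂ ≤ (1 + 3 * ((2 + 4 / v₀) * ((1 + a / v₀) * z)) * ε) • res Aᵀ Z₁ V₁ := by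
  obtain ⟨hZ, hV⟩ := stability hD hv hz ha hA hε hε1 hε2 h₁ h₂
  have hs : 0 < 1 + 3 * ((2 + 4 / v₀) * ((1 + a / v₀) * z)) * ε := by positivity
  exact ⟨res_le_smul_res (h₁.posDef_left hv) h₁.posDef_right (h₂.posDef_left hv) h₂.posDef_right
      hs hZ hV,
    res_le_smul_res h₂.posDef_right (h₂.posDef_left hv) h₁.posDef_right (h₁.posDef_left hv)
      hs hV hZ⟩

/-- Comparison of the solutions of two systems which both are approximate solutions of a third. -/
theorem exists_norm_sub_le {v₀ v₁ z c₁ a b : ℝ} (hv0 : 0 < v₀) (hv10 : 0 ≤ v₁) (hz : 1 ≤ z)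
    (hc : 0 ≤ c₁) (ha : 0 ≤ a) (hb : 0 < b) :
    ∃ e₀ > 0, ∃ K ≥ 0, ∀ {ι τ : Type} [Fintype ι] [Fintype τ] [DecidableEq ι] [DecidableEq τ]
      {Φ : Matrix ι ι ℝ →ₗ[ℝ] Matrix τ τ ℝ} {Ψ : Matrix τ τ ℝ →ₗ[ℝ] Matrix ι ι ℝ}
      {k C t' β β' e : ℝ} {A A' : Matrix ι τ ℝ} {V V' B₁ G₁ G₁' : Matrix ι ι ℝ}
      {Z Z' B₂ G₂ G₂' : Matrix τ τ ℝ},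
      DualPair Φ Ψ k C → C * Fintype.card τ ≤ c₁ → C * Fintype.card ι ≤ c₁ → 0 ≤ t' →
      0 ≤ β → 0 ≤ β' → A'ᵀ * A' ≤ a • 1 → 0 < e → e ≤ e₀ →
      |1 - t'| * (C * Fintype.card ι) ≤ e →
      IsSol Φ Ψ 1 β A V Z → IsSol Φ Ψ t' β' A' V' Z' →
      IsApproxSol Φ Ψ A' e v₀ v₁ z V Z → IsApproxSol Φ Ψ A' e v₀ v₁ z V' Z' →
      0 ≤ res A' V Z - res A V Z → 0 ≤ res A'ᵀ Z V - res Aᵀ Z V →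
      C * (res A' V Z - res A V Z).trace ≤ e → C * (res A'ᵀ Z V - res Aᵀ Z V).trace ≤ e →
      ‖B₁‖ ≤ b → ‖B₂‖ ≤ b →
      IsSol₂ Φ Ψ 1 B₁ B₂ (res A V Z) (res Aᵀ Z V) G₁ G₂ →
      IsSol₂ Φ Ψ t' B₁ B₂ (res A' V' Z') (res A'ᵀ Z' V') G₁' G₂' →
      ‖G₁ - G₁'‖ ≤ K * e ∧ ‖G₂ - G₂'‖ ≤ K * e := by
  have hz0 : 0 < z := by linarith
  set S : ℝ := 3 * ((2 + 4 / v₀) * ((1 + a / v₀) * z)) with hS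
  have hS0 : 0 ≤ S := by positivity
  set L : ℝ := 1 + c₁ * S + c₁ * S * v₀⁻¹ with hL
  have hL0 : 0 < L := by positivity
  set g : ℝ := 4 * z * (b * (1 + v₀⁻¹)) with hg
  have hg0 : 0 ≤ g := by positivity
  set μ : ℝ := b + g * (v₁ + z) with hμ
  have hμ0 : 0 ≤ μ := by positivity
  set q : ℝ := v₀⁻¹ with hq
  have hq0 : 0 < q := by positivity
  refine ⟨min 1 ((1 + a / v₀)⁻¹ * z⁻¹ / 2 / (2 + 4 / v₀)), by positivity,
    4 * z * ((2 * (1 + μ ^ 2) + 2 * (1 + (μ * q) ^ 2) + q * μ * q) * L * (1 + q)) * (v₁ + z),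
    by positivity, ?_⟩
  intro ι τ _ _ _ _ Φ Ψ k C t' β β' e A A' V V' B₁ G₁ G₁' Z Z' B₂ G₂ G₂' hD hcτ hcι ht' hβ hβ' hA'
    he hee ht'e h h' ha ha' gP0 gQ0 gP gQ hB₁ hB₂ hG hG'
  have he1 : e ≤ 1 := hee.trans (min_le_left _ _)
  have he2 : e * (2 + 4 / v₀) ≤ (1 + a / v₀)⁻¹ * z⁻¹ / 2 := by
    rw [← le_div_iff₀ (by positivity)]; exact hee.trans (min_le_right _ _)
  have hP0 : 0 ≤ res A V Z := res_nonneg h.posDef_left h.posDef_right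
  have hQ0 : 0 ≤ res Aᵀ Z V := res_nonneg h.posDef_right h.posDef_left
  have hP0' : 0 ≤ res A' V' Z' := res_nonneg h'.posDef_left h'.posDef_right
  have hQ0' : 0 ≤ res A'ᵀ Z' V' := res_nonneg h'.posDef_right h'.posDef_left
  have hP0'' : 0 ≤ res A' V Z := res_nonneg h.posDef_left h.posDef_right
  have hQ0'' : 0 ≤ res A'ᵀ Z V := res_nonneg h.posDef_right h.posDef_left
  have hP1 : ∀ X : Matrix ι τ ℝ, res X V Z ≤ (1 : ℝ) • 1 := fun X => by
    simpa using res_le_smul_one (A := X) h.posDef_left one_pos (by simpa using ha.lower_right)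
  have hP1' : res A' V' Z' ≤ (1 : ℝ) • 1 := by
    simpa using res_le_smul_one (A := A') h'.posDef_left one_pos (by simpa using ha'.lower_right)
  have hQ1 : ∀ X : Matrix ι τ ℝ, res Xᵀ Z V ≤ q • 1 := fun X =>
    res_le_smul_one (A := Xᵀ) h.posDef_right hv0 ha.lower_left
  have hQ1' : res A'ᵀ Z' V' ≤ q • 1 :=
    res_le_smul_one (A := A'ᵀ) h'.posDef_right hv0 ha'.lower_left
  obtain ⟨s1, s2⟩ := IsApproxSol.res_le_res hD hv0 hz ‹0 ≤ a› hA' he he1 he2 ha ha'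
  obtain ⟨s3, s4⟩ := IsApproxSol.res_le_res hD hv0 hz ‹0 ≤ a› hA' he he1 he2 ha' ha
  have hSe : 0 ≤ S * e := by positivity
  have dP := dom_sub_of_le_smul hSe hP0'' hP0' (hP1 A') hP1' s1 s3
  have dQ := dom_sub_of_le_smul hSe hQ0'' hQ0' (hQ1 A') hQ1' s4 s2
  have dP' := (Dom.of_nonneg gP0).neg.add dP
  have dQ' := (Dom.of_nonneg gQ0).neg.add dQ
  rw [neg_sub, sub_add_sub_cancel] at dP' dQ'
  have hC := hD.C_nonneg
  have d1 : C * (res A' V Z - res A V Z + (S * e * 1) • (1 : Matrix τ τ ℝ)).trace ≤ L * e := by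
    rw [trace_add, trace_smul, trace_one, smul_eq_mul]
    have := mul_le_mul_of_nonneg_right hcτ hSe
    have : 0 ≤ c₁ * S * q * e := by positivity
    rw [hL]; linarith
  have d2 : C * (res A'ᵀ Z V - res Aᵀ Z V + (S * e * q) • (1 : Matrix ι ι ℝ)).trace ≤ L * e := by
    rw [trace_add, trace_smul, trace_one, smul_eq_mul]
    have := mul_le_mul_of_nonneg_right hcι (mul_nonneg hSe hq0.le)
    have : 0 ≤ c₁ * S * e := by positivity
    rw [hL]; linarith
  have d3 : |1 - t'| * (C * Fintype.card ι) ≤ L * e := by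
    have : 0 ≤ c₁ * S * e := by positivity
    have : 0 ≤ c₁ * S * q * e := by positivity
    rw [hL]; linarith
  obtain ⟨m1, m2⟩ := h'.dom_sol₂ hD ht' hβ' hv0 ha'.lower_left hz ha'.upper_right hb hB₁ hB₂ hG'
  have n1 : ‖G₁'‖ ≤ g * v₁ := (m1.mono ((smul_le_smul_of_nonneg_left ha'.upper_left hg0).trans_eq
    (smul_smul _ _ _))).norm_le (by positivity)
  have n2 : ‖G₂'‖ ≤ g * z := (m2.mono ((smul_le_smul_of_nonneg_left ha'.upper_right hg0).trans_eq
    (smul_smul _ _ _))).norm_le (by positivity)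
  have k1 : ‖B₁ + G₁'‖ ≤ μ := (norm_add_le _ _).trans (by
    have : 0 ≤ g * z := by positivity
    rw [hμ]; linarith)
  have k2 : ‖B₂ + G₂'‖ ≤ μ := (norm_add_le _ _).trans (by
    have : 0 ≤ g * v₁ := by positivity
    rw [hμ]; linarith)
  have fin := IsSol₂.norm_sub_le hD h hβ hv0 ha.lower_left ha.upper_left hv10 hz ha.upper_right hμ0
    (by positivity : 0 < L * e) hG hG'
    (norm_le_of_nonneg_of_le zero_le_one hP0 (hP1 A))
    (norm_le_of_nonneg_of_le zero_le_one hP0' hP1')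
    (norm_le_of_nonneg_of_le hq0.le hQ0 (hQ1 A)) (norm_le_of_nonneg_of_le hq0.le hQ0' hQ1')
    k1 k2 dP' (add_nonneg gP0 (smul_one_nonneg (by positivity))) d1
    dQ' (add_nonneg gQ0 (smul_one_nonneg (by positivity))) d2 d3
  set R : ℝ := 2 * (1 + μ ^ 2) + 2 * (1 + (μ * q) ^ 2) + q * μ * q
  have hR : 0 ≤ R := by positivity
  have p1 : 0 ≤ 4 * z * (R * (L * e) * (1 + q)) * z := by positivity
  have p2 : 0 ≤ 4 * z * (R * (L * e) * (1 + q)) * v₁ := by positivity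
  exact ⟨fin.1.trans (by linarith), fin.2.trans (by linarith)⟩

variable {v₀ c₁ a b : ℝ}

/-- Solutions of two systems with the same data matrix and small regularizations are close. -/
theorem exists_norm_sub_le_self (hv0 : 0 < v₀) (hc : 0 ≤ c₁) (ha : 0 ≤ a) (hb : 0 < b) :
    ∃ e₀ > 0, ∃ K ≥ 0, ∀ {ι τ : Type} [Fintype ι] [Fintype τ] [DecidableEq ι] [DecidableEq τ]
      {Φ : Matrix ι ι ℝ →ₗ[ℝ] Matrix τ τ ℝ} {Ψ : Matrix τ τ ℝ →ₗ[ℝ] Matrix ι ι ℝ}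
      {k C β β' e : ℝ} {A : Matrix ι τ ℝ} {V V' B₁ G₁ G₁' : Matrix ι ι ℝ}
      {Z Z' B₂ G₂ G₂' : Matrix τ τ ℝ},
      DualPair Φ Ψ k C → v₀ ≤ k * (Fintype.card τ - Fintype.card ι) →
      C * Fintype.card τ ≤ c₁ → C * Fintype.card ι ≤ c₁ → Aᵀ * A ≤ a • 1 →
      0 < e → e ≤ e₀ → 0 ≤ β → β ≤ e → 0 ≤ β' → β' ≤ e →
      ‖B₁‖ ≤ b → ‖B₂‖ ≤ b →
      IsSol Φ Ψ 1 β A V Z → IsSol Φ Ψ 1 β' A V' Z' →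
      IsSol₂ Φ Ψ 1 B₁ B₂ (res A V Z) (res Aᵀ Z V) G₁ G₂ →
      IsSol₂ Φ Ψ 1 B₁ B₂ (res A V' Z') (res Aᵀ Z' V') G₁' G₂' →
      ‖G₁ - G₁'‖ ≤ K * e ∧ ‖G₂ - G₂'‖ ≤ K * e := by
  obtain ⟨e₀, he₀, K, hK, H⟩ := exists_norm_sub_le (v₀ := v₀) (v₁ := 1 + c₁) (z := 1 + c₁ / v₀)
    (c₁ := c₁) (a := a) (b := b) hv0 (by linarith)
    (by linarith [(by positivity : 0 ≤ c₁ / v₀)]) hc ha hb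
  refine ⟨min e₀ 1, by positivity, K, hK, ?_⟩
  intro ι τ _ _ _ _ Φ Ψ k C β β' e A V V' B₁ G₁ G₁' Z Z' B₂ G₂ G₂' hD hv hcτ hcι hA
    he hee hβ hβe hβ' hβe' hB₁ hB₂ h h' hG hG'
  have he1 : e ≤ 1 := hee.trans (min_le_right _ _)
  exact H hD hcτ hcι zero_le_one hβ hβ' hA he (hee.trans (min_le_left _ _)) (by simpa using he.le)
    h h' (h.isApproxSol_self hD hβ hβe he1 hv0 hv hcτ hcι)
    (h'.isApproxSol_self hD hβ' hβe' he1 hv0 hv hcτ hcι)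
    (by simp) (by simp) (by simpa using he.le) (by simpa using he.le) hB₁ hB₂ hG hG'

/-- Solutions of a system with a data matrix of small normalized Frobenius norm are close to the
solutions of the system without data matrix. -/
theorem exists_norm_sub_le_zero (hv0 : 0 < v₀) (hc : 0 ≤ c₁) (hb : 0 < b) :
    ∃ e₀ > 0, ∃ K ≥ 0, ∀ {ι τ : Type} [Fintype ι] [Fintype τ] [DecidableEq ι] [DecidableEq τ]
      {Φ : Matrix ι ι ℝ →ₗ[ℝ] Matrix τ τ ℝ} {Ψ : Matrix τ τ ℝ →ₗ[ℝ] Matrix ι ι ℝ}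
      {k C t β F e : ℝ} {A : Matrix ι τ ℝ} {V V' B₁ G₁ G₁' : Matrix ι ι ℝ}
      {Z Z' B₂ G₂ G₂' : Matrix τ τ ℝ},
      DualPair Φ Ψ k C → v₀ ≤ k * (Fintype.card τ - Fintype.card ι) →
      v₀ ≤ k * (Fintype.card τ - t * Fintype.card ι) → 0 ≤ t →
      C * Fintype.card τ ≤ c₁ → C * Fintype.card ι ≤ c₁ → t * (C * Fintype.card ι) ≤ c₁ →
      0 < e → e ≤ e₀ → 0 ≤ β → β ≤ e → (A * Aᵀ).trace ≤ F → C * F ≤ e →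
      |t - 1| * (C * Fintype.card ι) ≤ e →
      ‖B₁‖ ≤ b → ‖B₂‖ ≤ b →
      IsSol Φ Ψ 1 β A V Z → IsSol Φ Ψ t 0 (0 : Matrix ι τ ℝ) V' Z' →
      IsSol₂ Φ Ψ 1 B₁ B₂ (res A V Z) (res Aᵀ Z V) G₁ G₂ →
      IsSol₂ Φ Ψ t B₁ B₂ Z'⁻¹ V'⁻¹ G₁' G₂' →
      ‖G₁ - G₁'‖ ≤ K * e ∧ ‖G₂ - G₂'‖ ≤ K * e ∧ ‖G₁'‖ ≤ K := by
  obtain ⟨e₀, he₀, K, hK, H⟩ := exists_norm_sub_le (v₀ := v₀) (v₁ := 1 + c₁) (z := 1 + c₁ / v₀)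
    (c₁ := c₁) (a := 0) (b := b) hv0 (by linarith)
    (by linarith [(by positivity : 0 ≤ c₁ / v₀)]) hc le_rfl hb
  set m : ℝ := 1 + 2 * v₀⁻¹ + v₀⁻¹ ^ 2 with hm
  have hv0' : 0 < v₀⁻¹ := by positivity
  have hm0 : 0 < m := by positivity
  set g : ℝ := 4 * (1 + c₁ / v₀) * (b * (1 + v₀⁻¹)) with hg
  have hg0 : 0 ≤ g * (1 + c₁) := by positivity
  refine ⟨min (e₀ / m) 1, by positivity, K * m + g * (1 + c₁), by positivity, ?_⟩
  intro ι τ _ _ _ _ Φ Ψ k C t β F e A V V' B₁ G₁ G₁' Z Z' B₂ G₂ G₂' hD hv hv' ht hcτ hcι hct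
    he hee hβ hβe hF hFe hte hB₁ hB₂ h h' hG hG'
  have he1 : e ≤ 1 := hee.trans (min_le_right _ _)
  have hme : m * e ≤ e₀ := by
    rw [mul_comm, ← le_div_iff₀ hm0]; exact hee.trans (min_le_left _ _)
  have p1 : 0 < v₀⁻¹ * e := by positivity
  have p2 : 0 < v₀⁻¹ ^ 2 * e := by positivity
  have hme1 : e ≤ m * e := by rw [hm]; linarith
  have h1 := h.isApproxSol_zero hD (Or.inl rfl) zero_le_one hβ hβe he1 hv0 (by simpa using hv) hcτ
    (by simpa using hcι) hF hFe (by simpa using he.le)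
  have h2 := h'.isApproxSol_zero hD (ε := e) (F := 0) (Or.inr rfl) ht le_rfl he.le he1 hv0 hv' hcτ
    hct (by simp) (by simpa using he.le) hte
  have hV := h.posDef_left
  have hZ := h.posDef_right
  have hZ1 := h.one_le hD zero_le_one
  have hZinv : Z⁻¹ ≤ (1 : ℝ) • 1 := by simpa using inv_le_of_smul_one_le one_pos (by simpa using hZ1)
  have hVinv := inv_le_of_smul_one_le hv0 h1.lower_left
  have hPle : res A V Z ≤ (1 : ℝ) • 1 := (res_le_inv hV hZ).trans hZinv
  have hQle : res Aᵀ Z V ≤ v₀⁻¹ • 1 := (res_le_inv hZ hV).trans hVinv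
  have trP : C * (Z⁻¹ - res A V Z).trace ≤ m * e := by
    have h1 := mul_le_mul_of_nonneg_left
      (trace_inv_sub_res_le hV hZ zero_le_one hv0'.le hZinv hQle hF) hD.C_nonneg
    have h2 := mul_le_mul_of_nonneg_left hFe hv0'.le
    rw [hm]; linarith
  have trQ : C * (V⁻¹ - res Aᵀ Z V).trace ≤ m * e := by
    have hF' : (Aᵀ * Aᵀᵀ).trace ≤ F := by rwa [transpose_transpose, Matrix.trace_mul_comm]
    have h1 := mul_le_mul_of_nonneg_left
      (trace_inv_sub_res_le (A := Aᵀ) hZ hV hv0'.le zero_le_one hVinv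
        (by rwa [transpose_transpose]) hF') hD.C_nonneg
    have h2 := mul_le_mul_of_nonneg_left hFe (sq_nonneg v₀⁻¹)
    rw [hm]; linarith
  have hP0 := sub_nonneg.2 (res_le_inv (A := A) hV hZ)
  have hQ0 := sub_nonneg.2 (res_le_inv (A := Aᵀ) hZ hV)
  have hG'' : IsSol₂ Φ Ψ t B₁ B₂ (res (0 : Matrix ι τ ℝ) V' Z') (res (0 : Matrix ι τ ℝ)ᵀ Z' V')
      G₁' G₂' := by rwa [res_zero, transpose_zero, res_zero]
  have fin := H hD hcτ hcι ht hβ le_rfl (by simp) (by positivity) hme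
    (by rw [abs_sub_comm]; exact hte.trans hme1) h h' h1 h2 (by rwa [res_zero])
    (by rwa [transpose_zero, res_zero]) (by rwa [res_zero]) (by rwa [transpose_zero, res_zero])
    hB₁ hB₂ hG hG''
  have hsol := (h'.dom_sol₂ hD ht le_rfl hv0 h2.lower_left
    (by linarith [(by positivity : 0 ≤ c₁ / v₀)]) h2.upper_right hb hB₁ hB₂ hG'').1
  have hn : ‖G₁'‖ ≤ g * (1 + c₁) := (hsol.mono ((smul_le_smul_of_nonneg_left h2.upper_left
    (by positivity)).trans_eq (smul_smul _ _ _))).norm_le (by positivity)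
  have hge : 0 ≤ g * (1 + c₁) * e := by positivity
  exact ⟨fin.1.trans (by linarith), fin.2.trans (by linarith),
    hn.trans (le_add_of_nonneg_left (by positivity))⟩

end Compare

section Limits

variable {ι τ : Type*} [Fintype ι] [DecidableEq ι]

theorem isClosed_nonneg_matrix : IsClosed {M : Matrix ι ι ℝ | 0 ≤ M} := by
  have : {M : Matrix ι ι ℝ | 0 ≤ M} =
      {M | Mᵀ = M} ∩ ⋂ x : ι → ℝ, {M | 0 ≤ x ⬝ᵥ M *ᵥ x} := by
    ext M
    simp only [Set.mem_ofPred_eq, Set.mem_inter_iff, Set.mem_iInter]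
    refine ⟨fun h => ⟨transpose_of_nonneg h, quad_nonneg h⟩, fun h => ?_⟩
    exact le_of_quad isHermitian_zero (isHermitian_of_transpose h.1) fun x => by
      simpa using h.2 x
  rw [this]
  refine (isClosed_eq (continuous_id.matrix_transpose) continuous_id).inter
    (isClosed_iInter fun x => isClosed_le continuous_const ?_)
  exact continuous_const.dotProduct (continuous_id.matrix_mulVec continuous_const)

instance orderClosedTopology_matrix : OrderClosedTopology (Matrix ι ι ℝ) where
  isClosed_le' := by
    have : {p : Matrix ι ι ℝ × Matrix ι ι ℝ | p.1 ≤ p.2} = (fun p => p.2 - p.1) ⁻¹' {M | 0 ≤ M} := by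
      ext p; simp
    rw [this]
    exact isClosed_nonneg_matrix.preimage (continuous_snd.sub continuous_fst)

theorem bilin_polarization {M : Matrix ι ι ℝ} (hM : M.IsHermitian) (x y : ι → ℝ) :
    x ⬝ᵥ M *ᵥ y = ((x + y) ⬝ᵥ M *ᵥ (x + y) - (x - y) ⬝ᵥ M *ᵥ (x - y)) / 4 := by
  have h5 := bilin_comm hM x y
  simp only [mulVec_add, mulVec_sub, dotProduct_add, dotProduct_sub, add_dotProduct,
    sub_dotProduct]
  linarith

/-- A bounded monotone sequence of positive semidefinite matrices converges. -/
theorem exists_tendsto_of_monotone {f : ℕ → Matrix ι ι ℝ} {U : Matrix ι ι ℝ} (hf : Monotone f)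
    (h0 : ∀ n, 0 ≤ f n) (hU : ∀ n, f n ≤ U) : ∃ L, Tendsto f atTop (𝓝 L) := by
  have hq : ∀ x : ι → ℝ, ∃ l, Tendsto (fun n => x ⬝ᵥ f n *ᵥ x) atTop (𝓝 l) := fun x =>
    ⟨_, tendsto_atTop_ciSup (fun i j hij => quad_mono (hf hij) x)
      ⟨x ⬝ᵥ U *ᵥ x, by rintro _ ⟨n, rfl⟩; exact quad_mono (hU n) x⟩⟩
  choose l hl using hq
  refine ⟨Matrix.of fun i j => (l (Pi.single i 1 + Pi.single j 1) -
    l (Pi.single i 1 - Pi.single j 1)) / 4, ?_⟩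
  refine tendsto_pi_nhds.2 fun i => tendsto_pi_nhds.2 fun j => ?_
  have h := ((hl (Pi.single i 1 + Pi.single j 1)).sub (hl (Pi.single i 1 - Pi.single j 1))).div_const 4
  refine h.congr fun n => ?_
  rw [← bilin_polarization (isHermitian_of_nonneg (h0 n))]
  simp

theorem exists_tendsto_of_antitone {f : ℕ → Matrix ι ι ℝ} (hf : Antitone f)
    (h0 : ∀ n, 0 ≤ f n) : ∃ L, Tendsto f atTop (𝓝 L) := by
  obtain ⟨L, hL⟩ := exists_tendsto_of_monotone (f := fun n => f 0 - f n) (U := f 0)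
    (fun i j hij => sub_le_sub_left (hf hij) _) (fun n => sub_nonneg.2 (hf (Nat.zero_le n)))
    (fun n => sub_le_self _ (h0 n))
  refine ⟨f 0 - L, ?_⟩
  simpa using tendsto_const_nhds (x := f 0) |>.sub hL

theorem tendsto_inv_matrix {α : Type*} {l : Filter α} {f : α → Matrix ι ι ℝ} {L : Matrix ι ι ℝ}
    (hL : L.PosDef) (h : Tendsto f l (𝓝 L)) : Tendsto (fun a => (f a)⁻¹) l (𝓝 L⁻¹) := by
  have hd : L.det ≠ 0 := ((isUnit_iff_isUnit_det _).1 hL.isUnit).ne_zero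
  simp only [Matrix.inv_def, Ring.inverse_eq_inv']
  have h1 : Tendsto (fun a => (f a).det) l (𝓝 L.det) :=
    ((continuous_id.matrix_det).tendsto L).comp h
  have h2 : Tendsto (fun a => (f a).adjugate) l (𝓝 L.adjugate) :=
    ((continuous_id.matrix_adjugate).tendsto L).comp h
  exact (h1.inv₀ hd).smul h2

theorem tendsto_map_matrix [Fintype τ] [DecidableEq τ] (Φ : Matrix ι ι ℝ →ₗ[ℝ] Matrix τ τ ℝ)
    {α : Type*} {l : Filter α} {f : α → Matrix ι ι ℝ} {L : Matrix ι ι ℝ}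
    (h : Tendsto f l (𝓝 L)) : Tendsto (fun a => Φ (f a)) l (𝓝 (Φ L)) :=
  ((LinearMap.continuous_of_finiteDimensional Φ).tendsto L).comp h

theorem tendsto_res [Fintype τ] [DecidableEq τ] {A : Matrix ι τ ℝ} {α : Type*} {l : Filter α}
    {f : α → Matrix ι ι ℝ} {g : α → Matrix τ τ ℝ} {V : Matrix ι ι ℝ} {Z : Matrix τ τ ℝ}
    (hV : V.PosDef) (hZ : Z.PosDef) (hf : Tendsto f l (𝓝 V)) (hg : Tendsto g l (𝓝 Z)) :
    Tendsto (fun a => res A (f a) (g a)) l (𝓝 (res A V Z)) := by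
  refine tendsto_inv_matrix (posDef_resCore hV hZ) (hg.add ?_)
  have hc : Continuous fun X : Matrix ι ι ℝ => Aᵀ * X * A :=
    (continuous_const.matrix_mul continuous_id).matrix_mul continuous_const
  exact (hc.tendsto _).comp (tendsto_inv_matrix hV hf)

end Limits

section Existence

variable {ι τ : Type*} [Fintype ι] [Fintype τ] [DecidableEq ι] [DecidableEq τ]
  {Φ : Matrix ι ι ℝ →ₗ[ℝ] Matrix τ τ ℝ} {Ψ : Matrix τ τ ℝ →ₗ[ℝ] Matrix ι ι ℝ} {k C : ℝ}
  {t β v₀ : ℝ} {A : Matrix ι τ ℝ} {V : Matrix ι ι ℝ} {Z : Matrix τ τ ℝ}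

theorem IsSol.exists_isSol₂ (h : IsSol Φ Ψ t β A V Z) (hD : DualPair Φ Ψ k C) (ht : 0 ≤ t)
    (hβ : 0 ≤ β) (hv0 : 0 < v₀) (hv : v₀ • 1 ≤ V) (B₁ : Matrix ι ι ℝ) (B₂ : Matrix τ τ ℝ) :
    ∃ G₁ G₂, IsSol₂ Φ Ψ t B₁ B₂ (res A V Z) (res Aᵀ Z V) G₁ G₂ := by
  set P := res A V Z with hP
  set Q := res Aᵀ Z V with hQ
  let cP : Matrix τ τ ℝ →ₗ[ℝ] Matrix τ τ ℝ := (LinearMap.mulRight ℝ P).comp (LinearMap.mulLeft ℝ P)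
  let cQ : Matrix ι ι ℝ →ₗ[ℝ] Matrix ι ι ℝ := (LinearMap.mulRight ℝ Q).comp (LinearMap.mulLeft ℝ Q)
  let L : Matrix ι ι ℝ →ₗ[ℝ] Matrix ι ι ℝ :=
    LinearMap.id - (Ψ.comp cP).comp (t • (Φ.comp cQ))
  have hL : ∀ X, L X = X - Ψ (P * (t • Φ (Q * X * Q)) * P) := fun X => rfl
  obtain ⟨z, hz, hZ⟩ : ∃ z : ℝ, 1 ≤ z ∧ Z ≤ z • 1 :=
    ⟨max 1 ‖Z‖, le_max_left _ _, le_norm_smul_one h.posDef_right.1 (le_max_right _ _)⟩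
  have hinj : Function.Injective L := by
    rw [← LinearMap.ker_eq_bot, LinearMap.ker_eq_bot']
    intro X hX
    rw [hL, sub_eq_zero] at hX
    have hdom : ∀ e : ℝ, 0 < e → Dom X ((4 * z * e) • V) := fun e he => by
      refine (h.dom_of_eq hD ht hβ hv0 hv hz hZ he (X₂ := t • Φ (Q * X * Q)) (E₁ := 0) (E₂ := 0)
        (by rw [add_zero]; exact hX) (by rw [add_zero]) ?_ ?_).1
      · exact (Dom.of_norm_le (a := 0) (by simp)).mono (by
          simpa using smul_nonneg he.le (PosDef.nonneg h.posDef_left))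
      · exact (Dom.of_norm_le (a := 0) (by simp)).mono (by
          simpa using smul_nonneg he.le (PosDef.nonneg h.posDef_right))
    have hn : ∀ e : ℝ, 0 < e → ‖X‖ ≤ 4 * z * e * ‖V‖ := fun e he => by
      refine ((hdom e he).mono ?_).norm_le (by positivity)
      exact (smul_le_smul_of_nonneg_left (le_norm_smul_one h.posDef_left.1 le_rfl)
        (by positivity)).trans_eq (smul_smul _ _ _)
    have hlim : Tendsto (fun e : ℝ => 4 * z * e * ‖V‖) (𝓝[>] 0) (𝓝 (4 * z * 0 * ‖V‖)) :=
      (Continuous.tendsto (by fun_prop) 0).mono_left nhdsWithin_le_nhds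
    have h0 := ge_of_tendsto hlim (eventually_mem_nhdsWithin.mono fun e he => hn e he)
    simp only [mul_zero, zero_mul] at h0
    exact norm_le_zero_iff.1 h0
  obtain ⟨G₁, hG₁⟩ := (LinearMap.injective_iff_surjective.1 hinj)
    (Ψ (P * (B₂ + t • Φ (Q * B₁ * Q)) * P))
  refine ⟨G₁, t • Φ (Q * (B₁ + G₁) * Q), ?_, rfl⟩
  rw [hL, sub_eq_iff_eq_add, ← map_add] at hG₁
  nth_rw 1 [hG₁]
  congr 1
  rw [Matrix.mul_add Q, Matrix.add_mul, map_add, smul_add]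
  noncomm_ring

/-- Existence for the regularized system, by monotone iteration. -/
theorem DualPair.exists_isSol (hD : DualPair Φ Ψ k C) (ht : 0 ≤ t) (hβ : 0 < β)
    (A : Matrix ι τ ℝ) : ∃ V Z, IsSol Φ Ψ t β A V Z := by
  let F : Matrix ι ι ℝ × Matrix τ τ ℝ → Matrix ι ι ℝ × Matrix τ τ ℝ := fun p =>
    (β • 1 + Ψ (res A p.1 p.2), 1 + t • Φ (res Aᵀ p.2 p.1))
  let s : ℕ → Matrix ι ι ℝ × Matrix τ τ ℝ := fun n =>
    F^[n] (β • 1, 1 + t • Φ (β⁻¹ • 1))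
  have hs : ∀ n, s (n + 1) = F (s n) := fun n => Function.iterate_succ_apply' F n _
  have s0 : s 0 = (β • 1, 1 + t • Φ (β⁻¹ • 1)) := rfl
  have hβi : (0 : Matrix ι ι ℝ) ≤ β⁻¹ • 1 := smul_one_nonneg (inv_nonneg.2 hβ.le)
  have hF : ∀ p : Matrix ι ι ℝ × Matrix τ τ ℝ, β • 1 ≤ p.1 → 1 ≤ p.2 →
      β • 1 ≤ (F p).1 ∧ 1 ≤ (F p).2 := fun p h1 h2 => by
    have hV := posDef_of_smul_one_le hβ h1
    have hZ := posDef_of_one_le h2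
    exact ⟨le_add_of_nonneg_right (hD.symm.map_nonneg (res_nonneg hV hZ)),
      le_add_of_nonneg_right (smul_nonneg ht (hD.map_nonneg (res_nonneg hZ hV)))⟩
  have hlow : ∀ n, β • 1 ≤ (s n).1 ∧ 1 ≤ (s n).2 := by
    intro n
    induction n with
    | zero => exact ⟨le_rfl, le_add_of_nonneg_right (smul_nonneg ht (hD.map_nonneg hβi))⟩
    | succ n ih => rw [hs]; exact hF _ ih.1 ih.2
  have hVp : ∀ n, (s n).1.PosDef := fun n => posDef_of_smul_one_le hβ (hlow n).1
  have hZp : ∀ n, (s n).2.PosDef := fun n => posDef_of_one_le (hlow n).2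
  have hmono : ∀ n, (s n).1 ≤ (s (n + 1)).1 ∧ (s (n + 1)).2 ≤ (s n).2 := by
    intro n
    induction n with
    | zero =>
      refine ⟨(hlow 1).1, ?_⟩
      rw [hs]
      exact add_le_add le_rfl (smul_le_smul_of_nonneg_left
        (hD.map_mono (res_le_smul_one (hZp 0) hβ (hlow 0).1)) ht)
    | succ n ih =>
      rw [hs (n + 1), hs n]
      rw [hs n] at ih
      have hV' := hVp (n + 1)
      have hZ' := hZp (n + 1)
      rw [hs n] at hV' hZ'
      have i1 : (s n).1 ≤ (1 : ℝ) • (F (s n)).1 := by rw [one_smul]; exact ih.1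
      have i2 : (F (s n)).2 ≤ (1 : ℝ) • (s n).2 := by rw [one_smul]; exact ih.2
      have j1 := res_le_smul_res (A := A) (hVp n) (hZp n) hV' hZ' one_pos i2 i1
      have j2 := res_le_smul_res (A := Aᵀ) hZ' hV' (hZp n) (hVp n) one_pos i1 i2
      rw [one_smul] at j1 j2
      exact ⟨add_le_add le_rfl (hD.symm.map_mono j1),
        add_le_add le_rfl (smul_le_smul_of_nonneg_left (hD.map_mono j2) ht)⟩
  have hup : ∀ n, (s n).1 ≤ β • 1 + Ψ 1 := fun n => by
    refine (hmono n).1.trans ?_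
    rw [hs]
    refine add_le_add le_rfl (hD.symm.map_mono ?_)
    have := res_le_smul_one (A := A) (hVp n) one_pos (by simpa using (hlow n).2)
    simpa using this
  obtain ⟨V, hV⟩ := exists_tendsto_of_monotone (f := fun n => (s n).1)
    (monotone_nat_of_le_succ fun n => (hmono n).1) (fun n => PosDef.nonneg (hVp n)) hup
  obtain ⟨Z, hZ⟩ := exists_tendsto_of_antitone (f := fun n => (s n).2)
    (antitone_nat_of_succ_le fun n => (hmono n).2) (fun n => PosDef.nonneg (hZp n))
  have hVd : V.PosDef := posDef_of_smul_one_le hβ (ge_of_tendsto' hV fun n => (hlow n).1)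
  have hZd : Z.PosDef := posDef_of_one_le (ge_of_tendsto' hZ fun n => (hlow n).2)
  refine ⟨V, Z, hVd, hZd, ?_, ?_⟩
  · refine tendsto_nhds_unique (hV.comp (tendsto_add_atTop_nat 1)) ?_
    have := (tendsto_map_matrix Ψ (tendsto_res (A := A) hVd hZd hV hZ)).const_add (β • 1)
    refine this.congr fun n => ?_
    simp only [Function.comp, hs n, F]
  · refine tendsto_nhds_unique (hZ.comp (tendsto_add_atTop_nat 1)) ?_
    have := ((tendsto_map_matrix Φ (tendsto_res (A := Aᵀ) hZd hVd hZ hV)).const_smul t).const_add 1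
    refine this.congr fun n => ?_
    simp only [Function.comp, hs n, F]

/-- Existence for the limiting system, by monotone iteration; the trace identity keeps the iterates
bounded. -/
theorem DualPair.exists_isSol_zero (hD : DualPair Φ Ψ k C) (ht : 0 ≤ t)
    (hd : 0 < Fintype.card τ - t * Fintype.card ι) :
    ∃ V Z, IsSol Φ Ψ t 0 (0 : Matrix ι τ ℝ) V Z := by
  have hτ : Nonempty τ := by
    by_contra hτ
    rw [not_nonempty_iff] at hτ
    rw [Fintype.card_eq_zero, Nat.cast_zero] at hd
    have : 0 ≤ t * Fintype.card ι := by positivity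
    linarith
  let F : Matrix τ τ ℝ → Matrix τ τ ℝ := fun Z => 1 + t • Φ (Ψ Z⁻¹)⁻¹
  let s : ℕ → Matrix τ τ ℝ := fun n => F^[n] 1
  have hs : ∀ n, s (n + 1) = F (s n) := fun n => Function.iterate_succ_apply' F n _
  have hΨ : ∀ Z : Matrix τ τ ℝ, Z.PosDef → (Ψ Z⁻¹).PosDef := fun Z hZ =>
    posDef_of_smul_one_le (mul_pos hD.k_pos hZ.inv.trace_pos)
      (hD.lower_right (PosDef.inv_nonneg hZ))
  have hF1 : ∀ Z : Matrix τ τ ℝ, Z.PosDef → 1 ≤ F Z := fun Z hZ =>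
    le_add_of_nonneg_right (smul_nonneg ht (hD.map_nonneg (PosDef.inv_nonneg (hΨ Z hZ))))
  have hlow : ∀ n, 1 ≤ s n := by
    intro n
    induction n with
    | zero => exact le_rfl
    | succ n ih => rw [hs]; exact hF1 _ (posDef_of_one_le ih)
  have hp : ∀ n, (s n).PosDef := fun n => posDef_of_one_le (hlow n)
  have hmono : ∀ n, s n ≤ s (n + 1) := by
    intro n
    induction n with
    | zero => exact hlow 1
    | succ n ih =>
      rw [hs (n + 1)]
      nth_rw 1 [hs n]
      exact add_le_add le_rfl (smul_le_smul_of_nonneg_left (hD.map_mono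
        (inv_anti (hΨ _ (hp _)) (hD.symm.map_mono (inv_anti (hp _) ih)))) ht)
  set d : ℝ := Fintype.card τ - t * Fintype.card ι with hdd
  have htr : ∀ n, d ≤ (s n)⁻¹.trace := fun n => by
    have h1 : ((s n)⁻¹ * s (n + 1)).trace = (s n)⁻¹.trace + t * Fintype.card ι := by
      rw [hs, Matrix.mul_add, Matrix.mul_one, trace_add, Matrix.mul_smul, trace_smul,
        Matrix.trace_mul_comm, hD.adj (PosDef.inv_nonneg (hΨ _ (hp n))) (PosDef.inv_nonneg (hp n)),
        PosDef.inv_mul (hΨ _ (hp n)), trace_one, smul_eq_mul]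
    have h2 := trace_mul_mono_left (hmono n) (PosDef.inv_nonneg (hp n))
    rw [PosDef.mul_inv (hp n), trace_one, Matrix.trace_mul_comm, h1] at h2
    linarith
  have hkd : 0 < k * d := mul_pos hD.k_pos hd
  have hup : ∀ n, s n ≤ 1 + t • Φ ((k * d)⁻¹ • 1) := fun n => by
    refine (hmono n).trans ?_
    rw [hs]
    exact add_le_add le_rfl (smul_le_smul_of_nonneg_left (hD.map_mono
      (inv_le_of_smul_one_le hkd (hD.symm.le_map (PosDef.inv_nonneg (hp n)) (htr n)))) ht)
  obtain ⟨Z, hZ⟩ := exists_tendsto_of_monotone (monotone_nat_of_le_succ hmono)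
    (fun n => PosDef.nonneg (hp n)) hup
  have hZd : Z.PosDef := posDef_of_one_le (ge_of_tendsto' hZ hlow)
  refine ⟨Ψ Z⁻¹, Z, hΨ Z hZd, hZd, ?_, ?_⟩
  · rw [res_zero, zero_smul, zero_add]
  · rw [transpose_zero, res_zero]
    refine tendsto_nhds_unique (hZ.comp (tendsto_add_atTop_nat 1)) ?_
    have := ((tendsto_map_matrix Φ (tendsto_inv_matrix (hΨ Z hZd)
      (tendsto_map_matrix Ψ (tendsto_inv_matrix hZd hZ)))).const_smul t).const_add 1
    refine this.congr fun n => ?_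
    simp only [Function.comp, hs n, F]

end Existence

section Kraus

variable {ι τ α : Type*} [Fintype ι] [Fintype τ] [DecidableEq ι] [DecidableEq τ] [Fintype α]

theorem quad_sum_conj (K : α → Matrix ι τ ℝ) (C : Matrix ι ι ℝ) (v : τ → ℝ) :
    v ⬝ᵥ (∑ a, (K a)ᵀ * (Cᵀ * C) * K a) *ᵥ v = ∑ i, ∑ a, (C i ⬝ᵥ K a *ᵥ v) ^ 2 := by
  rw [Finset.sum_comm, sum_mulVec, dotProduct_sum]
  refine Finset.sum_congr rfl fun a _ => ?_
  rw [bilin_conj, ← mulVec_mulVec, dotProduct_mulVec, vecMul_transpose]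
  simp [dotProduct, mulVec, sq]

theorem trace_transpose_mul_self' (C : Matrix ι ι ℝ) : (Cᵀ * C).trace = ∑ i, C i ⬝ᵥ C i := by
  rw [Matrix.trace_mul_comm]
  simp [Matrix.trace, Matrix.mul_apply, dotProduct]

theorem sum_conj_bounds {K : α → Matrix ι τ ℝ} {k C : ℝ}
    (hK : ∀ w v, k * ((w ⬝ᵥ w) * (v ⬝ᵥ v)) ≤ ∑ a, (w ⬝ᵥ K a *ᵥ v) ^ 2 ∧
      ∑ a, (w ⬝ᵥ K a *ᵥ v) ^ 2 ≤ C * ((w ⬝ᵥ w) * (v ⬝ᵥ v)))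
    {M : Matrix ι ι ℝ} (hM : 0 ≤ M) :
    (k * M.trace) • 1 ≤ ∑ a, (K a)ᵀ * M * K a ∧ ∑ a, (K a)ᵀ * M * K a ≤ (C * M.trace) • 1 := by
  have hH : (∑ a, (K a)ᵀ * M * K a).IsHermitian :=
    isHermitian_of_nonneg (Finset.sum_nonneg fun a _ => conj_nonneg hM _)
  have h1 : ∀ c : ℝ, (c • (1 : Matrix τ τ ℝ)).IsHermitian := fun c =>
    isHermitian_of_transpose (by simp)
  obtain ⟨D, rfl⟩ := exists_transpose_mul_self hM
  refine ⟨le_of_quad (h1 _) hH fun v => ?_, le_of_quad hH (h1 _) fun v => ?_⟩ <;>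
    rw [quad_smul_one, quad_sum_conj, trace_transpose_mul_self', Finset.mul_sum, Finset.sum_mul] <;>
    refine Finset.sum_le_sum fun i _ => ?_
  · have := (hK (D i) v).1; linarith
  · have := (hK (D i) v).2; linarith

/-- A pair of maps in Kraus form is a dual pair as soon as the forms `∑ₐ (wᵀ Kₐ v)²` are comparable
with `|w|² |v|²`. -/
theorem DualPair.of_kraus {Φ : Matrix ι ι ℝ →ₗ[ℝ] Matrix τ τ ℝ} {Ψ : Matrix τ τ ℝ →ₗ[ℝ] Matrix ι ι ℝ}
    {K : α → Matrix ι τ ℝ} {k C c : ℝ} (hk : 0 < k) (hC : 0 ≤ C) (hc : 0 < c)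
    (hK : ∀ w v, k * ((w ⬝ᵥ w) * (v ⬝ᵥ v)) ≤ ∑ a, (w ⬝ᵥ K a *ᵥ v) ^ 2 ∧
      ∑ a, (w ⬝ᵥ K a *ᵥ v) ^ 2 ≤ C * ((w ⬝ᵥ w) * (v ⬝ᵥ v)))
    (hΦ : ∀ M, Φ M = c • ∑ a, (K a)ᵀ * M * K a) (hΨ : ∀ N, Ψ N = c • ∑ a, K a * Nᵀ * (K a)ᵀ) :
    DualPair Φ Ψ (c * k) (c * C) := by
  have hK' : ∀ v w, k * ((v ⬝ᵥ v) * (w ⬝ᵥ w)) ≤ ∑ a, (v ⬝ᵥ (K a)ᵀ *ᵥ w) ^ 2 ∧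
      ∑ a, (v ⬝ᵥ (K a)ᵀ *ᵥ w) ^ 2 ≤ C * ((v ⬝ᵥ v) * (w ⬝ᵥ w)) := fun v w => by
    simp only [bilin_transpose, mul_comm (v ⬝ᵥ v)]
    exact hK w v
  have hΨ' : ∀ {N}, 0 ≤ N → Ψ N = c • ∑ a, ((K a)ᵀ)ᵀ * N * (K a)ᵀ := fun hN => by
    rw [hΨ, transpose_of_nonneg hN]; simp only [transpose_transpose]
  refine ⟨by positivity, by positivity, fun h => ?_, fun h => ?_, fun h => ?_, fun h => ?_,
    fun h => ?_, fun h => ?_, fun {M N} hM hN => ?_⟩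
  · rw [hΦ, hΦ]
    exact (Dom.of_sum _ fun a _ => h.conj (K a)).smul hc.le
  · rename_i M D
    rw [hΨ, hΨ]
    refine (Dom.of_sum _ fun a _ => ?_).smul hc.le
    have h2 : Dom Mᵀ Dᵀ := fun x y => by
      simp only [bilin_transpose]; linarith [h y x]
    have := h2.conj (K a)ᵀ
    rwa [transpose_transpose] at this
  · rw [hΦ, mul_assoc, mul_smul]
    exact smul_le_smul_of_nonneg_left (sum_conj_bounds hK h).1 hc.le
  · rw [hΨ' h, mul_assoc, mul_smul]
    exact smul_le_smul_of_nonneg_left (sum_conj_bounds hK' h).1 hc.le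
  · rw [hΦ, mul_assoc, mul_smul]
    exact smul_le_smul_of_nonneg_left (sum_conj_bounds hK h).2 hc.le
  · rw [hΨ' h, mul_assoc, mul_smul]
    exact smul_le_smul_of_nonneg_left (sum_conj_bounds hK' h).2 hc.le
  · rw [hΦ, hΨ, transpose_of_nonneg hN, Matrix.smul_mul, Matrix.mul_smul, trace_smul, trace_smul,
      Matrix.sum_mul, Matrix.mul_sum, trace_sum, trace_sum]
    congr 1
    refine Finset.sum_congr rfl fun a _ => ?_
    rw [Matrix.mul_assoc, Matrix.mul_assoc, Matrix.trace_mul_comm]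
    simp only [Matrix.mul_assoc]

end Kraus

section Covariance

variable {n : ℕ} {W : Matrix (Fin n) (Fin n) ℝ} {ρ : ℝ}

theorem norm_pow_le_pow (hW : ‖W‖ ≤ ρ) (k : ℕ) : ‖W ^ k * (W ^ k)ᵀ‖ ≤ (ρ ^ 2) ^ k := by
  have hρ : 0 ≤ ρ := (norm_nonneg _).trans hW
  have h : ‖W ^ k‖ ≤ ρ ^ k := by
    induction k with
    | zero =>
      rw [pow_zero, pow_zero]
      exact norm_le_of_nonneg_of_le zero_le_one zero_le_one_mat (by rw [one_smul])
    | succ k ih =>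
      rw [pow_succ, pow_succ]
      exact (norm_mul_le _ _).trans (mul_le_mul ih hW (norm_nonneg _) (by positivity))
  rw [← conjTranspose_eq_transpose_of_trivial]
  refine (norm_mul_le _ _).trans ?_
  rw [l2_opNorm_conjTranspose, ← sq, ← pow_mul, mul_comm 2 k, pow_mul]
  exact pow_le_pow_left₀ (norm_nonneg _) h 2

theorem summable_S_zero (hW : ‖W‖ ≤ ρ) (hρ1 : ρ < 1) :
    Summable fun k : ℕ => W ^ k * (W ^ k)ᵀ := by
  have hρ : 0 ≤ ρ := (norm_nonneg _).trans hW
  exact Summable.of_norm_bounded (summable_geometric_of_lt_one (sq_nonneg ρ) (by nlinarith))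
    (norm_pow_le_pow hW)

theorem S_zero : S W 0 = ∑' k : ℕ, W ^ k * (W ^ k)ᵀ := by simp [S]

theorem S_eq (hW : ‖W‖ ≤ ρ) (hρ1 : ρ < 1) (q : ℤ) :
    S W q = W ^ (-q).toNat * S W 0 * (W ^ q.toNat)ᵀ := by
  have hs := summable_S_zero hW hρ1
  rw [S_zero, ← hs.tsum_mul_left, ← (hs.mul_left _).tsum_mul_right, S]
  refine tsum_congr fun k => ?_
  rw [add_comm k, add_comm k, pow_add, pow_add, transpose_mul]
  simp only [Matrix.mul_assoc]

theorem S_zero_eq (hW : ‖W‖ ≤ ρ) (hρ1 : ρ < 1) : S W 0 = 1 + W * S W 0 * Wᵀ := by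
  have hs := summable_S_zero hW hρ1
  rw [S_zero, ← hs.tsum_mul_left, ← (hs.mul_left _).tsum_mul_right, hs.tsum_eq_zero_add]
  congr 1
  · simp
  · refine tsum_congr fun k => ?_
    rw [pow_succ', transpose_mul]
    simp only [Matrix.mul_assoc]

theorem S_zero_nonneg : 0 ≤ S W 0 := by
  rw [S_zero]
  exact tsum_nonneg fun k => by simpa using transpose_mul_self_nonneg (W ^ k)ᵀ

theorem S_zero_le (hW : ‖W‖ ≤ ρ) (hρ1 : ρ < 1) : S W 0 ≤ (1 - ρ ^ 2)⁻¹ • 1 := by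
  have hρ : 0 ≤ ρ := (norm_nonneg _).trans hW
  refine le_norm_smul_one (isHermitian_of_nonneg S_zero_nonneg) ?_
  rw [S_zero]
  exact tsum_of_norm_bounded (hasSum_geometric_of_lt_one (sq_nonneg ρ) (by nlinarith))
    (norm_pow_le_pow hW)

theorem S_transpose (hW : ‖W‖ ≤ ρ) (hρ1 : ρ < 1) (q : ℤ) : (S W q)ᵀ = S W (-q) := by
  rw [S_eq hW hρ1 q, S_eq hW hρ1 (-q), transpose_mul, transpose_mul, transpose_transpose,
    transpose_of_nonneg S_zero_nonneg, neg_neg, Matrix.mul_assoc]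

/-- The quadratic form of the block Toeplitz covariance matrix, decomposed along the recursion
`b ↦ y₀ + Wᵀ b`. -/
theorem exists_quad_decomposition (hW : ‖W‖ ≤ ρ) (hρ : 0 < ρ) (hρ1 : ρ < 1) (T : ℕ)
    (y : Fin T → Fin n → ℝ) (b : Fin n → ℝ) (hb : b = ∑ j : Fin T, (W ^ (j : ℕ))ᵀ *ᵥ y j) :
    ∃ r : ℝ, ∑ i : Fin T, ∑ j : Fin T, y i ⬝ᵥ S W ((j : ℤ) - (i : ℤ)) *ᵥ y j =
        r + (b ⬝ᵥ S W 0 *ᵥ b - b ⬝ᵥ b) ∧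
      ∑ i, y i ⬝ᵥ y i ≤ 4 * r - 2 * (b ⬝ᵥ b) ∧
      r + ρ / (1 - ρ) * (b ⬝ᵥ b) ≤ (1 - ρ)⁻¹ ^ 2 * ∑ i, y i ⬝ᵥ y i := by
  induction T generalizing b with
  | zero => exact ⟨0, by simp [hb]⟩
  | succ T ih =>
    set b' : Fin n → ℝ := ∑ j : Fin T, (W ^ (j : ℕ))ᵀ *ᵥ y j.succ with hb'
    obtain ⟨r, h1, h2, h3⟩ := ih (fun j => y j.succ) b' rfl
    set c : Fin n → ℝ := Wᵀ *ᵥ b' with hc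
    have hcsum : c = ∑ j : Fin T, (W ^ ((j : ℕ) + 1))ᵀ *ᵥ y j.succ := by
      rw [hc, hb', mulVec_sum]
      refine Finset.sum_congr rfl fun j _ => ?_
      rw [mulVec_mulVec, pow_succ, transpose_mul]
    have hbc : b = y 0 + c := by
      rw [hb, Fin.sum_univ_succ, hcsum]
      simp
    have hWt : ‖Wᵀ‖ ≤ ρ := by
      rw [← conjTranspose_eq_transpose_of_trivial, l2_opNorm_conjTranspose]; exact hW
    have hcc : c ⬝ᵥ c ≤ ρ ^ 2 * (b' ⬝ᵥ b') := dotProduct_mulVec_self_le hWt b'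
    have hS := isHermitian_of_nonneg (S_zero_nonneg (W := W))
    have hrec : b' ⬝ᵥ S W 0 *ᵥ b' = b' ⬝ᵥ b' + c ⬝ᵥ S W 0 *ᵥ c := by
      nth_rw 1 [S_zero_eq hW hρ1]
      rw [quad_add, quad_one, hc, ← bilin_conj, transpose_transpose]
    have hcross : ∑ j : Fin T, y 0 ⬝ᵥ S W (((j.succ : Fin (T + 1)) : ℤ) - ((0 : Fin (T + 1)) : ℤ))
        *ᵥ y j.succ = y 0 ⬝ᵥ S W 0 *ᵥ c := by
      rw [hcsum, mulVec_sum, dotProduct_sum]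
      refine Finset.sum_congr rfl fun j _ => ?_
      rw [S_eq hW hρ1, mulVec_mulVec]
      have e1 : (-((((j.succ : Fin (T + 1)) : ℕ) : ℤ) - (((0 : Fin (T + 1)) : ℕ) : ℤ))).toNat = 0 := by
        simp
      have e2 : ((((j.succ : Fin (T + 1)) : ℕ) : ℤ) - (((0 : Fin (T + 1)) : ℕ) : ℤ)).toNat =
          (j : ℕ) + 1 := by
        simp
      rw [e1, e2, pow_zero, Matrix.one_mul]
    have hcross' : ∑ j : Fin T, y j.succ ⬝ᵥ
        S W (((0 : Fin (T + 1)) : ℤ) - ((j.succ : Fin (T + 1)) : ℤ)) *ᵥ y 0 =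
          y 0 ⬝ᵥ S W 0 *ᵥ c := by
      rw [← hcross]
      refine Finset.sum_congr rfl fun j _ => ?_
      rw [← bilin_transpose, S_transpose hW hρ1, neg_sub]
    have hmain : ∑ i : Fin (T + 1), ∑ j : Fin (T + 1),
        y i ⬝ᵥ S W ((j : ℤ) - (i : ℤ)) *ᵥ y j = r + b ⬝ᵥ S W 0 *ᵥ b := by
      rw [Fin.sum_univ_succ, Fin.sum_univ_succ, hcross]
      simp only [Fin.sum_univ_succ (n := T), Finset.sum_add_distrib]
      rw [hcross']
      have e : ∀ i j : Fin T, (((j.succ : Fin (T + 1)) : ℕ) : ℤ) - (((i.succ : Fin (T + 1)) : ℕ) : ℤ)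
          = (j : ℤ) - (i : ℤ) := fun i j => by simp
      simp only [e, h1, sub_self, hrec, hbc, mulVec_add, dotProduct_add, add_dotProduct]
      rw [bilin_comm hS c (y 0)]
      ring
    have hsum : ∑ i, y i ⬝ᵥ y i = y 0 ⬝ᵥ y 0 + ∑ i : Fin T, y i.succ ⬝ᵥ y i.succ :=
      Fin.sum_univ_succ _
    have hy0 : y 0 = b - c := by rw [hbc, add_sub_cancel_right]
    have hb0 := dotProduct_self_nonneg' b'
    refine ⟨r + b ⬝ᵥ b, by rw [hmain]; ring, ?_, ?_⟩
    · have h4 := dotProduct_self_nonneg' (b + c)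
      have h5 : y 0 ⬝ᵥ y 0 + (b + c) ⬝ᵥ (b + c) = 2 * (b ⬝ᵥ b) + 2 * (c ⬝ᵥ c) := by
        rw [hy0]
        simp only [dotProduct_add, dotProduct_sub, add_dotProduct, sub_dotProduct]
        ring
      have h6 : c ⬝ᵥ c ≤ b' ⬝ᵥ b' := hcc.trans (mul_le_of_le_one_left hb0 (by nlinarith))
      rw [hsum]
      linarith
    · have hρ' : 0 < 1 - ρ := by linarith
      have h4 := dotProduct_self_nonneg' (ρ • y 0 - (1 - ρ) • c)
      have h5 : (ρ • y 0 - (1 - ρ) • c) ⬝ᵥ (ρ • y 0 - (1 - ρ) • c) =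
          ρ * (y 0 ⬝ᵥ y 0) + (1 - ρ) * (c ⬝ᵥ c) - ρ * (1 - ρ) * (b ⬝ᵥ b) := by
        rw [hbc]
        simp only [dotProduct_add, dotProduct_sub, add_dotProduct, sub_dotProduct, smul_dotProduct,
          dotProduct_smul, smul_eq_mul, dotProduct_comm c (y 0)]
        ring
      have h6 : (1 - ρ) * (b ⬝ᵥ b) ≤ y 0 ⬝ᵥ y 0 + (1 - ρ) * (ρ * (b' ⬝ᵥ b')) := by
        have h7 := mul_le_mul_of_nonneg_left hcc hρ'.le
        have h8 : ρ * ((1 - ρ) * (b ⬝ᵥ b)) ≤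
            ρ * (y 0 ⬝ᵥ y 0 + (1 - ρ) * (ρ * (b' ⬝ᵥ b'))) := by nlinarith
        exact le_of_mul_le_mul_left h8 hρ
      rw [hsum, mul_add]
      have h9 : b ⬝ᵥ b + ρ / (1 - ρ) * (b ⬝ᵥ b) = (1 - ρ)⁻¹ ^ 2 * ((1 - ρ) * (b ⬝ᵥ b)) := by
        field_simp; ring
      have h10 : ρ / (1 - ρ) * (b' ⬝ᵥ b') =
          (1 - ρ)⁻¹ ^ 2 * ((1 - ρ) * (ρ * (b' ⬝ᵥ b'))) := by field_simp
      have h11 := mul_le_mul_of_nonneg_left h6 (sq_nonneg (1 - ρ)⁻¹)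
      rw [mul_add] at h11
      linarith

/-- The block Toeplitz covariance matrix. -/
noncomputable def blockCov (W : Matrix (Fin n) (Fin n) ℝ) (T : ℕ) :
    Matrix (Fin T × Fin n) (Fin T × Fin n) ℝ :=
  Matrix.of fun p q => S W ((q.1 : ℤ) - (p.1 : ℤ)) p.2 q.2

theorem quad_blockCov (T : ℕ) (v : Fin T × Fin n → ℝ) :
    v ⬝ᵥ blockCov W T *ᵥ v = ∑ i : Fin T, ∑ j : Fin T,
      (fun x => v (i, x)) ⬝ᵥ S W ((j : ℤ) - (i : ℤ)) *ᵥ (fun x => v (j, x)) := by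
  simp only [dotProduct, mulVec, blockCov, of_apply, Fintype.sum_prod_type, Finset.mul_sum]
  refine Finset.sum_congr rfl fun i _ => ?_
  rw [Finset.sum_comm]

theorem blockCov_bounds (hW : ‖W‖ ≤ ρ) (hρ : 0 < ρ) (hρ1 : ρ < 1) (T : ℕ)
    (v : Fin T × Fin n → ℝ) :
    1 / 4 * (v ⬝ᵥ v) ≤ v ⬝ᵥ blockCov W T *ᵥ v ∧
      v ⬝ᵥ blockCov W T *ᵥ v ≤ (1 - ρ)⁻¹ ^ 2 * (v ⬝ᵥ v) := by
  obtain ⟨r, h1, h2, h3⟩ := exists_quad_decomposition hW hρ hρ1 T (fun i x => v (i, x)) _ rfl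
  set b : Fin n → ℝ := ∑ j : Fin T, (W ^ (j : ℕ))ᵀ *ᵥ fun x => v (j, x)
  have hv : v ⬝ᵥ v = ∑ i : Fin T, (fun x => v (i, x)) ⬝ᵥ (fun x => v (i, x)) := by
    simp only [dotProduct, Fintype.sum_prod_type]
  have hb := dotProduct_self_nonneg' b
  have hS1 : b ⬝ᵥ b ≤ b ⬝ᵥ S W 0 *ᵥ b := by
    rw [S_zero_eq hW hρ1, quad_add, quad_one]
    have := quad_nonneg (conj_nonneg (S_zero_nonneg (W := W)) Wᵀ) b
    rw [transpose_transpose] at this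
    linarith
  have hS2 := quad_mono (S_zero_le hW hρ1) b
  rw [quad_smul_one] at hS2
  have hρ2 : (1 - ρ ^ 2)⁻¹ - 1 ≤ ρ / (1 - ρ) := by
    have h5 : 0 < 1 - ρ := by linarith
    have h6 : 0 < 1 - ρ ^ 2 := by nlinarith
    have : ρ / (1 - ρ) - ((1 - ρ ^ 2)⁻¹ - 1) = ρ / (1 - ρ ^ 2) := by
      have e : (1 - ρ ^ 2) = (1 - ρ) * (1 + ρ) := by ring
      have : (1 : ℝ) + ρ ≠ 0 := by positivity
      rw [e]
      field_simp
      ring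
    have : 0 ≤ ρ / (1 - ρ ^ 2) := by positivity
    linarith
  have h4 := mul_le_mul_of_nonneg_right hρ2 hb
  rw [quad_blockCov, h1, hv]
  constructor <;> linarith

theorem blockCov_nonneg (hW : ‖W‖ ≤ ρ) (hρ : 0 < ρ) (hρ1 : ρ < 1) (T : ℕ) :
    0 ≤ blockCov W T := by
  refine le_of_quad isHermitian_zero (isHermitian_of_transpose ?_) fun v => ?_
  · ext p q
    simp only [blockCov, transpose_apply, of_apply]
    rw [← neg_sub, ← S_transpose hW hρ1, transpose_apply]
  · have h1 := (blockCov_bounds hW hρ hρ1 T v).1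
    have h2 := dotProduct_self_nonneg' v
    rw [zero_mulVec, dotProduct_zero]
    linarith

theorem shiftSum_eq {T : ℕ} (W : Matrix (Fin n) (Fin n) ℝ) (P : Matrix (Fin T) (Fin T) ℝ) :
    shiftSum W P = ∑ i : Fin T, ∑ j : Fin T,
      ((1 / (T : ℝ)) * P i j) • S W ((i : ℤ) - (j : ℤ)) := by
  have htr : ∀ q : ℤ, (J T q * P).trace =
      ∑ i : Fin T, ∑ j : Fin T, if q = (i : ℤ) - (j : ℤ) then P i j else 0 := fun q => by
    rw [Finset.sum_comm]
    simp only [Matrix.trace, Matrix.diag, Matrix.mul_apply, J, of_apply, ite_mul, one_mul, zero_mul]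
    refine Finset.sum_congr rfl fun i _ => Finset.sum_congr rfl fun j _ => ?_
    congr 1
    exact propext ⟨fun h => by omega, fun h => by omega⟩
  have hterm : ∀ q : ℤ, ((1 / (T : ℝ)) * (J T q * P).trace) • S W q =
      ∑ i : Fin T, ∑ j : Fin T, if q = (i : ℤ) - (j : ℤ) then
        ((1 / (T : ℝ)) * P i j) • S W ((i : ℤ) - (j : ℤ)) else 0 := fun q => by
    rw [htr, Finset.mul_sum, Finset.sum_smul]
    refine Finset.sum_congr rfl fun i _ => ?_
    rw [Finset.mul_sum, Finset.sum_smul]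
    refine Finset.sum_congr rfl fun j _ => ?_
    split_ifs with h
    · rw [h]
    · simp
  have hsum : ∀ i j : Fin T, HasSum (fun q : ℤ => if q = (i : ℤ) - (j : ℤ) then
        ((1 / (T : ℝ)) * P i j) • S W ((i : ℤ) - (j : ℤ)) else 0)
        (((1 / (T : ℝ)) * P i j) • S W ((i : ℤ) - (j : ℤ))) := fun i j => by
    exact hasSum_ite_eq _ _
  rw [shiftSum]
  simp only [hterm]
  exact (hasSum_sum fun i _ => hasSum_sum fun j _ => hsum i j).tsum_eq

/-- `toeplitzTrace` with weight `1 / T`, as a linear map. -/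
noncomputable def toeplitzMap (W : Matrix (Fin n) (Fin n) ℝ) (T : ℕ) :
    Matrix (Fin n) (Fin n) ℝ →ₗ[ℝ] Matrix (Fin T) (Fin T) ℝ where
  toFun := toeplitzTrace W T (1 / (T : ℝ))
  map_add' M N := by ext i j; simp [toeplitzTrace, mul_add]
  map_smul' a M := by ext i j; simp [toeplitzTrace]; ring

/-- `shiftSum`, as a linear map. -/
noncomputable def shiftMap (W : Matrix (Fin n) (Fin n) ℝ) (T : ℕ) :
    Matrix (Fin T) (Fin T) ℝ →ₗ[ℝ] Matrix (Fin n) (Fin n) ℝ where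
  toFun := shiftSum W
  map_add' M N := by
    simp only [shiftSum_eq, Matrix.add_apply, mul_add, add_smul, Finset.sum_add_distrib]
  map_smul' a M := by
    simp only [shiftSum_eq, Matrix.smul_apply, smul_eq_mul, Finset.smul_sum, smul_smul,
      RingHom.id_apply, mul_left_comm]

theorem dualPair_toeplitzMap_shiftMap (hW : ‖W‖ ≤ ρ) (hρ : 0 < ρ) (hρ1 : ρ < 1) {T : ℕ}
    (hT : 0 < T) : DualPair (toeplitzMap W T) (shiftMap W T) (1 / (T : ℝ) * (1 / 4))
      (1 / (T : ℝ) * (1 - ρ)⁻¹ ^ 2) := by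
  obtain ⟨L, hL⟩ := exists_transpose_mul_self (blockCov_nonneg hW hρ hρ1 T)
  have hLe : ∀ p q, S W ((q.1 : ℤ) - (p.1 : ℤ)) p.2 q.2 = ∑ a, L a p * L a q := fun p q => by
    have := congrFun (congrFun hL p) q
    simpa [blockCov, Matrix.mul_apply] using this
  let K : Fin T × Fin n → Matrix (Fin n) (Fin T) ℝ := fun a => Matrix.of fun x i => L a (i, x)
  have hform : ∀ w v, ∑ a, (w ⬝ᵥ K a *ᵥ v) ^ 2 =
      (fun p : Fin T × Fin n => v p.1 * w p.2) ⬝ᵥ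
        blockCov W T *ᵥ (fun p : Fin T × Fin n => v p.1 * w p.2) := fun w v => by
    rw [hL, ← mulVec_mulVec, dotProduct_mulVec, vecMul_transpose]
    simp only [dotProduct, mulVec, ← sq]
    refine Finset.sum_congr rfl fun a _ => ?_
    congr 1
    rw [Fintype.sum_prod_type, Finset.sum_comm]
    refine Finset.sum_congr rfl fun x _ => ?_
    rw [Finset.mul_sum]
    refine Finset.sum_congr rfl fun i _ => ?_
    simp only [K, of_apply]
    ring
  have hnorm : ∀ (w : Fin n → ℝ) (v : Fin T → ℝ), (fun p : Fin T × Fin n => v p.1 * w p.2) ⬝ᵥ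
      (fun p : Fin T × Fin n => v p.1 * w p.2) = (w ⬝ᵥ w) * (v ⬝ᵥ v) := fun w v => by
    simp only [dotProduct, Fintype.sum_prod_type]
    rw [mul_comm, Finset.sum_mul_sum]
    refine Finset.sum_congr rfl fun i _ => Finset.sum_congr rfl fun x _ => ?_
    ring
  refine DualPair.of_kraus (K := K) (by norm_num) (by positivity) (by positivity) ?_ ?_ ?_
  · intro w v
    rw [hform, ← hnorm]
    exact blockCov_bounds hW hρ hρ1 T _
  · intro M
    ext i j
    change 1 / (T : ℝ) * (S W ((i : ℤ) - (j : ℤ)) * M).trace = _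
    rw [Matrix.smul_apply, smul_eq_mul, Matrix.sum_apply]
    congr 1
    simp only [Matrix.trace, Matrix.diag, Matrix.mul_apply, K, of_apply, transpose_apply,
      Finset.sum_mul]
    have e : ∀ x y, S W ((i : ℤ) - (j : ℤ)) x y = ∑ a, L a (i, y) * L a (j, x) := fun x y => by
      rw [← hLe (i, y) (j, x), ← neg_sub, ← S_transpose hW hρ1, transpose_apply]
    simp only [e, Finset.sum_mul]
    simp only [Finset.sum_comm (s := (Finset.univ : Finset (Fin n)))
      (t := (Finset.univ : Finset (Fin T × Fin n)))]
    refine Finset.sum_congr rfl fun a _ => ?_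
    refine Finset.sum_congr rfl fun x _ => Finset.sum_congr rfl fun y _ => ?_
    ring
  · intro N
    change shiftSum W N = _
    rw [shiftSum_eq]
    ext x y
    simp only [Matrix.sum_apply, Matrix.smul_apply, smul_eq_mul, Matrix.mul_apply, K, of_apply,
      transpose_apply, Finset.sum_mul]
    have e : ∀ i j : Fin T, S W ((i : ℤ) - (j : ℤ)) x y = ∑ a, L a (j, x) * L a (i, y) :=
      fun i j => hLe (j, x) (i, y)
    simp only [e, Finset.mul_sum]
    simp only [Finset.sum_comm (s := (Finset.univ : Finset (Fin T)))
      (t := (Finset.univ : Finset (Fin T × Fin n)))]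
    refine Finset.sum_congr rfl fun a _ => ?_
    refine Finset.sum_congr rfl fun i _ => Finset.sum_congr rfl fun j _ => ?_
    ring

end Covariance

section DataMatrix

theorem trace_le_rank_mul {ι : Type*} [Fintype ι] [DecidableEq ι] {H : Matrix ι ι ℝ} {a : ℝ}
    (hH : H.IsHermitian) (h : H ≤ a • 1) : H.trace ≤ H.rank * a := by
  have hle : ∀ i, hH.eigenvalues i ≤ a := fun i => by
    rw [hH.eigenvalues_eq, star_trivial, RCLike.re_to_real]
    have h1 := quad_mono h (hH.eigenvectorBasis i).ofLp
    have h2 := EuclideanSpace.real_norm_sq_eq (hH.eigenvectorBasis i)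
    rw [hH.eigenvectorBasis.orthonormal.1 i] at h2
    have h3 : (hH.eigenvectorBasis i).ofLp ⬝ᵥ (hH.eigenvectorBasis i).ofLp = 1 := by
      simp only [dotProduct, ← sq]
      simpa using h2.symm
    rw [quad_smul_one, h3, mul_one] at h1
    exact h1
  rw [hH.trace_eq_sum_eigenvalues, hH.rank_eq_card_non_zero_eigs, Fintype.card_subtype]
  simp only [RCLike.ofReal_real_eq_id, id_eq]
  rw [← Finset.sum_filter_ne_zero, ← nsmul_eq_mul]
  exact Finset.sum_le_card_nsmul _ _ _ fun i _ => hle i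

variable {n : ℕ} {W : Matrix (Fin n) (Fin n) ℝ} {ρ : ℝ}

theorem trace_mul_transpose_eq {ι τ : Type*} [Fintype ι] [Fintype τ] (M : Matrix ι τ ℝ) :
    (M * Mᵀ).trace = ∑ j, Mᵀ j ⬝ᵥ Mᵀ j := by
  simp only [Matrix.trace, Matrix.diag, Matrix.mul_apply, transpose_apply, dotProduct]
  exact Finset.sum_comm

/-- The matrix whose columns are those of `A`, delayed by one step. -/
def delay {T : ℕ} (A : Matrix (Fin n) (Fin (T + 1)) ℝ) : Matrix (Fin n) (Fin (T + 1)) ℝ :=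
  Matrix.of fun x j => (Fin.cons 0 (fun i : Fin T => A x i.castSucc) : Fin (T + 1) → ℝ) j

theorem sum_delay_le {T : ℕ} (A : Matrix (Fin n) (Fin (T + 1)) ℝ) {f : (Fin n → ℝ) → ℝ}
    (hf : ∀ v, 0 ≤ f v) (hf0 : f 0 = 0) : ∑ j, f ((delay A)ᵀ j) ≤ ∑ j, f (Aᵀ j) := by
  rw [Fin.sum_univ_succ, Fin.sum_univ_castSucc (fun j => f (Aᵀ j))]
  have h0 : (delay A)ᵀ 0 = 0 := by ext x; simp [delay]
  have h1 : ∀ i : Fin T, (delay A)ᵀ i.succ = Aᵀ i.castSucc := fun i => by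
    ext x; simp [delay]
  simp only [h0, h1, hf0, zero_add]
  exact le_add_of_nonneg_right (hf _)

/-- The displacement `A - W (delay A)` of the data matrix has rank at most three. -/
theorem rank_displacement_le {T : ℕ} (m : Fin n → ℝ) (u : ℤ → ℝ) :
    (dataMatrix W m u (T + 1) - W * delay (dataMatrix W m u (T + 1))).rank ≤ 3 := by
  set A := dataMatrix W m u (T + 1) with hA
  have hAe : ∀ x j, A x j = ∑ i ∈ Finset.range (T + 1), (W ^ i *ᵥ m) x *
      (1 / Real.sqrt ((T + 1 : ℕ) : ℝ) * u (((j : ℕ) : ℤ) - (i : ℤ))) := fun x j => by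
    rw [← Fin.sum_univ_eq_sum_range (fun i => (W ^ i *ᵥ m) x *
      (1 / Real.sqrt ((T + 1 : ℕ) : ℝ) * u (((j : ℕ) : ℤ) - (i : ℤ)))), hA]
    simp [dataMatrix, Matrix.mul_apply, memoryMatrix, inputMatrix]
  let w : Fin (T + 1) → Fin n → ℝ := fun j =>
    (1 / Real.sqrt ((T + 1 : ℕ) : ℝ) * u ((j : ℕ) : ℤ)) • m -
      (1 / Real.sqrt ((T + 1 : ℕ) : ℝ) * u (((j : ℕ) : ℤ) - ((T + 1 : ℕ) : ℤ))) • (W ^ (T + 1) *ᵥ m)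
  let N : Matrix (Fin n) (Fin 3) ℝ := Matrix.of fun x => ![m x, (W ^ (T + 1) *ᵥ m) x, A x 0 - w 0 x]
  let P : Matrix (Fin 3) (Fin (T + 1)) ℝ := Matrix.of
    ![fun j => 1 / Real.sqrt ((T + 1 : ℕ) : ℝ) * u ((j : ℕ) : ℤ),
      fun j => -(1 / Real.sqrt ((T + 1 : ℕ) : ℝ) * u (((j : ℕ) : ℤ) - ((T + 1 : ℕ) : ℤ))),
      fun j => if j = 0 then 1 else 0]
  have key : A - W * delay A = N * P := by
    ext x j
    have hNP : (N * P) x j = w j x + (A x 0 - w 0 x) * (if j = 0 then 1 else 0) := by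
      simp [Matrix.mul_apply, Fin.sum_univ_three, N, P, w]
      ring
    rw [hNP]
    refine Fin.cases ?_ (fun j => ?_) j
    · have : (W * delay A) x 0 = 0 := by simp [Matrix.mul_apply, delay]
      rw [Matrix.sub_apply, this]
      simp
    · have h1 : (W * delay A) x j.succ = ∑ i ∈ Finset.range (T + 1), (W ^ (i + 1) *ᵥ m) x *
          (1 / Real.sqrt ((T + 1 : ℕ) : ℝ) * u (((j.succ : ℕ) : ℤ) - ((i + 1 : ℕ) : ℤ))) := by
        simp only [Matrix.mul_apply, delay, of_apply, Fin.cons_succ, hAe, Finset.mul_sum]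
        rw [Finset.sum_comm]
        refine Finset.sum_congr rfl fun i _ => ?_
        rw [pow_succ', ← mulVec_mulVec]
        rw [mulVec, dotProduct, Finset.sum_mul]
        refine Finset.sum_congr rfl fun y _ => ?_
        have : (((j.castSucc : Fin (T + 1)) : ℕ) : ℤ) - (i : ℤ) =
            (((j.succ : Fin (T + 1)) : ℕ) : ℤ) - ((i + 1 : ℕ) : ℤ) := by simp
        rw [this]
        ring
      rw [Matrix.sub_apply, h1, hAe, ← Finset.sum_sub_distrib, Finset.sum_range_sub']
      simp [w]
      ring
  rw [key]
  refine (Matrix.rank_mul_le_left _ _).trans ?_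
  simpa using Matrix.rank_le_card_width N

/-- A bounded data matrix has bounded Frobenius norm. -/
theorem trace_dataMatrix_le (hW : ‖W‖ ≤ ρ) (hρ : 0 < ρ) (hρ1 : ρ < 1) {T : ℕ} (hT : 0 < T)
    {m : Fin n → ℝ} {u : ℤ → ℝ} {K : ℝ}
    (hK : ‖dataMatrix W m u T * (dataMatrix W m u T)ᵀ‖ ≤ K) :
    (dataMatrix W m u T * (dataMatrix W m u T)ᵀ).trace ≤ 12 * K / (1 - ρ) ^ 2 := by
  obtain ⟨T, rfl⟩ := Nat.exists_eq_succ_of_ne_zero hT.ne'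
  have hK0 : 0 ≤ K := (norm_nonneg _).trans hK
  have hrank := rank_displacement_le (T := T) (W := W) m u
  set A := dataMatrix W m u (T + 1)
  set D := A - W * delay A with hD
  have hAA : A * Aᵀ ≤ K • 1 := le_norm_smul_one
    (isHermitian_of_transpose (by rw [transpose_mul, transpose_transpose])) hK
  have hWt : ‖Wᵀ‖ ≤ ρ := by
    rw [← conjTranspose_eq_transpose_of_trivial, l2_opNorm_conjTranspose]; exact hW
  have hcol : ∀ (M : Matrix (Fin n) (Fin (T + 1)) ℝ) (e : Fin n → ℝ),
      e ⬝ᵥ (M * Mᵀ) *ᵥ e = ∑ j, (e ⬝ᵥ Mᵀ j) ^ 2 := fun M e => by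
    rw [← mulVec_mulVec, dotProduct_mulVec, ← mulVec_transpose]
    simp only [dotProduct, mulVec, sq, transpose_apply, mul_comm (e _)]
  have hDD : D * Dᵀ ≤ (4 * K) • 1 := by
    refine le_of_quad (isHermitian_of_transpose (by rw [transpose_mul, transpose_transpose]))
      (isHermitian_of_nonneg (smul_one_nonneg (by positivity))) fun e => ?_
    rw [quad_smul_one, hcol]
    have h1 : ∀ j, e ⬝ᵥ Dᵀ j = e ⬝ᵥ Aᵀ j - (Wᵀ *ᵥ e) ⬝ᵥ (delay A)ᵀ j := fun j => by
      have : Dᵀ j = Aᵀ j - W *ᵥ (delay A)ᵀ j := by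
        ext x; simp [hD, Matrix.mul_apply, mulVec, dotProduct]
      rw [this, dotProduct_sub, dotProduct_mulVec, mulVec_transpose]
    have h2 : ∑ j, (e ⬝ᵥ Aᵀ j) ^ 2 ≤ K * (e ⬝ᵥ e) := by
      have := quad_mono hAA e
      rwa [hcol, quad_smul_one] at this
    have h3 : ∑ j, ((Wᵀ *ᵥ e) ⬝ᵥ (delay A)ᵀ j) ^ 2 ≤ K * (e ⬝ᵥ e) := by
      refine (sum_delay_le A (f := fun v => ((Wᵀ *ᵥ e) ⬝ᵥ v) ^ 2) (fun v => sq_nonneg _)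
        (by simp)).trans ?_
      have h4 := quad_mono hAA (Wᵀ *ᵥ e)
      rw [hcol, quad_smul_one] at h4
      refine h4.trans (mul_le_mul_of_nonneg_left ?_ hK0)
      exact (dotProduct_mulVec_self_le hWt e).trans
        (mul_le_of_le_one_left (dotProduct_self_nonneg' e) (by nlinarith))
    calc ∑ j, (e ⬝ᵥ Dᵀ j) ^ 2
        ≤ ∑ j, (2 * (e ⬝ᵥ Aᵀ j) ^ 2 + 2 * ((Wᵀ *ᵥ e) ⬝ᵥ (delay A)ᵀ j) ^ 2) :=
          Finset.sum_le_sum fun j _ => by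
            rw [h1]
            nlinarith [sq_nonneg (e ⬝ᵥ Aᵀ j + (Wᵀ *ᵥ e) ⬝ᵥ (delay A)ᵀ j)]
      _ = 2 * ∑ j, (e ⬝ᵥ Aᵀ j) ^ 2 + 2 * ∑ j, ((Wᵀ *ᵥ e) ⬝ᵥ (delay A)ᵀ j) ^ 2 := by
          rw [Finset.sum_add_distrib, Finset.mul_sum, Finset.mul_sum]
      _ ≤ 4 * K * (e ⬝ᵥ e) := by linarith
  have htrD : (D * Dᵀ).trace ≤ 12 * K := by
    have h1 := trace_le_rank_mul (isHermitian_of_transpose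
      (by rw [transpose_mul, transpose_transpose])) hDD
    have h2 : ((D * Dᵀ).rank : ℝ) ≤ 3 := by
      exact_mod_cast (Matrix.rank_mul_le_left _ _).trans hrank
    have := mul_le_mul_of_nonneg_right h2 (by positivity : 0 ≤ 4 * K)
    linarith
  have hρ' : 0 < 1 - ρ := by linarith
  have hcolA : ∀ j, (1 - ρ) * (Aᵀ j ⬝ᵥ Aᵀ j) ≤
      Dᵀ j ⬝ᵥ Dᵀ j + (1 - ρ) * (ρ * ((delay A)ᵀ j ⬝ᵥ (delay A)ᵀ j)) := fun j => by
    set d := Dᵀ j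
    set c := W *ᵥ (delay A)ᵀ j with hc
    have hAj : Aᵀ j = d + c := by
      have : d = Aᵀ j - c := by
        ext x
        simp [d, c, hD, Matrix.mul_apply, mulVec, dotProduct, mul_comm]
      rw [this, sub_add_cancel]
    have hcc : c ⬝ᵥ c ≤ ρ ^ 2 * ((delay A)ᵀ j ⬝ᵥ (delay A)ᵀ j) := dotProduct_mulVec_self_le hW _
    have h4 := dotProduct_self_nonneg' (ρ • d - (1 - ρ) • c)
    have h5 : (ρ • d - (1 - ρ) • c) ⬝ᵥ (ρ • d - (1 - ρ) • c) =
        ρ * (d ⬝ᵥ d) + (1 - ρ) * (c ⬝ᵥ c) - ρ * (1 - ρ) * (Aᵀ j ⬝ᵥ Aᵀ j) := by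
      rw [hAj]
      simp only [dotProduct_add, dotProduct_sub, add_dotProduct, sub_dotProduct, smul_dotProduct,
        dotProduct_smul, smul_eq_mul, dotProduct_comm c d]
      ring
    have h7 := mul_le_mul_of_nonneg_left hcc hρ'.le
    refine le_of_mul_le_mul_left ?_ hρ
    nlinarith
  have hsum := Finset.sum_le_sum fun j (_ : j ∈ Finset.univ) => hcolA j
  rw [Finset.sum_add_distrib, ← Finset.mul_sum, ← Finset.mul_sum, ← Finset.mul_sum,
    ← trace_mul_transpose_eq, ← trace_mul_transpose_eq] at hsum
  have hdel := sum_delay_le A (f := fun v => v ⬝ᵥ v) dotProduct_self_nonneg' (by simp)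
  rw [← trace_mul_transpose_eq A] at hdel
  rw [le_div_iff₀ (by positivity)]
  have h8 := mul_le_mul_of_nonneg_left hdel (by positivity : 0 ≤ (1 - ρ) * ρ)
  nlinarith

end DataMatrix

section Rescaling

variable {ι τ : Type*} [Fintype ι] [Fintype τ] [DecidableEq ι] [DecidableEq τ] {η γ : ℝ}

theorem rescaled_eq (hη : 0 < η) (X : Matrix ι ι ℝ) :
    (γ / η ^ 2) • 1 + γ • X = (γ / η ^ 2) • (1 + η ^ 2 • X) := by
  rw [smul_add, smul_smul, div_mul_cancel₀ _ (by positivity)]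

theorem posDef_one_add_smul {X : Matrix ι ι ℝ} (hX : 0 ≤ X) (a : ℝ) (ha : 0 ≤ a) :
    (1 + a • X).PosDef :=
  posDef_of_one_le (le_add_of_nonneg_right (smul_nonneg ha hX))

theorem posDef_rescaled (hη : 0 < η) (hγ : 0 < γ) {X : Matrix ι ι ℝ} (hX : 0 ≤ X) :
    ((γ / η ^ 2) • 1 + γ • X).PosDef := by
  rw [rescaled_eq hη]
  exact (posDef_one_add_smul hX _ (by positivity)).smul (by positivity)

theorem res_rescaled (hη : 0 < η) (hγ : 0 < γ) (A : Matrix ι τ ℝ) {X : Matrix ι ι ℝ} (hX : 0 ≤ X)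
    (Y : Matrix τ τ ℝ) : res (η⁻¹ • A) ((γ / η ^ 2) • 1 + γ • X) (1 + η ^ 2 • Y) =
      (1 + η ^ 2 • Y + (1 / γ) • (Aᵀ * (1 + η ^ 2 • X)⁻¹ * A))⁻¹ := by
  rw [res, rescaled_eq hη, inv_smul_real (by positivity) (posDef_one_add_smul hX _ (by positivity))]
  simp only [transpose_smul, Matrix.smul_mul, Matrix.mul_smul, smul_smul]
  have e : η⁻¹ * ((γ / η ^ 2)⁻¹ * η⁻¹) = 1 / γ := by field_simp
  rw [← e]

theorem res_transpose_rescaled (hη : 0 < η) (hγ : 0 < γ) (A : Matrix ι τ ℝ) {X : Matrix ι ι ℝ}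
    (hX : 0 ≤ X) {Y : Matrix τ τ ℝ} (hY : 0 ≤ Y) :
    res (η⁻¹ • A)ᵀ (1 + η ^ 2 • Y) ((γ / η ^ 2) • 1 + γ • X) =
      (η ^ 2 / γ) • (1 + η ^ 2 • X + (1 / γ) • (A * (1 + η ^ 2 • Y)⁻¹ * Aᵀ))⁻¹ := by
  have hη2 : 0 < η ^ 2 := by positivity
  have hpd : (1 + η ^ 2 • X + (1 / γ) • (A * (1 + η ^ 2 • Y)⁻¹ * Aᵀ)).PosDef := by
    refine posDef_of_le (posDef_one_add_smul hX _ hη2.le) (le_add_of_nonneg_right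
      (smul_nonneg (by positivity) ?_))
    have := conj_nonneg (PosDef.inv_nonneg (posDef_one_add_smul hY _ hη2.le)) Aᵀ
    rwa [transpose_transpose] at this
  have e : η ^ 2 / γ = (γ / η ^ 2)⁻¹ := by rw [inv_div]
  rw [e, ← inv_smul_real (by positivity) hpd, res, rescaled_eq hη, smul_add (γ / η ^ 2)
    (1 + η ^ 2 • X)]
  simp only [transpose_smul, Matrix.smul_mul, Matrix.mul_smul, smul_smul, transpose_transpose]
  rw [show γ / η ^ 2 * (1 / γ) = η⁻¹ * η⁻¹ by field_simp]

end Rescaling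

section Translation

variable {n T : ℕ} {W B : Matrix (Fin n) (Fin n) ℝ} {A : Matrix (Fin n) (Fin T) ℝ} {η γ c : ℝ}
  {R G : Matrix (Fin T) (Fin T) ℝ} {Rt Gt : Matrix (Fin n) (Fin n) ℝ}

theorem res_eq_smul_Qtbar (hη : 0 < η) (hγ : 0 < γ) (hRt : 0 ≤ Rt) :
    res (η⁻¹ • A) ((γ / η ^ 2) • 1 + γ • Rt) (1 + η ^ 2 • R) = γ • Qtbar A η γ R Rt := by
  rw [res_rescaled hη hγ A hRt, Qtbar, smul_smul, mul_one_div_cancel hγ.ne', one_smul]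

theorem res_eq_smul_Qbar (hη : 0 < η) (hγ : 0 < γ) (hR : 0 ≤ R) (hRt : 0 ≤ Rt) :
    res (η⁻¹ • A)ᵀ (1 + η ^ 2 • R) ((γ / η ^ 2) • 1 + γ • Rt) = η ^ 2 • Qbar A η γ R Rt := by
  rw [res_transpose_rescaled hη hγ A hRt hR, Qbar, smul_smul, mul_one_div]

theorem res_eq_smul_Qbar' (hη : 0 < η) (hγ : 0 < γ) (hR : 0 ≤ R) :
    res (η⁻¹ • Aᵀ) ((γ / η ^ 2) • 1 + γ • R) (1 + η ^ 2 • Rt) = γ • Qbar A η γ R Rt := by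
  rw [res_rescaled hη hγ Aᵀ hR, Qbar, smul_smul, mul_one_div_cancel hγ.ne', one_smul,
    transpose_transpose]

theorem res_eq_smul_Qtbar' (hη : 0 < η) (hγ : 0 < γ) (hR : 0 ≤ R) (hRt : 0 ≤ Rt) :
    res (η⁻¹ • Aᵀ)ᵀ (1 + η ^ 2 • Rt) ((γ / η ^ 2) • 1 + γ • R) = η ^ 2 • Qtbar A η γ R Rt := by
  rw [res_transpose_rescaled hη hγ Aᵀ hR hRt, Qtbar, smul_smul, mul_one_div, transpose_transpose]

theorem toeplitzMap_apply (M : Matrix (Fin n) (Fin n) ℝ) :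
    toeplitzMap W T M = toeplitzTrace W T (1 / (T : ℝ)) M := rfl

theorem shiftMap_apply (M : Matrix (Fin T) (Fin T) ℝ) : shiftMap W T M = shiftSum W M := rfl

theorem toeplitzTrace_eq_smul (hT : 0 < T) (a : ℝ) (M : Matrix (Fin n) (Fin n) ℝ) :
    toeplitzTrace W T a M = (a * T) • toeplitzMap W T M := by
  have : (T : ℝ) ≠ 0 := by positivity
  ext i j
  simp only [toeplitzMap_apply, toeplitzTrace, of_apply, Matrix.smul_apply, smul_eq_mul]
  field_simp

namespace IsFirstOrder

theorem isSol (h : IsFirstOrder W A η γ R Rt) (hη : 0 < η) (hγ : 0 < γ) :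
    IsSol (toeplitzMap W T) (shiftMap W T) 1 (γ / η ^ 2) (η⁻¹ • A)
      ((γ / η ^ 2) • 1 + γ • Rt) (1 + η ^ 2 • R) := by
  have hR := nonneg_iff_posSemidef.2 h.posSemidef
  have hRt := nonneg_iff_posSemidef.2 h.posSemidef_tilde
  refine ⟨posDef_rescaled hη hγ hRt, posDef_one_add_smul hR _ (by positivity), ?_, ?_⟩
  · rw [res_eq_smul_Qtbar hη hγ hRt, map_smul, shiftMap_apply, ← h.eq_tilde]
  · rw [res_eq_smul_Qbar hη hγ hR hRt, map_smul, toeplitzMap_apply, ← h.eq, one_smul]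

theorem isSol_swap (h : IsFirstOrder W A η γ R Rt) (hη : 0 < η) (hγ : 0 < γ) :
    IsSol (shiftMap W T) (toeplitzMap W T) 1 (γ / η ^ 2) (η⁻¹ • Aᵀ)
      ((γ / η ^ 2) • 1 + γ • R) (1 + η ^ 2 • Rt) := by
  have hR := nonneg_iff_posSemidef.2 h.posSemidef
  have hRt := nonneg_iff_posSemidef.2 h.posSemidef_tilde
  refine ⟨posDef_rescaled hη hγ hR, posDef_one_add_smul hRt _ (by positivity), ?_, ?_⟩
  · rw [res_eq_smul_Qbar' hη hγ hR, map_smul, toeplitzMap_apply, ← h.eq]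
  · rw [res_eq_smul_Qtbar' hη hγ hR hRt, map_smul, shiftMap_apply, ← h.eq_tilde, one_smul]

theorem isSol₂ (h : IsFirstOrder W A η γ R Rt) (hη : 0 < η) (hγ : 0 < γ)
    (hG : IsSecondOrder W A B η γ R Rt G Gt) :
    IsSol₂ (toeplitzMap W T) (shiftMap W T) 1 B 0
      (res (η⁻¹ • A) ((γ / η ^ 2) • 1 + γ • Rt) (1 + η ^ 2 • R))
      (res (η⁻¹ • A)ᵀ (1 + η ^ 2 • R) ((γ / η ^ 2) • 1 + γ • Rt)) Gt (η ^ 4 • G) := by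
  have hR := nonneg_iff_posSemidef.2 h.posSemidef
  have hRt := nonneg_iff_posSemidef.2 h.posSemidef_tilde
  rw [res_eq_smul_Qtbar hη hγ hRt, res_eq_smul_Qbar hη hγ hR hRt]
  constructor
  · nth_rw 1 [hG.eq_tilde]
    simp only [zero_add, Matrix.smul_mul, Matrix.mul_smul, smul_smul, map_smul, shiftMap_apply]
    congr 1; ring
  · nth_rw 1 [hG.eq]
    simp only [Matrix.smul_mul, Matrix.mul_smul, smul_smul, map_smul, toeplitzMap_apply]
    congr 1; ring

theorem isSol₂_swap (h : IsFirstOrder W A η γ R Rt) (hη : 0 < η) (hγ : 0 < γ)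
    (hG : IsSecondOrder W A B η γ R Rt G Gt) :
    IsSol₂ (shiftMap W T) (toeplitzMap W T) 1 0 B
      (res (η⁻¹ • Aᵀ) ((γ / η ^ 2) • 1 + γ • R) (1 + η ^ 2 • Rt))
      (res (η⁻¹ • Aᵀ)ᵀ (1 + η ^ 2 • Rt) ((γ / η ^ 2) • 1 + γ • R)) (γ ^ 2 • G) Gt := by
  have hR := nonneg_iff_posSemidef.2 h.posSemidef
  have hRt := nonneg_iff_posSemidef.2 h.posSemidef_tilde
  rw [res_eq_smul_Qbar' hη hγ hR, res_eq_smul_Qtbar' hη hγ hR hRt]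
  constructor
  · nth_rw 1 [hG.eq]
    simp only [Matrix.smul_mul, Matrix.mul_smul, smul_smul, map_smul, toeplitzMap_apply]
    congr 1; ring
  · nth_rw 1 [hG.eq_tilde]
    simp only [zero_add, Matrix.smul_mul, Matrix.mul_smul, smul_smul, map_smul, shiftMap_apply]
    congr 1; ring

end IsFirstOrder

/-- Solutions of both systems exist at every level `γ > 0`. -/
theorem exists_isFirstOrder_isSecondOrder {k C : ℝ}
    (hD : DualPair (toeplitzMap W T) (shiftMap W T) k C) (hη : 0 < η) (hγ : 0 < γ)
    (A : Matrix (Fin n) (Fin T) ℝ) (B : Matrix (Fin n) (Fin n) ℝ) :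
    ∃ R Rt, IsFirstOrder W A η γ R Rt ∧ ∃ G Gt, IsSecondOrder W A B η γ R Rt G Gt := by
  have hβ : 0 < γ / η ^ 2 := by positivity
  obtain ⟨V, Z, h⟩ := hD.exists_isSol zero_le_one hβ (η⁻¹ • A)
  set P := res (η⁻¹ • A) V Z with hP
  set Q := res (η⁻¹ • A)ᵀ Z V with hQ
  have hP0 : 0 ≤ P := res_nonneg h.posDef_left h.posDef_right
  have hQ0 : 0 ≤ Q := res_nonneg h.posDef_right h.posDef_left
  set R : Matrix (Fin T) (Fin T) ℝ := (η ^ 2)⁻¹ • toeplitzMap W T Q with hR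
  set Rt : Matrix (Fin n) (Fin n) ℝ := γ⁻¹ • shiftMap W T P with hRt
  have hR0 : 0 ≤ R := smul_nonneg (by positivity) (hD.map_nonneg hQ0)
  have hRt0 : 0 ≤ Rt := smul_nonneg (by positivity) (hD.symm.map_nonneg hP0)
  have hV : V = (γ / η ^ 2) • 1 + γ • Rt := by
    rw [hRt, smul_smul, mul_inv_cancel₀ hγ.ne', one_smul]; exact h.eq_left
  have hZ : Z = 1 + η ^ 2 • R := by
    rw [hR, smul_smul, mul_inv_cancel₀ (by positivity), one_smul, ← one_smul ℝ (toeplitzMap W T Q)]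
    exact h.eq_right
  have hPe : P = γ • Qtbar A η γ R Rt := by
    rw [hP, hV, hZ, res_eq_smul_Qtbar hη hγ hRt0]
  have hQe : Q = η ^ 2 • Qbar A η γ R Rt := by
    rw [hQ, hV, hZ, res_eq_smul_Qbar hη hγ hR0 hRt0]
  have hη2 : η ^ 2 ≠ 0 := by positivity
  refine ⟨R, Rt, ⟨nonneg_iff_posSemidef.1 hR0, nonneg_iff_posSemidef.1 hRt0, ?_, ?_⟩, ?_⟩
  · nth_rw 1 [hR]
    rw [hQe, map_smul, smul_smul, inv_mul_cancel₀ hη2, one_smul, toeplitzMap_apply]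
  · nth_rw 1 [hRt]
    rw [hPe, map_smul, smul_smul, inv_mul_cancel₀ hγ.ne', one_smul, shiftMap_apply]
  · obtain ⟨G₁, G₂, hG⟩ := h.exists_isSol₂ hD zero_le_one hβ.le hβ (h.smul_one_le hD) B 0
    rw [← hP, ← hQ] at hG
    refine ⟨(η ^ 4)⁻¹ • G₂, G₁, ?_, ?_⟩
    · rw [hG.eq_right, hQe]
      simp only [Matrix.smul_mul, Matrix.mul_smul, smul_smul, map_smul, toeplitzMap_apply]
      rw [show (η ^ 4)⁻¹ * (1 * (η ^ 2 * η ^ 2)) = 1 by field_simp, one_smul]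
    · have hη4 : η ^ 4 * (η ^ 4)⁻¹ = 1 := mul_inv_cancel₀ (by positivity)
      nth_rw 1 [hG.eq_left]
      rw [hPe, ← shiftMap_apply]
      simp only [zero_add, Matrix.smul_mul, Matrix.mul_smul, smul_smul, map_smul]
      congr 1
      linear_combination (-γ ^ 2) * hη4

theorem shiftGt_of_lt {X : Matrix (Fin n) (Fin n) ℝ} (hc : c < 1) : shiftGt c X = X := by
  simp [shiftGt, hc.le]

theorem shiftLt_of_lt {X : Matrix (Fin T) (Fin T) ℝ} (hc : c < 1) : shiftLt c X = 1 + X := by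
  simp [shiftLt, hc]

theorem shiftGt_of_gt {X : Matrix (Fin n) (Fin n) ℝ} (hc : 1 < c) : shiftGt c X = 1 + X := by
  simp [shiftGt, hc]

theorem shiftLt_of_gt {X : Matrix (Fin T) (Fin T) ℝ} (hc : 1 < c) : shiftLt c X = X := by
  simp [shiftLt, hc.le]

namespace IsLimitFirstOrder

theorem isSol (h : IsLimitFirstOrder W c R Rt) (hc : c < 1) (hT : 0 < T) :
    IsSol (toeplitzMap W T) (shiftMap W T) (c * (1 / (n : ℝ)) * T) 0
      (0 : Matrix (Fin n) (Fin T) ℝ) Rt (1 + R) := by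
  have h1 := h.posDef_shift
  have h2 := h.posDef_shift_tilde
  have h3 := h.eq
  have h4 := h.eq_tilde
  rw [shiftGt_of_lt hc] at h2 h3
  rw [shiftLt_of_lt hc] at h1 h4
  refine ⟨h2, h1, ?_, ?_⟩
  · rw [res_zero, zero_smul, zero_add, shiftMap_apply, ← h4]
  · rw [transpose_zero, res_zero, ← toeplitzTrace_eq_smul hT, ← h3]

theorem _root_.ESN.IsLimitSecondOrder.isSol₂ (h : IsLimitSecondOrder W B c R Rt G Gt)
    (hc : c < 1) (hT : 0 < T) :
    IsSol₂ (toeplitzMap W T) (shiftMap W T) (c * (1 / (n : ℝ)) * T) B 0 (1 + R)⁻¹ Rt⁻¹ Gt G := by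
  have h1 := h.eq
  have h2 := h.eq_tilde
  rw [shiftGt_of_lt hc] at h1
  rw [shiftLt_of_lt hc] at h2
  exact ⟨by rw [zero_add, shiftMap_apply]; exact h2, by rw [← toeplitzTrace_eq_smul hT]; exact h1⟩

theorem isSol_swap (h : IsLimitFirstOrder W c R Rt) (hc : 1 < c) (hT : 0 < T) (hn : 0 < n) :
    IsSol (shiftMap W T) (toeplitzMap W T) (c * (1 / (n : ℝ)) * T)⁻¹ 0
      (0 : Matrix (Fin T) (Fin n) ℝ) ((c * (1 / (n : ℝ)) * T)⁻¹ • R) (1 + Rt) := by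
  have h1 := h.posDef_shift
  have h2 := h.posDef_shift_tilde
  have h3 := h.eq
  have h4 := h.eq_tilde
  rw [shiftGt_of_gt hc] at h2 h3
  rw [shiftLt_of_gt hc] at h1 h4
  have ht : 0 < c * (1 / (n : ℝ)) * T := by positivity
  refine ⟨h1.smul (by positivity), h2, ?_, ?_⟩
  · nth_rw 1 [h3]
    rw [res_zero, zero_smul, zero_add, toeplitzTrace_eq_smul hT, smul_smul, inv_mul_cancel₀ ht.ne',
      one_smul]
  · rw [transpose_zero, res_zero, inv_smul_real (by positivity) h1, inv_inv, map_smul, smul_smul,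
      inv_mul_cancel₀ ht.ne', one_smul, shiftMap_apply, ← h4]

theorem isSol₂_swap (h : IsLimitFirstOrder W c R Rt) (hG : IsLimitSecondOrder W B c R Rt G Gt)
    (hc : 1 < c) (hT : 0 < T) (hn : 0 < n) :
    IsSol₂ (shiftMap W T) (toeplitzMap W T) (c * (1 / (n : ℝ)) * T)⁻¹ 0 B (1 + Rt)⁻¹
      ((c * (1 / (n : ℝ)) * T)⁻¹ • R)⁻¹ ((c * (1 / (n : ℝ)) * T)⁻¹ • G) Gt := by
  have h0 := h.posDef_shift
  have h1 := hG.eq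
  have h2 := hG.eq_tilde
  rw [shiftGt_of_gt hc] at h1
  rw [shiftLt_of_gt hc] at h0 h2
  have ht : 0 < c * (1 / (n : ℝ)) * T := by positivity
  set t : ℝ := c * (1 / (n : ℝ)) * T with htd
  constructor
  · nth_rw 1 [h1]
    rw [toeplitzTrace_eq_smul hT, smul_smul, ← htd, inv_mul_cancel₀ ht.ne', one_smul]
  · nth_rw 1 [h2]
    rw [inv_smul_real (by positivity) h0, inv_inv, zero_add]
    simp only [Matrix.smul_mul, Matrix.mul_smul, smul_smul, map_smul, shiftMap_apply]
    rw [show t⁻¹ * (t * (t⁻¹ * t)) = 1 by field_simp, one_smul]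

end IsLimitFirstOrder

/-- Existence for the limiting systems, `c < 1`. -/
theorem exists_isLimit_of_lt {k C : ℝ} (hD : DualPair (toeplitzMap W T) (shiftMap W T) k C)
    (hc0 : 0 ≤ c) (hc : c < 1) (hT : 0 < T) (hn : 0 < n) (B : Matrix (Fin n) (Fin n) ℝ) :
    ∃ R Rt, IsLimitFirstOrder (T := T) W c R Rt ∧
      ∃ G Gt, IsLimitSecondOrder W B c R Rt G Gt := by
  have ht : 0 ≤ c * (1 / (n : ℝ)) * T := by positivity
  have hT' : (0 : ℝ) < T := by positivity
  have hd : 0 < (Fintype.card (Fin T) : ℝ) - c * (1 / (n : ℝ)) * T * Fintype.card (Fin n) := by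
    have hn' : (n : ℝ) ≠ 0 := by positivity
    rw [Fintype.card_fin, Fintype.card_fin]
    have : c * (1 / (n : ℝ)) * T * n = c * T := by field_simp
    rw [this]; nlinarith
  obtain ⟨V, Z, h⟩ := hD.exists_isSol_zero ht hd
  have h1 : Z = 1 + (Z - 1) := by abel
  have e1 := h.eq_left
  have e2 := h.eq_right
  rw [res_zero, zero_smul, zero_add] at e1
  rw [transpose_zero, res_zero, ← toeplitzTrace_eq_smul hT] at e2
  refine ⟨Z - 1, V, ⟨nonneg_iff_posSemidef.1 (sub_nonneg.2 (h.one_le hD ht)),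
    h.posDef_left.posSemidef, ?_, ?_, ?_, ?_⟩, ?_⟩
  · rw [shiftLt_of_lt hc, ← h1]; exact h.posDef_right
  · rw [shiftGt_of_lt hc]; exact h.posDef_left
  · rw [shiftGt_of_lt hc]; exact sub_eq_of_eq_add' e2
  · rw [shiftLt_of_lt hc, ← h1]; exact e1
  · obtain ⟨G₁, G₂, hG⟩ := h.exists_isSol₂ hD ht le_rfl (mul_pos hD.k_pos hd)
      (h.lower_left hD (Or.inr rfl) ht le_rfl le_rfl) B 0
    rw [transpose_zero, res_zero, res_zero] at hG
    refine ⟨G₂, G₁, ?_, ?_⟩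
    · rw [shiftGt_of_lt hc, toeplitzTrace_eq_smul hT]; exact hG.eq_right
    · rw [shiftLt_of_lt hc, ← h1]
      have := hG.eq_left
      rwa [zero_add] at this

/-- Existence for the limiting systems, `c > 1`. -/
theorem exists_isLimit_of_gt {k C : ℝ} (hD : DualPair (toeplitzMap W T) (shiftMap W T) k C)
    (hc : 1 < c) (hT : 0 < T) (hn : 0 < n) (B : Matrix (Fin n) (Fin n) ℝ) :
    ∃ R Rt, IsLimitFirstOrder (T := T) W c R Rt ∧
      ∃ G Gt, IsLimitSecondOrder W B c R Rt G Gt := by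
  set t : ℝ := c * (1 / (n : ℝ)) * T with htd
  have ht : 0 < t := by positivity
  have hti : 0 ≤ t⁻¹ := by positivity
  have hd : 0 < (Fintype.card (Fin n) : ℝ) - t⁻¹ * Fintype.card (Fin T) := by
    have hT' : (T : ℝ) ≠ 0 := by positivity
    have hn' : (0 : ℝ) < n := by positivity
    rw [Fintype.card_fin, Fintype.card_fin, htd]
    have : (c * (1 / (n : ℝ)) * T)⁻¹ * T = n * c⁻¹ := by field_simp
    rw [this]
    have : c⁻¹ < 1 := inv_lt_one_of_one_lt₀ hc
    nlinarith
  obtain ⟨V, Z, h⟩ := hD.symm.exists_isSol_zero hti hd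
  have h1 : Z = 1 + (Z - 1) := by abel
  have e1 := h.eq_left
  have e2 := h.eq_right
  have hV := h.posDef_left
  rw [res_zero, zero_smul, zero_add] at e1
  rw [transpose_zero, res_zero] at e2
  have hVinv : (t • V)⁻¹ = t⁻¹ • V⁻¹ := inv_smul_real ht.ne' hV
  refine ⟨t • V, Z - 1, ⟨(hV.smul ht).posSemidef,
    nonneg_iff_posSemidef.1 (sub_nonneg.2 (h.one_le hD.symm hti)), ?_, ?_, ?_, ?_⟩, ?_⟩
  · rw [shiftLt_of_gt hc]; exact hV.smul ht
  · rw [shiftGt_of_gt hc, ← h1]; exact h.posDef_right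
  · rw [shiftGt_of_gt hc, ← h1, toeplitzTrace_eq_smul hT, ← htd, ← e1]
  · rw [shiftLt_of_gt hc, hVinv, ← shiftMap_apply, map_smul]; exact sub_eq_of_eq_add' e2
  · obtain ⟨G₁, G₂, hG⟩ := h.exists_isSol₂ hD.symm hti le_rfl (mul_pos hD.k_pos hd)
      (h.lower_left hD.symm (Or.inr rfl) hti le_rfl le_rfl) 0 B
    rw [transpose_zero, res_zero, res_zero] at hG
    refine ⟨t • G₁, G₂, ?_, ?_⟩
    · rw [shiftGt_of_gt hc, ← h1, toeplitzTrace_eq_smul hT, ← htd, ← hG.eq_left]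
    · rw [shiftLt_of_gt hc, hVinv, ← shiftMap_apply]
      have := hG.eq_right
      rw [zero_add] at this
      simp only [Matrix.smul_mul, Matrix.mul_smul, smul_smul, map_smul]
      rw [show t⁻¹ * (t * t⁻¹) = t⁻¹ by field_simp]
      exact this

end Translation

section SmallGamma

/-- Quantitative criterion for `SmallGammaLimit`. -/
theorem smallGammaLimit_of_bounds {d : ℕ → ℕ} {E : ℕ → Prop}
    {F : ∀ n, ℝ → Matrix (Fin (d n)) (Fin (d n)) ℝ} {L : ∀ n, Matrix (Fin (d n)) (Fin (d n)) ℝ}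
    {a e₀ K : ℝ} {r : ℕ → ℝ} (he₀ : 0 < e₀) (hr : Tendsto r atTop (𝓝 0))
    (hF : ∀ᶠ n in atTop, ∀ γ γ' : ℝ, 0 < γ → 0 < γ' → (γ + γ') / a ≤ e₀ →
      ‖F n γ - F n γ'‖ ≤ K * ((γ + γ') / a))
    (hL : ∀ᶠ n in atTop, ∀ γ : ℝ, 0 < γ → γ / a + r n ≤ e₀ → ‖F n γ - L n‖ ≤ K * (γ / a + r n))
    (hE : ∀ᶠ n in atTop, E n → r n = 0) : SmallGammaLimit E F L := by
  have hid : Tendsto (fun γ : ℝ => γ) (𝓝[>] 0) (𝓝 0) := tendsto_nhdsWithin_of_tendsto_nhds tendsto_id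
  have hpos : ∀ᶠ γ : ℝ in 𝓝[>] 0, 0 < γ := self_mem_nhdsWithin
  refine ⟨?_, ?_, ?_⟩
  · filter_upwards [hF] with n hn
    have : CompleteSpace (Matrix (Fin (d n)) (Fin (d n)) ℝ) := FiniteDimensional.complete ℝ _
    have hsum : Tendsto (fun p : ℝ × ℝ => (p.1 + p.2) / a) (𝓝[>] 0 ×ˢ 𝓝[>] 0) (𝓝 0) := by
      simpa using ((hid.comp tendsto_fst).add (hid.comp tendsto_snd)).div_const a
    have hc : Cauchy (map (F n) (𝓝[>] 0)) := by
      rw [cauchy_map_iff', Metric.uniformity_eq_comap_nhds_zero, tendsto_comap_iff]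
      refine squeeze_zero_norm' ?_ (by simpa using hsum.const_mul K)
      filter_upwards [hpos.prod_mk hpos, hsum.eventually (ge_mem_nhds he₀)] with p hp he
      have := hn p.1 p.2 hp.1 hp.2 he
      simpa [dist_eq_norm] using this
    exact cauchy_map_iff_exists_tendsto.1 hc
  · have hsum : Tendsto (fun p : ℕ × ℝ => p.2 / a + r p.1) (atTop ×ˢ 𝓝[>] 0) (𝓝 0) := by
      simpa using ((hid.comp tendsto_snd).div_const a).add (hr.comp tendsto_fst)
    refine squeeze_zero_norm' ?_ (by simpa using hsum.const_mul K)
    filter_upwards [hL.prod_mk hpos, hsum.eventually (ge_mem_nhds he₀)] with p hp he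
    simpa using hp.1 p.2 hp.2 he
  · filter_upwards [hL, hE] with n hn hEn hE'
    have hsum : Tendsto (fun γ : ℝ => γ / a) (𝓝[>] 0) (𝓝 0) := by simpa using hid.div_const a
    rw [tendsto_iff_norm_sub_tendsto_zero]
    refine squeeze_zero_norm' ?_ (by simpa using hsum.const_mul K)
    filter_upwards [hpos, hsum.eventually (ge_mem_nhds he₀)] with γ hγ he
    have := hn γ hγ
    rw [hEn hE', add_zero] at this
    simpa using this he

end SmallGamma

theorem opNorm_le_sqrt {ι τ : Type*} [Fintype ι] [Fintype τ] [DecidableEq ι] [DecidableEq τ]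
    {A : Matrix ι τ ℝ} {K : ℝ} (h : ‖A * Aᵀ‖ ≤ K) :
    ‖A‖ ≤ √K ∧ ‖Aᵀ‖ ≤ √K := by
  have e : ‖A‖ = ‖Aᵀ‖ := by
    rw [← conjTranspose_eq_transpose_of_trivial, l2_opNorm_conjTranspose]
  have := l2_opNorm_conjTranspose_mul_self Aᴴ
  rw [conjTranspose_conjTranspose, conjTranspose_eq_transpose_of_trivial] at this
  have h2 : ‖Aᵀ‖ ≤ √K := Real.le_sqrt_of_sq_le (by rw [sq, ← this]; exact h)
  exact ⟨e ▸ h2, h2⟩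

section Asymptotics

variable {T : ℕ → ℕ} {η : ℝ} {W B : ∀ n, Matrix (Fin n) (Fin n) ℝ}
  {A : ∀ n, Matrix (Fin n) (Fin (T n)) ℝ} {c K Kb ρ : ℝ}
  {R G : ∀ n, ℝ → Matrix (Fin (T n)) (Fin (T n)) ℝ} {Rt Gt : ∀ n, ℝ → Matrix (Fin n) (Fin n) ℝ}
  {Rlim Glim : ∀ n, Matrix (Fin (T n)) (Fin (T n)) ℝ} {Rtlim Gtlim : ∀ n, Matrix (Fin n) (Fin n) ℝ}

theorem tendsto_one_div_of_ratio (hc : Tendsto (fun n : ℕ => (n : ℝ) / (T n : ℝ)) atTop (𝓝 c)) :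
    Tendsto (fun n => 1 / (T n : ℝ)) atTop (𝓝 0) := by
  have := hc.mul tendsto_one_div_atTop_nhds_zero_nat
  rw [mul_zero] at this
  refine this.congr' ?_
  filter_upwards [eventually_gt_atTop 0] with n hn
  have : (n : ℝ) ≠ 0 := by positivity
  field_simp

theorem smallGammaLimit_of_lt (hT : ∀ n, 0 < T n) (hη : 0 < η) (hρ0 : 0 < ρ) (hρ1 : ρ < 1)
    (hW : ∀ n, ‖W n‖ ≤ ρ) (hAK : ∀ n, ‖A n * (A n)ᵀ‖ ≤ K)
    (htr : Tendsto (fun n => 1 / (T n : ℝ) * (A n * (A n)ᵀ).trace) atTop (𝓝 0))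
    (hc0 : 0 ≤ c) (hc1 : c < 1) (hc : Tendsto (fun n : ℕ => (n : ℝ) / (T n : ℝ)) atTop (𝓝 c))
    (hKb : 0 < Kb) (hB : ∀ n, ‖B n‖ ≤ Kb)
    (hγ : ∀ᶠ n in atTop, ∀ γ : ℝ, 0 < γ → IsFirstOrder (W n) (A n) η γ (R n γ) (Rt n γ) ∧
      IsSecondOrder (W n) (A n) (B n) η γ (R n γ) (Rt n γ) (G n γ) (Gt n γ))
    (hlim : ∀ᶠ n in atTop, IsLimitFirstOrder (W n) c (Rlim n) (Rtlim n) ∧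
      IsLimitSecondOrder (W n) (B n) c (Rlim n) (Rtlim n) (Glim n) (Gtlim n)) :
    SmallGammaLimit (fun n => A n = 0 ∧ (n : ℝ) / (T n : ℝ) = c) (fun n γ => η ^ 4 • G n γ) Glim ∧
      SmallGammaLimit (fun n => A n = 0 ∧ (n : ℝ) / (T n : ℝ) = c) Gt Gtlim := by
  set C : ℝ := (1 - ρ)⁻¹ ^ 2 with hC
  have hC0 : 0 ≤ C := sq_nonneg _
  have hv0 : 0 < (1 - c) / 8 := by linarith
  obtain ⟨e₁, he₁, K₁, hK₁, H₁⟩ := exists_norm_sub_le_self (v₀ := (1 - c) / 8) (c₁ := C)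
    (a := (η⁻¹ * √K) ^ 2) (b := Kb) hv0 hC0 (sq_nonneg _) hKb
  obtain ⟨e₂, he₂, K₂, hK₂, H₂⟩ := exists_norm_sub_le_zero (v₀ := (1 - c) / 8) (c₁ := C)
    (b := Kb) hv0 hC0 hKb
  set r : ℕ → ℝ := fun n => C * (η⁻¹ ^ 2) * (1 / (T n : ℝ) * (A n * (A n)ᵀ).trace) +
    C * |c - (n : ℝ) / T n| with hrdef
  have hr : Tendsto r atTop (𝓝 0) := by
    have h1 := htr.const_mul (C * η⁻¹ ^ 2)
    have h2 := ((tendsto_const_nhds (x := c)).sub hc).abs.const_mul C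
    have h := h1.add h2
    simp only [mul_zero, sub_self, abs_zero, add_zero] at h
    exact h
  have hE : ∀ᶠ n in atTop, (A n = 0 ∧ (n : ℝ) / (T n : ℝ) = c) → r n = 0 := by
    filter_upwards with n h
    simp [hrdef, h.1, h.2]
  have hη2 : 0 < η ^ 2 := by positivity
  have hmain : ∀ᶠ n in atTop, (∀ γ γ' : ℝ, 0 < γ → 0 < γ' → (γ + γ') / η ^ 2 ≤ min e₁ e₂ →
      ‖η ^ 4 • G n γ - η ^ 4 • G n γ'‖ ≤ max K₁ K₂ * ((γ + γ') / η ^ 2) ∧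
        ‖Gt n γ - Gt n γ'‖ ≤ max K₁ K₂ * ((γ + γ') / η ^ 2)) ∧
      ∀ γ : ℝ, 0 < γ → γ / η ^ 2 + r n ≤ min e₁ e₂ →
        ‖η ^ 4 • G n γ - Glim n‖ ≤ max K₁ K₂ * (γ / η ^ 2 + r n) ∧
          ‖Gt n γ - Gtlim n‖ ≤ max K₁ K₂ * (γ / η ^ 2 + r n) := by
    filter_upwards [hγ, hlim, eventually_gt_atTop 0,
      hc.eventually (ge_mem_nhds (show c < (1 + c) / 2 by linarith))] with n hsol hl hn hnc
    have hTn : (0 : ℝ) < T n := by exact_mod_cast hT n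
    have hn' : (0 : ℝ) < n := by exact_mod_cast hn
    have hD := dualPair_toeplitzMap_shiftMap (hW n) hρ0 hρ1 (hT n)
    rw [← hC] at hD
    have e1 : 1 / (T n : ℝ) * (1 / 4) * ((T n : ℝ) - n) = (1 - n / T n) / 4 := by field_simp
    have e2 : 1 / (T n : ℝ) * C * (T n : ℝ) = C := by field_simp
    have e3 : 1 / (T n : ℝ) * C * (n : ℝ) = C * (n / T n) := by field_simp
    have e4 : 1 / (T n : ℝ) * (1 / 4) * ((T n : ℝ) - c * (1 / (n : ℝ)) * T n * n) = (1 - c) / 4 := by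
      field_simp
    have e5 : c * (1 / (n : ℝ)) * T n * (n / T n) = c := by field_simp
    have hv1 : (1 - c) / 8 ≤ 1 / (T n : ℝ) * (1 / 4) *
        ((Fintype.card (Fin (T n)) : ℝ) - Fintype.card (Fin n)) := by
      rw [Fintype.card_fin, Fintype.card_fin, e1]; linarith
    have hτ : 1 / (T n : ℝ) * C * (Fintype.card (Fin (T n)) : ℝ) ≤ C := by
      rw [Fintype.card_fin, e2]
    have hι : 1 / (T n : ℝ) * C * (Fintype.card (Fin n) : ℝ) ≤ C := by
      rw [Fintype.card_fin, e3]; nlinarith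
    have hA := (opNorm_le_sqrt (hAK n)).1
    have hA' : ‖η⁻¹ • A n‖ ≤ η⁻¹ * √K := by
      rw [norm_smul, Real.norm_of_nonneg (by positivity)]; gcongr
    have hr0 : 0 ≤ r n := by
      have : 0 ≤ (A n * (A n)ᵀ).trace := by
        simpa using (posSemidef_self_mul_conjTranspose (A n)).trace_nonneg
      positivity
    have hB0 : ‖(0 : Matrix (Fin (T n)) (Fin (T n)) ℝ)‖ ≤ Kb := by simpa using hKb.le
    refine ⟨fun γ γ' h0 h0' he => ?_, fun γ h0 he => ?_⟩
    · have hdiv : γ / η ^ 2 ≤ (γ + γ') / η ^ 2 := by gcongr; linarith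
      have hdiv' : γ' / η ^ 2 ≤ (γ + γ') / η ^ 2 := by gcongr; linarith
      obtain ⟨h1, h2⟩ := H₁ hD hv1 hτ hι (transpose_mul_self_le hA') (e := (γ + γ') / η ^ 2)
        (by positivity) (he.trans (min_le_left _ _)) (by positivity) hdiv (by positivity) hdiv'
        (hB n) hB0 ((hsol γ h0).1.isSol hη h0) ((hsol γ' h0').1.isSol hη h0')
        ((hsol γ h0).1.isSol₂ hη h0 (hsol γ h0).2) ((hsol γ' h0').1.isSol₂ hη h0' (hsol γ' h0').2)
      have hle : K₁ * ((γ + γ') / η ^ 2) ≤ max K₁ K₂ * ((γ + γ') / η ^ 2) := by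
        gcongr; exact le_max_left _ _
      exact ⟨h2.trans hle, h1.trans hle⟩
    · have hF : ((η⁻¹ • A n) * (η⁻¹ • A n)ᵀ).trace ≤ η⁻¹ ^ 2 * (A n * (A n)ᵀ).trace := by
        rw [transpose_smul, Matrix.smul_mul, Matrix.mul_smul, smul_smul, trace_smul, smul_eq_mul, sq]
      obtain ⟨h1, h2, -⟩ := H₂ hD hv1 (t := c * (1 / (n : ℝ)) * T n)
        (by rw [Fintype.card_fin, Fintype.card_fin, e4]; linarith) (by positivity) hτ hι
        (by rw [Fintype.card_fin, e3, mul_left_comm, e5]; nlinarith) (e := γ / η ^ 2 + r n)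
        (by positivity) (he.trans (min_le_right _ _)) (by positivity) (by linarith) hF
        (by
          have h1 : 0 ≤ C * |c - (n : ℝ) / T n| := by positivity
          have h2 : 0 < γ / η ^ 2 := by positivity
          simp only [hrdef]; linarith)
        (by
          have h1 : 0 ≤ C * η⁻¹ ^ 2 * (1 / (T n : ℝ) * (A n * (A n)ᵀ).trace) := by
            have : 0 ≤ (A n * (A n)ᵀ).trace := by
              simpa using (posSemidef_self_mul_conjTranspose (A n)).trace_nonneg
            positivity
          have h2 : 0 < γ / η ^ 2 := by positivity
          have h3 : |c * (1 / (n : ℝ)) * T n - 1| * (C * (n / T n)) = C * |c - (n : ℝ) / T n| := by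
            rw [← abs_of_nonneg (show 0 ≤ (n : ℝ) / T n by positivity), mul_left_comm, ← abs_mul,
              sub_mul, abs_of_nonneg (show 0 ≤ (n : ℝ) / T n by positivity), e5, one_mul]
          rw [Fintype.card_fin, e3, h3]
          simp only [hrdef]; linarith)
        (hB n) hB0 ((hsol γ h0).1.isSol hη h0) (hl.1.isSol hc1 (hT n))
        ((hsol γ h0).1.isSol₂ hη h0 (hsol γ h0).2) (hl.2.isSol₂ hc1 (hT n))
      have hle : K₂ * (γ / η ^ 2 + r n) ≤ max K₁ K₂ * (γ / η ^ 2 + r n) := by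
        gcongr; exact le_max_right _ _
      exact ⟨h2.trans hle, h1.trans hle⟩
  have he₀ : 0 < min e₁ e₂ := lt_min he₁ he₂
  exact ⟨smallGammaLimit_of_bounds he₀ hr
    (hmain.mono fun n h γ γ' h0 h0' he => (h.1 γ γ' h0 h0' he).1)
    (hmain.mono fun n h γ h0 he => (h.2 γ h0 he).1) hE,
    smallGammaLimit_of_bounds he₀ hr
    (hmain.mono fun n h γ γ' h0 h0' he => (h.1 γ γ' h0 h0' he).2)
    (hmain.mono fun n h γ h0 he => (h.2 γ h0 he).2) hE⟩

set_option maxHeartbeats 800000 in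
theorem smallGammaLimit_of_gt (hT : ∀ n, 0 < T n) (hη : 0 < η) (hρ0 : 0 < ρ) (hρ1 : ρ < 1)
    (hW : ∀ n, ‖W n‖ ≤ ρ) (hAK : ∀ n, ‖A n * (A n)ᵀ‖ ≤ K)
    (htr : Tendsto (fun n => 1 / (T n : ℝ) * (A n * (A n)ᵀ).trace) atTop (𝓝 0))
    (hc1 : 1 < c) (hc : Tendsto (fun n : ℕ => (n : ℝ) / (T n : ℝ)) atTop (𝓝 c))
    (hKb : 0 < Kb) (hB : ∀ n, ‖B n‖ ≤ Kb)
    (hγ : ∀ᶠ n in atTop, ∀ γ : ℝ, 0 < γ → IsFirstOrder (W n) (A n) η γ (R n γ) (Rt n γ) ∧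
      IsSecondOrder (W n) (A n) (B n) η γ (R n γ) (Rt n γ) (G n γ) (Gt n γ))
    (hlim : ∀ᶠ n in atTop, IsLimitFirstOrder (W n) c (Rlim n) (Rtlim n) ∧
      IsLimitSecondOrder (W n) (B n) c (Rlim n) (Rtlim n) (Glim n) (Gtlim n)) :
    SmallGammaLimit (fun n => A n = 0 ∧ (n : ℝ) / (T n : ℝ) = c) (fun n γ => γ ^ 2 • G n γ) Glim ∧
      SmallGammaLimit (fun n => A n = 0 ∧ (n : ℝ) / (T n : ℝ) = c) Gt Gtlim := by
  set C : ℝ := (1 - ρ)⁻¹ ^ 2 with hC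
  have hC0 : 0 ≤ C := sq_nonneg _
  have hc0 : 0 < c := by linarith
  have hv0 : 0 < (1 - 1 / c) / 8 := by
    have : 1 / c < 1 := (div_lt_one hc0).2 hc1
    linarith
  obtain ⟨e₁, he₁, K₁, hK₁, H₁⟩ := exists_norm_sub_le_self (v₀ := (1 - 1 / c) / 8) (c₁ := C * (c + 1))
    (a := (η⁻¹ * √K) ^ 2) (b := Kb) hv0 (by positivity) (sq_nonneg _) hKb
  obtain ⟨e₂, he₂, K₂, hK₂, H₂⟩ := exists_norm_sub_le_zero (v₀ := (1 - 1 / c) / 8) (c₁ := C * (c + 1))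
    (b := Kb) hv0 (by positivity) hKb
  set r : ℕ → ℝ := fun n => C * (η⁻¹ ^ 2) * (1 / (T n : ℝ) * (A n * (A n)ᵀ).trace) +
    (C + 1) * |(n : ℝ) / T n / c - 1| with hrdef
  have hs : Tendsto (fun n : ℕ => (n : ℝ) / T n / c) atTop (𝓝 1) := by
    simpa [div_self hc0.ne'] using hc.div_const c
  have hr : Tendsto r atTop (𝓝 0) := by
    have h1 := htr.const_mul (C * η⁻¹ ^ 2)
    have h2 := (hs.sub_const 1).abs.const_mul (C + 1)
    have h := h1.add h2
    simp only [mul_zero, sub_self, abs_zero, add_zero] at h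
    exact h
  have hE : ∀ᶠ n in atTop, (A n = 0 ∧ (n : ℝ) / (T n : ℝ) = c) → r n = 0 := by
    filter_upwards with n h
    simp [hrdef, h.1, h.2, div_self hc0.ne']
  have hη2 : 0 < η ^ 2 := by positivity
  have hmain : ∀ᶠ n in atTop, (∀ γ γ' : ℝ, 0 < γ → 0 < γ' → (γ + γ') / η ^ 2 ≤ min e₁ e₂ →
      ‖γ ^ 2 • G n γ - γ' ^ 2 • G n γ'‖ ≤ max K₁ (3 * K₂) * ((γ + γ') / η ^ 2) ∧
        ‖Gt n γ - Gt n γ'‖ ≤ max K₁ (3 * K₂) * ((γ + γ') / η ^ 2)) ∧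
      ∀ γ : ℝ, 0 < γ → γ / η ^ 2 + r n ≤ min e₁ e₂ →
        ‖γ ^ 2 • G n γ - Glim n‖ ≤ max K₁ (3 * K₂) * (γ / η ^ 2 + r n) ∧
          ‖Gt n γ - Gtlim n‖ ≤ max K₁ (3 * K₂) * (γ / η ^ 2 + r n) := by
    filter_upwards [hγ, hlim, eventually_gt_atTop 0,
      hc.eventually (le_mem_nhds (show (1 + c) / 2 < c by linarith)),
      hc.eventually (ge_mem_nhds (show c < c + 1 by linarith)),
      hs.eventually (le_mem_nhds (show (1 / 2 : ℝ) < 1 by norm_num))] with n hsol hl hn hnc hnc' hns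
    have hTn : (0 : ℝ) < T n := by exact_mod_cast hT n
    have hn' : (0 : ℝ) < n := by exact_mod_cast hn
    have hD := (dualPair_toeplitzMap_shiftMap (hW n) hρ0 hρ1 (hT n)).symm
    rw [← hC] at hD
    set s : ℝ := (n : ℝ) / T n / c with hsdef
    have hs0 : 0 < s := by positivity
    have hst : (c * (1 / (n : ℝ)) * T n)⁻¹ = s := by rw [hsdef]; field_simp
    have hsc : s * c = n / T n := by rw [hsdef]; field_simp
    have e1 : 1 / (T n : ℝ) * (1 / 4) * ((n : ℝ) - T n) = (n / T n - 1) / 4 := by field_simp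
    have e2 : 1 / (T n : ℝ) * C * (T n : ℝ) = C := by field_simp
    have e3 : 1 / (T n : ℝ) * C * (n : ℝ) = C * (n / T n) := by field_simp
    have e4 : 1 / (T n : ℝ) * (1 / 4) * ((n : ℝ) - s * T n) = (n / T n - s) / 4 := by field_simp
    have hcc : c * (1 - 1 / c) = c - 1 := by field_simp
    have hcs : s * (c - 1) = s * c * (1 - 1 / c) := by rw [mul_assoc, hcc]
    have hv1 : (1 - 1 / c) / 8 ≤ 1 / (T n : ℝ) * (1 / 4) *
        ((Fintype.card (Fin n) : ℝ) - Fintype.card (Fin (T n))) := by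
      rw [Fintype.card_fin, Fintype.card_fin, e1]
      have : 0 ≤ (c - 1) * (1 - 1 / c) := mul_nonneg (by linarith) (by linarith)
      linarith
    have hτ : 1 / (T n : ℝ) * C * (Fintype.card (Fin n) : ℝ) ≤ C * (c + 1) := by
      rw [Fintype.card_fin, e3]; gcongr
    have hι : 1 / (T n : ℝ) * C * (Fintype.card (Fin (T n)) : ℝ) ≤ C * (c + 1) := by
      rw [Fintype.card_fin, e2]; exact le_mul_of_one_le_right hC0 (by linarith)
    have hsle : s ≤ c + 1 := (le_mul_of_one_le_right hs0.le hc1.le).trans (hsc.trans_le hnc')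
    have hA := (opNorm_le_sqrt (hAK n)).2
    have hA' : ‖η⁻¹ • (A n)ᵀ‖ ≤ η⁻¹ * √K := by
      rw [norm_smul, Real.norm_of_nonneg (by positivity)]; gcongr
    have htr0 : 0 ≤ C * η⁻¹ ^ 2 * (1 / (T n : ℝ) * (A n * (A n)ᵀ).trace) := by
      have : 0 ≤ (A n * (A n)ᵀ).trace := by
        simpa using (posSemidef_self_mul_conjTranspose (A n)).trace_nonneg
      positivity
    have hs1 : 0 ≤ |s - 1| := abs_nonneg _
    have hCs : 0 ≤ C * |s - 1| := by positivity
    have hrn : r n = C * η⁻¹ ^ 2 * (1 / (T n : ℝ) * (A n * (A n)ᵀ).trace) +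
        (C + 1) * |s - 1| := rfl
    have hr0 : 0 ≤ r n := by rw [hrn]; positivity
    have hv2 : (1 - 1 / c) / 8 ≤ ((n : ℝ) / T n - s) / 4 := by
      have h1 : (n : ℝ) / T n - s = n / T n * (1 - 1 / c) := by rw [← hsc, ← hcs]; ring
      have h2 : 1 ≤ (n : ℝ) / T n := by linarith
      have := mul_le_mul_of_nonneg_right h2 (show 0 ≤ 1 - 1 / c by linarith)
      rw [h1]; linarith
    have hsC : s * C ≤ C * (c + 1) := by rw [mul_comm s]; gcongr
    have hB0 : ‖(0 : Matrix (Fin (T n)) (Fin (T n)) ℝ)‖ ≤ Kb := by simpa using hKb.le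
    refine ⟨fun γ γ' h0 h0' he => ?_, fun γ h0 he => ?_⟩
    · have hdiv : γ / η ^ 2 ≤ (γ + γ') / η ^ 2 := by gcongr; linarith
      have hdiv' : γ' / η ^ 2 ≤ (γ + γ') / η ^ 2 := by gcongr; linarith
      obtain ⟨h1, h2⟩ := H₁ hD hv1 hτ hι (transpose_mul_self_le hA') (e := (γ + γ') / η ^ 2)
        (by positivity) (he.trans (min_le_left _ _)) (by positivity) hdiv (by positivity) hdiv'
        hB0 (hB n) ((hsol γ h0).1.isSol_swap hη h0) ((hsol γ' h0').1.isSol_swap hη h0')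
        ((hsol γ h0).1.isSol₂_swap hη h0 (hsol γ h0).2) ((hsol γ' h0').1.isSol₂_swap hη h0' (hsol γ' h0').2)
      have hle : K₁ * ((γ + γ') / η ^ 2) ≤ max K₁ (3 * K₂) * ((γ + γ') / η ^ 2) := by
        gcongr; exact le_max_left _ _
      exact ⟨h1.trans hle, h2.trans hle⟩
    · have hF : ((η⁻¹ • (A n)ᵀ) * (η⁻¹ • (A n)ᵀ)ᵀ).trace ≤ η⁻¹ ^ 2 * (A n * (A n)ᵀ).trace := by
        rw [transpose_smul, transpose_transpose, Matrix.smul_mul, Matrix.mul_smul, smul_smul,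
          trace_smul, smul_eq_mul, sq, trace_mul_comm]
      have hγ0 : 0 < γ / η ^ 2 := by positivity
      have hse : |s - 1| ≤ γ / η ^ 2 + r n := by linarith
      have hlim₁ := hl.1.isSol_swap hc1 (hT n) hn
      have hlim₂ := hl.1.isSol₂_swap hl.2 hc1 (hT n) hn
      rw [hst] at hlim₁ hlim₂
      obtain ⟨h1, h2, h3⟩ := H₂ hD hv1 (t := s)
        (by rw [Fintype.card_fin, Fintype.card_fin, e4]; exact hv2) hs0.le hτ hι
        (by rw [Fintype.card_fin, e2]; exact hsC) (e := γ / η ^ 2 + r n)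
        (by positivity) (he.trans (min_le_right _ _)) (by positivity) (by linarith) hF
        (by linarith) (by rw [Fintype.card_fin, e2]; linarith)
        hB0 (hB n) ((hsol γ h0).1.isSol_swap hη h0) hlim₁
        ((hsol γ h0).1.isSol₂_swap hη h0 (hsol γ h0).2) hlim₂
      have hGl : ‖Glim n‖ ≤ 2 * K₂ := by
        rw [norm_smul, Real.norm_of_nonneg hs0.le] at h3
        have := mul_le_mul_of_nonneg_right hns (norm_nonneg (Glim n))
        linarith
      have h4 : ‖s • Glim n - Glim n‖ ≤ 2 * K₂ * (γ / η ^ 2 + r n) := by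
        rw [show s • Glim n - Glim n = (s - 1) • Glim n by rw [sub_smul, one_smul], norm_smul, Real.norm_eq_abs, mul_comm]
        gcongr
      have hle : 3 * K₂ * (γ / η ^ 2 + r n) ≤ max K₁ (3 * K₂) * (γ / η ^ 2 + r n) := by
        gcongr; exact le_max_right _ _
      have h5 := norm_sub_le_norm_sub_add_norm_sub (γ ^ 2 • G n γ) (s • Glim n) (Glim n)
      have h6 : 0 ≤ K₂ * (γ / η ^ 2 + r n) := by positivity
      exact ⟨by linarith, by linarith⟩
  have he₀ : 0 < min e₁ e₂ := lt_min he₁ he₂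
  exact ⟨smallGammaLimit_of_bounds he₀ hr
    (hmain.mono fun n h γ γ' h0 h0' he => (h.1 γ γ' h0 h0' he).1)
    (hmain.mono fun n h γ h0 he => (h.2 γ h0 he).1) hE,
    smallGammaLimit_of_bounds he₀ hr
    (hmain.mono fun n h γ γ' h0 h0' he => (h.1 γ γ' h0 h0' he).2)
    (hmain.mono fun n h γ h0 he => (h.2 γ h0 he).2) hE⟩

end Asymptotics

end ESN

theorem proposition2
    (T : ℕ → ℕ) (hT : ∀ n, 0 < T n)
    (η : ℝ) (hη : 0 < η)
    (W : ∀ n, Matrix (Fin n) (Fin n) ℝ)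
    (hW : ∃ ρ < (1 : ℝ), ∀ n, ‖W n‖ ≤ ρ)
    (m : ∀ n, Fin n → ℝ) (u : ℕ → ℤ → ℝ)
    (A : ∀ n, Matrix (Fin n) (Fin (T n)) ℝ)
    (hA : ∀ n, A n = ESN.dataMatrix (W n) (m n) (u n) (T n))
    (hAbdd : ∃ K : ℝ, ∀ n, ‖A n * (A n)ᵀ‖ ≤ K)
    (c : ℝ) (hc0 : 0 ≤ c) (hc1 : c ≠ 1)
    (hc : Tendsto (fun n : ℕ => (n : ℝ) / (T n : ℝ)) atTop (𝓝 c))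
    (B : ∀ n, Matrix (Fin n) (Fin n) ℝ)
    (hBsymm : ∀ n, (B n).IsSymm)
    (hBbdd : ∃ K : ℝ, ∀ n, ‖B n‖ ≤ K) :
    -- for all large `n`, all the systems have solutions
    (∀ᶠ n in atTop,
      (∃ R Rt, ESN.IsLimitFirstOrder (T := T n) (W n) c R Rt ∧
        ∃ G Gt, ESN.IsLimitSecondOrder (W n) (B n) c R Rt G Gt) ∧
      ∀ γ : ℝ, 0 < γ → ∃ R Rt, ESN.IsFirstOrder (W n) (A n) η γ R Rt ∧
        ∃ G Gt, ESN.IsSecondOrder (W n) (A n) (B n) η γ R Rt G Gt) ∧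
    -- and, whatever the solutions, the rescaled matrices converge
    (∀ (R : ∀ n, ℝ → Matrix (Fin (T n)) (Fin (T n)) ℝ)
       (Rt : ∀ n, ℝ → Matrix (Fin n) (Fin n) ℝ)
       (G : ∀ n, ℝ → Matrix (Fin (T n)) (Fin (T n)) ℝ)
       (Gt : ∀ n, ℝ → Matrix (Fin n) (Fin n) ℝ)
       (Rlim : ∀ n, Matrix (Fin (T n)) (Fin (T n)) ℝ)
       (Rtlim : ∀ n, Matrix (Fin n) (Fin n) ℝ)
       (Glim : ∀ n, Matrix (Fin (T n)) (Fin (T n)) ℝ)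
       (Gtlim : ∀ n, Matrix (Fin n) (Fin n) ℝ),
      (∀ᶠ n in atTop, ∀ γ : ℝ, 0 < γ →
        ESN.IsFirstOrder (W n) (A n) η γ (R n γ) (Rt n γ) ∧
        ESN.IsSecondOrder (W n) (A n) (B n) η γ (R n γ) (Rt n γ) (G n γ) (Gt n γ)) →
      (∀ᶠ n in atTop,
        ESN.IsLimitFirstOrder (W n) c (Rlim n) (Rtlim n) ∧
        ESN.IsLimitSecondOrder (W n) (B n) c (Rlim n) (Rtlim n) (Glim n) (Gtlim n)) →
      (c < 1 →
        ESN.SmallGammaLimit (fun n => A n = 0 ∧ (n : ℝ) / (T n : ℝ) = c)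
          (fun n γ => η ^ 4 • G n γ) Glim ∧
        ESN.SmallGammaLimit (fun n => A n = 0 ∧ (n : ℝ) / (T n : ℝ) = c) Gt Gtlim) ∧
      (1 < c →
        ESN.SmallGammaLimit (fun n => A n = 0 ∧ (n : ℝ) / (T n : ℝ) = c)
          (fun n γ => γ ^ 2 • G n γ) Glim ∧
        ESN.SmallGammaLimit (fun n => A n = 0 ∧ (n : ℝ) / (T n : ℝ) = c) Gt Gtlim)) := by
  
  obtain ⟨ρ', hρ', hW'⟩ := hW
  obtain ⟨K, hK⟩ := hAbdd
  obtain ⟨Kb, hKb⟩ := hBbdd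
  have hρ0 : 0 < max ρ' (1 / 2) := lt_max_of_lt_right (by norm_num)
  have hρ1 : max ρ' (1 / 2) < 1 := max_lt hρ' (by norm_num)
  have hW : ∀ n, ‖W n‖ ≤ max ρ' (1 / 2) := fun n => (hW' n).trans (le_max_left _ _)
  refine ⟨?_, ?_⟩
  · filter_upwards [eventually_gt_atTop 0] with n hn
    have hD := ESN.dualPair_toeplitzMap_shiftMap (hW n) hρ0 hρ1 (hT n)
    refine ⟨?_, fun γ hγ => ESN.exists_isFirstOrder_isSecondOrder hD hη hγ (A n) (B n)⟩
    rcases hc1.lt_or_gt with h | h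
    · exact ESN.exists_isLimit_of_lt hD hc0 h (hT n) hn (B n)
    · exact ESN.exists_isLimit_of_gt hD h (hT n) hn (B n)
  · intro R Rt G Gt Rlim Rtlim Glim Gtlim hγ hlim
    have htr : Tendsto (fun n => 1 / (T n : ℝ) * (A n * (A n)ᵀ).trace) atTop (𝓝 0) := by
      have hb := (ESN.tendsto_one_div_of_ratio hc).mul_const (12 * K / (1 - max ρ' (1 / 2)) ^ 2)
      rw [zero_mul] at hb
      refine squeeze_zero (fun n => ?_) (fun n => ?_) hb
      · have : 0 ≤ (A n * (A n)ᵀ).trace := by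
          simpa using (Matrix.posSemidef_self_mul_conjTranspose (A n)).trace_nonneg
        positivity
      · have := hK n
        rw [hA n] at this ⊢
        gcongr
        exact ESN.trace_dataMatrix_le (hW n) hρ0 hρ1 (hT n) this
    have hB : ∀ n, ‖B n‖ ≤ |Kb| + 1 := fun n => by linarith [hKb n, le_abs_self Kb]
    have hKb0 : 0 < |Kb| + 1 := by positivity
    exact ⟨fun h => ESN.smallGammaLimit_of_lt hT hη hρ0 hρ1 hW hK htr hc0 h hc hKb0 hB hγ hlim,
      fun h => ESN.smallGammaLimit_of_gt hT hη hρ0 hρ1 hW hK htr h hc hKb0 hB hγ hlim⟩
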